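/- Let $\Bbbk=\mathbb C(q)$, let $m,n$ be natural numbers, and let $[\![a,b]\!]$ be $1$ if $a=b$ and $0$ otherwise. **The quantum groups.** $U_q(\mathfrak{gl}_n)$ is the $\Bbbk$-algebra generated by $E_k,F_k$ ($1\le k\le n-1$) and $K_{\varepsilon_i}^{\pm1}$ ($1\le i\le n$), with $K_{\varepsilon_i}K_{\varepsilon_i}^{-1}=K_{\varepsilon_i}^{-1}K_{\varepsilon_i}=1$, $K_{\varepsilon_i}K_{\varepsilon_j}=K_{\varepsilon_j}K_{\varepsilon_i}$, $K_{\varepsilon_i}E_kK_{\varepsilon_i}^{-1}=q^{[\![i,k]\!]-[\![i,k+1]\!]}E_k$, $K_{\varepsilon_i}F_kK_{\varepsilon_i}^{-1}=q^{-[\![i,k]\!]+[\![i,k+1]\!]}F_k$, $E_kF_l-F_lE_k=[\![k,l]\!]\frac{K_k-K_k^{-1}}{q-q^{-1}}$ where $K_k=K_{\varepsilon_k}K_{\varepsilon_{k+1}}^{-1}$, and the quantum Serre relations. Its coproduct is $\Delta(E_k)=E_k\otimes K_k+1\otimes E_k$, $\Delta(F_k)=F_k\otimes1+K_k^{-1}\otimes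 F_k$, $\Delta(K_{\varepsilon_i})=K_{\varepsilon_i}\otimes K_{\varepsilon_i}$. For $\lambda=\sum_i\lambda_i\varepsilon_i$ with $\lambda_i\in\mathbb Z$ put $K_\lambda=\prod_iK_{\varepsilon_i}^{\lambda_i}$. Put $U_L=U_q(\mathfrak{gl}_m)$, $U_R=U_q(\mathfrak{gl}_n)$ and $U_{LR}=U_L\otimes U_R$. **The algebra $\mathscr P$.** $\mathscr P$ is the $\Bbbk$-algebra generated by $t_{i,j}$ ($1\le i\le m$, $1\le j\le n$) with the relations $t_{k,i}t_{k,j}=q\,t_{k,j}t_{k,i}$ and $t_{i,k}t_{j,k}=q\,t_{j,k}t_{i,k}$ for $i<j$, and $t_{i,l}t_{k,j}=t_{k,j}t_{i,l}$ and $t_{i,j}t_{k,l}-t_{k,l}t_{i,j}=(q-q^{-1})t_{i,l}t_{k,j}$ for $i<k$, $j<l$. It is a $U_{LR}$-module algebra, through the coproduct above and the commuting actions $$E_k t_{i,j}=-[\![k,i]\!]\,q^{-1}t_{k+1,j},\quad F_k t_{i,j}=-[\![k+1,i]\!]\,q\,t_{k,j},\quad K_{\varepsilon_k}t_{i,j}=q^{-[\![k,i]\!]}t_{i,j}$$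 of $U_L$ and $$E_k t_{i,j}=-[\![k,j]\!]\,q^{-1}t_{i,k+1},\quad F_k t_{i,j}=-[\![k+1,j]\!]\,q\,t_{i,k},\quad K_{\varepsilon_k}t_{i,j}=q^{-[\![k,j]\!]}t_{i,j}$$ of $U_R$. Let $\phi_U:U_{LR}\to\operatorname{End}_{\Bbbk}(\mathscr P)$ be the resulting homomorphism. **The algebra $\mathscr{PD}$.** $\mathscr{PD}$ is the $\Bbbk$-algebra generated by $t_{i,j}$ and $\partial_{i,j}$ ($1\le i\le m$, $1\le j\le n$) with the relations of $\mathscr P$ for the $t_{i,j}$; the relations $\partial_{k,j}\partial_{k,i}=q\,\partial_{k,i}\partial_{k,j}$ and $\partial_{j,k}\partial_{i,k}=q\,\partial_{i,k}\partial_{j,k}$ for $i<j$, and $\partial_{k,j}\partial_{i,l}=\partial_{i,l}\partial_{k,j}$ and $\partial_{k,l}\partial_{i,j}-\partial_{i,j}\partial_{k,l}=(q-q^{-1})\partial_{k,j}\partial_{i,l}$ for $i<k$, $j<l$; and, for all indices, $$\partial_{\bar a_1,\bar a_2}t_{a_1,a_2}=[\![a_1,\bar a_1]\!][\![a_2,\bar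 a_2]\!]+\sum_{b_1\ge a_1}\sum_{\bar b_1\ge\bar a_1}\sum_{b_2\ge a_2}\sum_{\bar b_2\ge\bar a_2}c_1c_2\;t_{b_1,b_2}\partial_{\bar b_1,\bar b_2},$$ $$c_r=[\![a_r,\bar a_r]\!][\![b_r,\bar b_r]\!][\![a_r,b_r]\!]_q+(1-[\![a_r,\bar a_r]\!])[\![a_r,b_r]\!][\![\bar a_r,\bar b_r]\!],$$ where $[\![a,b]\!]_q$ is $q$ if $a=b$ and $q-q^{-1}$ otherwise. Let $\mathscr I$ be the left ideal of $\mathscr{PD}$ generated by the $\partial_{i,j}$. The canonical map $\mathscr P\to\mathscr{PD}/\mathscr I$ is bijective, and so $\mathscr{PD}$ acts on $\mathscr P$; let $\phi_{PD}:\mathscr{PD}\to\operatorname{End}_{\Bbbk}(\mathscr P)$ be this action. Put $$\mathring U_{LR}=\{x\in U_{LR}:\phi_U(x)\in\phi_{PD}(\mathscr{PD})\},\quad \mathring U_L=\{x\in U_L:x\otimes1\in\mathring U_{LR}\},\quad \mathring U_R=\{x\in U_R:1\otimes x\in\mathring U_{LR}\}.$$ **Proposition.** For $1\le a\le m$ and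 $1\le b\le n$ let $\lambda_{L,a}=-\sum_{i=a}^m2\varepsilon_i$ and $\lambda_{R,b}=-\sum_{i=b}^n2\varepsilon_i$. Then $K_{\lambda_{L,a}}\in\mathring U_L$ for every $1\le a\le m$, and $K_{\lambda_{R,b}}\in\mathring U_R$ for every $1\le b\le n$. Moreover, for $a=m$, $$\phi_U(K_{\lambda_{L,m}}\otimes1)=\phi_{PD}\Bigl(1+(q^2-1)\sum_{i=1}^nt_{m,i}\partial_{m,i}\Bigr).$$ -/

import Mathlib

/-!
Overview of the objects that occur in the theorem; everything else is auxiliary.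

* `Kq`, `q`: the field `ℂ(q)` and its generator.
* `P m n`: the algebra `𝒫`, generated by `P.t i j` with the relations `PRel`.
* `PD m n`: the algebra `𝒫𝒟`, generated by `PD.t i j`, `PD.d i j` with the relations `PDRel`.
* `PD.phi`: the action of `𝒫𝒟` on `𝒫 ≅ 𝒫𝒟 / ℐ`, where `ℐ` is the left ideal generated by the
  `∂_{i,j}`; that it is this action is `PD.mul_ofP_sub_mem` and `PD.eq_zero_of_ofP_mem`.
* `Uq m`: the algebra `U_q(gl_m)`, with the relations `URel`; `Uq.KLam`: the elements `K_λ`.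
* `Uq.phiL`, `Uq.phiR`, `phiU`: the actions of `U_L`, `U_R` and `U_L ⊗ U_R` on `𝒫`; the values on
  the `t_{i,j}` are `Uq.phiL_E_t`, ..., `Uq.phiR_K_t`, the coproduct rules are `Uq.phiL_E_mul`,
  `Uq.phiL_F_mul`, `Uq.phiL_K_mul`.
* `UringLR`, `UringL`, `UringR`: the subalgebras of elements acting on `𝒫` by elements of `𝒫𝒟`.
* `lamTail`: the weights `λ_{L,a}` and `λ_{R,b}`.

Indices in `Fin m` start at `0`, so that `k : Fin (m - 1)` stands for the simple root
`ε_{lo k} - ε_{hi k}`.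
-/

namespace QWeyl
noncomputable section

set_option linter.unusedSectionVars false
set_option linter.unusedSimpArgs false
set_option linter.unusedVariables false

/-- The ground field `ℂ(q)`. -/
def Kq : Type := RatFunc ℂ

instance : Field Kq := inferInstanceAs (Field (RatFunc ℂ))

/-- The parameter `q`. -/
def q : Kq := (RatFunc.X : RatFunc ℂ)

/-- The scalar `q - q⁻¹`. -/
def qh : Kq := q - q⁻¹

theorem q_ne_zero : q ≠ 0 := RatFunc.X_ne_zero (K := ℂ)

theorem qh_ne_zero : qh ≠ 0 := by
  intro h
  have h1 : q * q = 1 := by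
    have : q * qh = 0 := by rw [h, mul_zero]
    rw [qh, mul_sub, mul_inv_cancel₀ q_ne_zero] at this
    exact sub_eq_zero.mp this
  have h2 : algebraMap (Polynomial ℂ) (RatFunc ℂ) (Polynomial.X * Polynomial.X) =
      algebraMap (Polynomial ℂ) (RatFunc ℂ) 1 := by
    rw [map_mul, RatFunc.algebraMap_X, map_one]; exact h1
  have h3 := RatFunc.algebraMap_injective ℂ h2
  have h4 := congrArg (Polynomial.eval 0) h3
  simp at h4

section Braid
variable {ι κ M N : Type} [LinearOrder ι] [LinearOrder κ]
  [AddCommGroup M] [Module Kq M] [AddCommGroup N] [Module Kq N]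

/-- The braid operator of type `A` in the indices `a, c`, applied to the family `F`. -/
def sig (F : ι → ι → M) (a c : ι) : M :=
  if a = c then q • F a a else F c a + if a < c then qh • F a c else 0

/-- The sum of `f x` over all `x > a`. -/
def gtSum [Fintype ι] (a : ι) (f : ι → M) : M := ∑ x, if a < x then f x else 0

/-- The mixed braid operator in the indices `a, c`; see `sum_mixCoeff`. -/
def tau [Fintype ι] (F : ι → ι → M) (a c : ι) : M :=
  if a = c then q • F a a + qh • gtSum a (fun x => F x x) else F a c

theorem gtSum_map [Fintype ι] (φ : M →ₗ[Kq] N) (a : ι) (f : ι → M) :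
    φ (gtSum a f) = gtSum a (fun x => φ (f x)) := by
  simp [gtSum, apply_ite φ]

theorem gtSum_add [Fintype ι] (a : ι) (f g : ι → M) :
    gtSum a (fun x => f x + g x) = gtSum a f + gtSum a g := by
  unfold gtSum
  rw [← Finset.sum_add_distrib]
  refine Finset.sum_congr rfl fun x _ => ?_
  split_ifs <;> simp

theorem gtSum_smul [Fintype ι] (a : ι) (r : Kq) (f : ι → M) :
    gtSum a (fun x => r • f x) = r • gtSum a f :=
  (gtSum_map (r • LinearMap.id) a f).symm

theorem ite_smul_zero (p : Prop) [Decidable p] (r : Kq) (x : M) :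
    (if p then r • x else 0) = r • (if p then x else 0) := by
  split_ifs <;> simp

theorem gtSum_zero [Fintype ι] (a : ι) : gtSum a (fun _ => (0 : M)) = 0 := by
  simp [gtSum]

theorem gtSum_ite [Fintype ι] (a b : ι) (f g : ι → M) :
    gtSum a (fun x => if b = x then f x else g x) =
      (if a < b then f b - g b else 0) + gtSum a g := by
  unfold gtSum
  rw [← sub_eq_iff_eq_add, ← Finset.sum_sub_distrib, Finset.sum_eq_single b]
  · split_ifs <;> simp
  · intro x _ hx; simp [Ne.symm hx]
  · simp

theorem gtSum_ite' [Fintype ι] (a b : ι) (f g : ι → M) :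
    gtSum a (fun x => if x = b then f x else g x) =
      (if a < b then f b - g b else 0) + gtSum a g := by
  simp only [eq_comm (b := b)]; exact gtSum_ite a b f g

def midSum [Fintype ι] (a b : ι) (f : ι → M) : M := ∑ x, if a < x ∧ x < b then f x else 0

theorem gtSum_split [Fintype ι] {a b : ι} (h : a < b) (f : ι → M) :
    gtSum a f = midSum a b f + f b + gtSum b f := by
  have : f b = ∑ x, if x = b then f x else 0 := by simp
  rw [this]
  unfold gtSum midSum
  rw [← Finset.sum_add_distrib, ← Finset.sum_add_distrib]
  refine Finset.sum_congr rfl fun x _ => ?_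
  rcases lt_trichotomy x b with h1 | h1 | h1
  · simp [h1, h1.ne, h1.not_gt]
  · subst h1; simp [h]
  · simp [h1, h1.ne', h1.not_gt, h.trans h1]

theorem gtSum_lt [Fintype ι] {a b : ι} (h : a < b) (f : ι → M) :
    gtSum a (fun x => if x < b then f x else 0) = midSum a b f := by
  unfold gtSum midSum
  refine Finset.sum_congr rfl fun x _ => ?_
  split_ifs <;> simp_all

theorem gtSum_lt_of_le [Fintype ι] {a b : ι} (h : b ≤ a) (f : ι → M) :
    gtSum a (fun x => if x < b then f x else 0) = 0 := by
  unfold gtSum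
  refine Finset.sum_eq_zero fun x _ => ?_
  by_cases h1 : a < x
  · simp [(h.trans_lt h1).not_gt]
  · simp [h1]

theorem gtSum_gt [Fintype ι] {a b : ι} (h : a ≤ b) (f : ι → M) :
    gtSum a (fun x => if b < x then f x else 0) = gtSum b f := by
  unfold gtSum
  refine Finset.sum_congr rfl fun x _ => ?_
  by_cases h1 : b < x
  · simp [h1, h.trans_lt h1]
  · simp [h1]

theorem gtSum_gt' [Fintype ι] {a b : ι} (h : b ≤ a) (f : ι → M) :
    gtSum a (fun x => if b < x then f x else 0) = gtSum a f := by
  unfold gtSum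
  refine Finset.sum_congr rfl fun x _ => ?_
  by_cases h1 : a < x
  · simp [h1, h.trans_lt h1]
  · simp [h1]

theorem sig_map (φ : M →ₗ[Kq] N) (F : ι → ι → M) (a c : ι) :
    φ (sig F a c) = sig (fun x y => φ (F x y)) a c := by
  unfold sig; split_ifs <;> simp

theorem tau_map [Fintype ι] (φ : M →ₗ[Kq] N) (F : ι → ι → M) (a c : ι) :
    φ (tau F a c) = tau (fun x y => φ (F x y)) a c := by
  unfold tau; split_ifs <;> simp [gtSum_map]

theorem sig_add (F G : ι → ι → M) (a c : ι) :
    sig (fun x y => F x y + G x y) a c = sig F a c + sig G a c := by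
  unfold sig; split_ifs <;> (simp only [smul_add, add_zero]; try abel)

theorem tau_add [Fintype ι] (F G : ι → ι → M) (a c : ι) :
    tau (fun x y => F x y + G x y) a c = tau F a c + tau G a c := by
  unfold tau; split_ifs
  · simp only [smul_add, gtSum_add]; abel
  · rfl

theorem tau_smul [Fintype ι] (r : Kq) (F : ι → ι → M) (a c : ι) :
    tau (fun x y => r • F x y) a c = r • tau F a c :=
  (tau_map (r • LinearMap.id) F a c).symm

theorem sig_smul (r : Kq) (F : ι → ι → M) (a c : ι) :
    sig (fun x y => r • F x y) a c = r • sig F a c :=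
  (sig_map (r • LinearMap.id) F a c).symm

theorem sig_sig_comm (F : ι → ι → κ → κ → M) (a c : ι) (b d : κ) :
    sig (fun a c => sig (fun b d => F a c b d) b d) a c =
      sig (fun b d => sig (fun a c => F a c b d) a c) b d := by
  let φ : (ι → ι → M) →ₗ[Kq] M :=
    ⟨⟨fun G => sig G a c, fun G H => sig_add G H a c⟩, fun r G => sig_smul r G a c⟩
  have h := sig_map φ (fun b d => fun a c => F a c b d) b d
  refine Eq.trans ?_ h
  congr 1; funext x y
  exact (sig_map (LinearMap.proj y ∘ₗ LinearMap.proj (φ := fun _ : ι => ι → M) x)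
    (fun b d => fun a c => F a c b d) b d).symm

theorem sig_tau_comm [Fintype κ] (F : ι → ι → κ → κ → M) (a c : ι) (b d : κ) :
    sig (fun a c => tau (fun b d => F a c b d) b d) a c =
      tau (fun b d => sig (fun a c => F a c b d) a c) b d := by
  let φ : (ι → ι → M) →ₗ[Kq] M :=
    ⟨⟨fun G => sig G a c, fun G H => sig_add G H a c⟩, fun r G => sig_smul r G a c⟩
  have h := tau_map φ (fun b d => fun a c => F a c b d) b d
  refine Eq.trans ?_ h
  congr 1; funext x y
  exact (tau_map (LinearMap.proj y ∘ₗ LinearMap.proj (φ := fun _ : ι => ι → M) x)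
    (fun b d => fun a c => F a c b d) b d).symm

theorem tau_tau_comm [Fintype ι] [Fintype κ] (F : ι → ι → κ → κ → M) (a c : ι) (b d : κ) :
    tau (fun a c => tau (fun b d => F a c b d) b d) a c =
      tau (fun b d => tau (fun a c => F a c b d) a c) b d := by
  let φ : (ι → ι → M) →ₗ[Kq] M :=
    ⟨⟨fun G => tau G a c, fun G H => tau_add G H a c⟩, fun r G => tau_smul r G a c⟩
  have h := tau_map φ (fun b d => fun a c => F a c b d) b d
  refine Eq.trans ?_ h
  congr 1; funext x y
  exact (tau_map (LinearMap.proj y ∘ₗ LinearMap.proj (φ := fun _ : ι => ι → M) x)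
    (fun b d => fun a c => F a c b d) b d).symm

theorem sig_sig (F : ι → ι → M) (a c : ι) :
    sig (sig F) a c = F a c + qh • sig F a c := by
  have hq := q_ne_zero
  unfold sig
  rcases lt_trichotomy a c with h | h | h
  · simp [h.ne, h.ne', h, h.not_gt];
  · subst h; simp [smul_smul]; rw [← one_smul Kq (F a a), smul_smul, smul_smul, ← add_smul]; congr 1
    simp [qh]; field_simp; ring
  · simp [h.ne, h.ne', h, h.not_gt]

theorem tau_sig_delta [Fintype ι] (H : ι → M) (a a' c : ι) :
    tau (fun x y => if a' = y then H x else 0) a c =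
      sig (fun p r => if p = c then H r else 0) a a' := by
  unfold tau sig
  by_cases h : a = c
  · subst h
    by_cases h2 : a = a'
    · subst h2; simp [gtSum_ite, gtSum_zero]
    · simp [h2, Ne.symm h2, gtSum_ite, gtSum_zero]
  · by_cases h2 : a = a'
    · subst h2; simp [h]
    · by_cases h3 : a' = c <;> simp [h, h2, h3]

theorem tau_sig_delta' [Fintype ι] (Y : ι → M) (x a c : ι) :
    tau (fun x' a' => if x' = c then Y a' else 0) x a =
      sig (fun a' c' => if a' = x then Y c' else 0) a c := by
  unfold tau sig
  by_cases h : x = a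
  · subst h
    by_cases h2 : x = c
    · subst h2; simp [gtSum_ite', gtSum_zero]
    · simp [h2, Ne.symm h2, gtSum_ite', gtSum_zero]
  · by_cases h2 : a = c
    · subst h2; simp [h, Ne.symm h]
    · by_cases h3 : x = c <;> simp [h, Ne.symm h, h2, h3, eq_comm]

theorem rll [Fintype ι] (F : ι → ι → ι → M) (a₁ a₂ c : ι) :
    sig (fun a₁ a₂ => tau (fun x y => tau (fun u v => F x u v) a₂ y) a₁ c) a₁ a₂ =
      tau (fun x y => tau (fun u v => sig (fun p r => F p r v) x u) a₂ y) a₁ c := by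
  unfold sig tau
  have hq := q_ne_zero
  by_cases h1 : a₁ = c
  · subst h1
    rcases lt_trichotomy a₁ a₂ with h | h | h
    · simp only [h.ne, h.ne', h, h.not_gt, if_true, if_false, ite_self, gtSum_ite, gtSum_ite',
        gtSum_add, gtSum_smul, gtSum_zero, lt_irrefl, ite_smul_zero, smul_add, add_zero,
          smul_sub, smul_zero]
      try simp only [gtSum_lt h, gtSum_lt_of_le h.le, gtSum_lt_of_le le_rfl, gtSum_gt h.le,
        gtSum_gt le_rfl, gtSum_gt' h.le, gtSum_split h]
      simp only [qh]
      match_scalars <;> field_simp <;> ring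
    · subst h
      simp only [if_true, if_false, ite_self, gtSum_ite, gtSum_ite', gtSum_add, gtSum_smul,
        gtSum_zero, lt_irrefl, ite_smul_zero, smul_add, add_zero,
          smul_sub, smul_zero, gtSum_lt_of_le le_rfl,
        gtSum_gt le_rfl]
      simp only [qh]
      match_scalars <;> field_simp <;> ring
    · simp only [h.ne, h.ne', h, h.not_gt, if_true, if_false, ite_self, gtSum_ite, gtSum_ite',
        gtSum_add, gtSum_smul, gtSum_zero, lt_irrefl, ite_smul_zero, smul_add, add_zero,
          smul_sub, smul_zero]
      try simp only [gtSum_lt h, gtSum_lt_of_le h.le, gtSum_lt_of_le le_rfl, gtSum_gt h.le,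
        gtSum_gt le_rfl, gtSum_gt' h.le, gtSum_split h]
      simp only [qh]
      match_scalars <;> field_simp <;> ring
  · by_cases h2 : a₂ = c
    · subst h2
      rcases lt_or_gt_of_ne h1 with h | h
      · simp only [h.ne, h.ne', h, h.not_gt, if_true, if_false, ite_self, gtSum_ite, gtSum_ite',
          gtSum_add, gtSum_smul, gtSum_zero, lt_irrefl, ite_smul_zero, smul_add, add_zero,
          smul_sub, smul_zero]
        try simp only [gtSum_lt h, gtSum_lt_of_le h.le, gtSum_lt_of_le le_rfl, gtSum_gt h.le,
          gtSum_gt le_rfl, gtSum_gt' h.le, gtSum_split h]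
        simp only [qh]
        match_scalars <;> field_simp <;> ring
      · simp only [h.ne, h.ne', h, h.not_gt, if_true, if_false, ite_self, gtSum_ite, gtSum_ite',
          gtSum_add, gtSum_smul, gtSum_zero, lt_irrefl, ite_smul_zero, smul_add, add_zero,
          smul_sub, smul_zero]
        try simp only [gtSum_lt h, gtSum_lt_of_le h.le, gtSum_lt_of_le le_rfl, gtSum_gt h.le,
          gtSum_gt le_rfl, gtSum_gt' h.le, gtSum_split h]
        simp only [qh]
        match_scalars <;> field_simp <;> ring
    · simp [h1, h2]

theorem rll' [Fintype ι] (F : ι → ι → ι → M) (x a c : ι) :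
    sig (fun a c => tau (fun x' a' => tau (fun x'' c' => F x'' a' c') x' c) x a) a c =
      tau (fun x' a' => tau (fun x'' c' => sig (fun p r => F x'' p r) a' c') x' c) x a := by
  unfold sig tau
  have hq := q_ne_zero
  by_cases h1 : x = a
  · subst h1
    rcases lt_trichotomy x c with h | h | h
    · simp only [h.ne, h.ne', h, h.not_gt, if_true, if_false, ite_self, gtSum_ite, gtSum_ite',
        gtSum_add, gtSum_smul, gtSum_zero, lt_irrefl, ite_smul_zero, smul_add, add_zero,
          smul_sub, smul_zero]
      try simp only [gtSum_lt h, gtSum_lt_of_le h.le, gtSum_lt_of_le le_rfl, gtSum_gt h.le,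
        gtSum_gt le_rfl, gtSum_gt' h.le, gtSum_split h]
      simp only [qh]
      match_scalars <;> field_simp <;> ring
    · subst h
      simp only [if_true, if_false, ite_self, gtSum_ite, gtSum_ite', gtSum_add, gtSum_smul,
        gtSum_zero, lt_irrefl, ite_smul_zero, smul_add, add_zero,
          smul_sub, smul_zero, gtSum_lt_of_le le_rfl,
        gtSum_gt le_rfl]
      simp only [qh]
      match_scalars <;> field_simp <;> ring
    · simp only [h.ne, h.ne', h, h.not_gt, if_true, if_false, ite_self, gtSum_ite, gtSum_ite',
        gtSum_add, gtSum_smul, gtSum_zero, lt_irrefl, ite_smul_zero, smul_add, add_zero,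
          smul_sub, smul_zero]
      try simp only [gtSum_lt h, gtSum_lt_of_le h.le, gtSum_lt_of_le le_rfl, gtSum_gt h.le,
        gtSum_gt le_rfl, gtSum_gt' h.le, gtSum_split h]
      simp only [qh]
      match_scalars <;> field_simp <;> ring
  · by_cases h2 : x = c
    · subst h2
      rcases lt_or_gt_of_ne h1 with h | h
      · simp only [h.ne, h.ne', h, h.not_gt, if_true, if_false, ite_self, gtSum_ite, gtSum_ite',
          gtSum_add, gtSum_smul, gtSum_zero, lt_irrefl, ite_smul_zero, smul_add, add_zero,
          smul_sub, smul_zero]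
        try simp only [gtSum_lt h, gtSum_lt_of_le h.le, gtSum_lt_of_le le_rfl, gtSum_gt h.le,
          gtSum_gt le_rfl, gtSum_gt' h.le, gtSum_split h]
        simp only [qh]
        match_scalars <;> field_simp <;> ring
      · simp only [h.ne, h.ne', h, h.not_gt, if_true, if_false, ite_self, gtSum_ite, gtSum_ite',
          gtSum_add, gtSum_smul, gtSum_zero, lt_irrefl, ite_smul_zero, smul_add, add_zero,
          smul_sub, smul_zero]
        try simp only [gtSum_lt h, gtSum_lt_of_le h.le, gtSum_lt_of_le le_rfl, gtSum_gt h.le,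
          gtSum_gt le_rfl, gtSum_gt' h.le, gtSum_split h]
        simp only [qh]
        match_scalars <;> field_simp <;> ring
    · simp [h1, h2]

end Braid

section Quadratic
variable {ι κ M : Type} [LinearOrder ι] [LinearOrder κ] [AddCommGroup M] [Module Kq M]

def IsQuad (G : ι → κ → ι → κ → M) : Prop :=
  (∀ k i j, i < j → G k i k j = q • G k j k i) ∧
  (∀ k i j, i < j → G i k j k = q • G j k i k) ∧
  (∀ i k j l, i < k → j < l → G i l k j = G k j i l) ∧
  (∀ i k j l, i < k → j < l → G i j k l - G k l i j = qh • G i l k j)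

theorem isQuad_iff (G : ι → κ → ι → κ → M) :
    IsQuad G ↔ ∀ a b c d, sig (fun a c => G a b c d) a c = sig (fun b d => G a b c d) b d := by
  have hq := q_ne_zero
  constructor
  · rintro ⟨h1, h2, h3, h4⟩ a b c d
    unfold sig
    rcases lt_trichotomy a c with h | h | h <;> rcases lt_trichotomy b d with h' | h' | h'
    · simp only [h.ne, h'.ne, h, h', if_true, if_false]
      rw [h3 a c b d h h']
    · subst h'
      simp only [h.ne, h, if_true, if_false, h2 b a c h, qh]
      match_scalars; field_simp; ring
    · simp only [h.ne, h'.ne', h, h'.not_gt, if_true, if_false, add_zero]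
      rw [← h4 a c d b h h']; abel
    · subst h
      simp only [h'.ne, h', if_true, if_false, h1 a b d h', qh]
      match_scalars; field_simp; ring
    · subst h; subst h'; simp
    · subst h
      simp only [h'.ne', h'.not_gt, if_true, if_false, h1 a d b h', qh, add_zero]
    · simp only [h.ne', h'.ne, h', h.not_gt, if_true, if_false, add_zero]
      rw [← sub_eq_iff_eq_add, ← neg_sub, ← sub_eq_zero]
      have := h4 c a b d h h'
      rw [← h3 c a b d h h', ← this]; abel
    · subst h'
      simp only [h.ne', h.not_gt, if_true, if_false, h2 b c a h, add_zero]
    · simp only [h.ne', h'.ne', h'.not_gt, h.not_gt, if_true, if_false, add_zero]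
      rw [h3 c a d b h h']
  · intro H
    refine ⟨fun k i j h => ?_, fun k i j h => ?_, fun i k j l h h' => ?_, fun i k j l h h' => ?_⟩
    · have := H k j k i
      simpa [sig, h.ne', h.not_gt] using this.symm
    · have := H j k i k
      simpa [sig, h.ne', h.not_gt] using this
    · have := H k l i j
      simpa [sig, h.ne', h.not_gt, h'.ne', h'.not_gt] using this
    · have := H i l k j
      simp only [sig, h.ne, h'.ne', h, h'.not_gt, if_true, if_false, add_zero] at this
      rw [← this]; abel

end Quadratic

/-! ### The quantized coordinate ring of `m × n` matrices -/

/-- The defining relations of `𝒫`. -/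
inductive PRel (m n : ℕ) :
    FreeAlgebra Kq (Fin m × Fin n) → FreeAlgebra Kq (Fin m × Fin n) → Prop
  | row (k : Fin m) (i j : Fin n) (h : i < j) : PRel m n
      (FreeAlgebra.ι Kq (k, i) * FreeAlgebra.ι Kq (k, j))
      (q • (FreeAlgebra.ι Kq (k, j) * FreeAlgebra.ι Kq (k, i)))
  | col (k : Fin n) (i j : Fin m) (h : i < j) : PRel m n
      (FreeAlgebra.ι Kq (i, k) * FreeAlgebra.ι Kq (j, k))
      (q • (FreeAlgebra.ι Kq (j, k) * FreeAlgebra.ι Kq (i, k)))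
  | comm (i k : Fin m) (j l : Fin n) (h : i < k) (h' : j < l) : PRel m n
      (FreeAlgebra.ι Kq (i, l) * FreeAlgebra.ι Kq (k, j))
      (FreeAlgebra.ι Kq (k, j) * FreeAlgebra.ι Kq (i, l))
  | cross (i k : Fin m) (j l : Fin n) (h : i < k) (h' : j < l) : PRel m n
      (FreeAlgebra.ι Kq (i, j) * FreeAlgebra.ι Kq (k, l) -
        FreeAlgebra.ι Kq (k, l) * FreeAlgebra.ι Kq (i, j))
      ((q - q⁻¹) • (FreeAlgebra.ι Kq (i, l) * FreeAlgebra.ι Kq (k, j)))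

/-- The algebra `𝒫 = 𝒫_{m × n}`. -/
def P (m n : ℕ) : Type := RingQuot (PRel m n)

instance (m n : ℕ) : Ring (P m n) := inferInstanceAs (Ring (RingQuot (PRel m n)))

instance (m n : ℕ) : Algebra Kq (P m n) := inferInstanceAs (Algebra Kq (RingQuot (PRel m n)))

namespace P
variable {m n : ℕ}

/-- The quotient map from the free algebra. -/
def mk (m n : ℕ) : FreeAlgebra Kq (Fin m × Fin n) →ₐ[Kq] P m n :=
  RingQuot.mkAlgHom Kq (PRel m n)

theorem mk_rel {x y : FreeAlgebra Kq (Fin m × Fin n)} (h : PRel m n x y) : mk m n x = mk m n y :=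
  RingQuot.mkAlgHom_rel Kq h

/-- The generator `t_{i,j}` of `𝒫`. -/
def t (i : Fin m) (j : Fin n) : P m n := mk m n (FreeAlgebra.ι Kq (i, j))

theorem isQuad_t : IsQuad (fun (a : Fin m) (b : Fin n) c d => (t a b * t c d : P m n)) := by
  refine ⟨fun k i j h => ?_, fun k i j h => ?_, fun i k j l h h' => ?_, fun i k j l h h' => ?_⟩
  · simpa [t] using mk_rel (PRel.row (m := m) k i j h)
  · simpa [t] using mk_rel (PRel.col (n := n) k i j h)
  · simpa [t] using mk_rel (PRel.comm i k j l h h')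
  · simpa [t, qh] using mk_rel (PRel.cross i k j l h h')

/-- The universal property of `𝒫`. -/
def lift {A : Type} [Ring A] [Algebra Kq A] (T : Fin m → Fin n → A)
    (h : IsQuad (fun a b c d => T a b * T c d)) : P m n →ₐ[Kq] A :=
  RingQuot.liftAlgHom Kq ⟨FreeAlgebra.lift Kq (fun p => T p.1 p.2), by
    intro x y hxy
    induction hxy with
    | row k i j h' => simpa using h.1 k i j h'
    | col k i j h' => simpa using h.2.1 k i j h'
    | comm i k j l h' h'' => simpa using h.2.2.1 i k j l h' h''
    | cross i k j l h' h'' => simpa [qh] using h.2.2.2 i k j l h' h''⟩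

@[simp] theorem lift_t {A : Type} [Ring A] [Algebra Kq A] (T : Fin m → Fin n → A)
    (h : IsQuad (fun a b c d => T a b * T c d)) (i : Fin m) (j : Fin n) :
    lift T h (t i j) = T i j := by
  refine (RingQuot.liftAlgHom_mkAlgHom_apply Kq _ _ _).trans ?_
  simp

theorem algHom_ext {A : Type} [Ring A] [Algebra Kq A] {f g : P m n →ₐ[Kq] A}
    (h : ∀ i j, f (t i j) = g (t i j)) : f = g := by
  apply RingQuot.ringQuot_ext'
  apply FreeAlgebra.hom_ext
  funext p
  exact h p.1 p.2

theorem induction_on {C : P m n → Prop} (f : P m n) (h1 : C 1)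
    (hadd : ∀ f g, C f → C g → C (f + g)) (hsmul : ∀ (r : Kq) f, C f → C (r • f))
    (ht : ∀ a b f, C f → C (t a b * f)) : C f := by
  obtain ⟨x, rfl⟩ := RingQuot.mkAlgHom_surjective Kq (PRel m n) f
  change C (mk m n x)
  suffices h : ∀ y : P m n, C y → C (mk m n x * y) by
    simpa using h 1 h1
  induction x using FreeAlgebra.induction with
  | grade0 r =>
    intro y hy
    rw [AlgHom.commutes, ← Algebra.smul_def]
    exact hsmul r y hy
  | grade1 p => intro y hy; exact ht p.1 p.2 y hy
  | mul x y hx hy =>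
    intro z hz
    rw [map_mul, mul_assoc]
    exact hx _ (hy _ hz)
  | add x y hx hy =>
    intro z hz
    rw [map_add, add_mul]
    exact hadd _ _ (hx _ hz) (hy _ hz)

/-- A linear map on `𝒫` is determined by its value at `1` and by its recursion over left
multiplication by generators. -/
theorem linearMap_ext {M : Type} [AddCommGroup M] [Module Kq M] {f g : P m n →ₗ[Kq] M}
    (h1 : f 1 = g 1) (ht : ∀ a b x, f x = g x → f (t a b * x) = g (t a b * x)) : f = g := by
  ext x
  induction x using induction_on with
  | h1 => exact h1
  | hadd x y hx hy => rw [map_add, map_add, hx, hy]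
  | hsmul r x hx => rw [map_smul, map_smul, hx]
  | ht a b x hx => exact ht a b x hx

/-! ### The `q`-derivations -/

/-- The vector `(x, y)` stands for `(f, (∂_{c,d} f)_{c,d})`. -/
def delAux (a : Fin m) (b : Fin n) :
    Module.End Kq (P m n × (Fin m → Fin n → P m n)) where
  toFun z := (t a b * z.1, fun c d => (if a = c then (if b = d then z.1 else 0) else 0) +
    tau (fun a' c' => tau (fun b' d' => t a' b' * z.2 c' d') b d) a c)
  map_add' x y := by
    refine Prod.ext (by simp [mul_add]) ?_
    funext c d
    simp only [Prod.fst_add, Prod.snd_add, Pi.add_apply, mul_add, tau_add]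
    split_ifs <;> abel
  map_smul' r x := by
    refine Prod.ext (by simp) ?_
    funext c d
    simp only [Prod.smul_fst, Prod.smul_snd, Pi.smul_apply, mul_smul_comm, tau_smul,
      RingHom.id_apply, smul_add, smul_ite, smul_zero]

theorem quad_key {ι κ M : Type} [LinearOrder ι] [LinearOrder κ] [AddCommGroup M] [Module Kq M]
    (F : ι → ι → κ → κ → M) (a a' : ι) (b b' : κ) :
    sig (fun a a' => F a a' b b' + sig (fun p r => sig (fun p' r' => F p r p' r') b b') a a') a a' =
    sig (fun b b' => F a a' b b' + sig (fun p r => sig (fun p' r' => F p r p' r') b b') a a') b b' := by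
  rw [sig_add, sig_add]
  have e1 : sig (fun a a' => sig (fun p r => sig (fun p' r' => F p r p' r') b b') a a') a a' =
    sig (fun p' r' => F a a' p' r') b b' +
      qh • sig (fun p r => sig (fun p' r' => F p r p' r') b b') a a' := sig_sig _ a a'
  have e2 : sig (fun b b' => sig (fun p r => sig (fun p' r' => F p r p' r') b b') a a') b b' =
    sig (fun p r => F p r b b') a a' +
      qh • sig (fun p r => sig (fun p' r' => F p r p' r') b b') a a' := by
    have : (fun b b' => sig (fun p r => sig (fun p' r' => F p r p' r') b b') a a') =
      fun b b' => sig (fun p' r' => sig (fun p r => F p r p' r') a a') b b' := by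
      funext b b'; exact sig_sig_comm F a a' b b'
    rw [this, sig_sig_comm F a a' b b']
    exact sig_sig _ b b'
  rw [e1, e2]; abel

theorem isQuad_delAux :
    IsQuad (fun (a : Fin m) (b : Fin n) a' b' => delAux a b * delAux a' b') := by
  rw [isQuad_iff]
  intro a b a' b'
  have hP := (isQuad_iff _).1 (isQuad_t (m := m) (n := n))
  refine LinearMap.ext fun z => Prod.ext ?_ ?_
  · let φ : Module.End Kq (P m n × (Fin m → Fin n → P m n)) →ₗ[Kq] P m n :=
      LinearMap.fst Kq _ _ ∘ₗ LinearMap.applyₗ z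
    have e1 := sig_map φ (fun a a' => delAux a b * delAux a' b') a a'
    have e2 := sig_map φ (fun b b' => delAux a b * delAux a' b') b b'
    have e3 := congrArg (LinearMap.mulRight Kq z.1) (hP a b a' b')
    rw [sig_map, sig_map] at e3
    refine e1.trans (Eq.trans ?_ e2.symm)
    simp only [LinearMap.mulRight_apply, mul_assoc] at e3
    exact e3
  · funext c d
    let φ : Module.End Kq (P m n × (Fin m → Fin n → P m n)) →ₗ[Kq] P m n :=
      LinearMap.proj d ∘ₗ LinearMap.proj (φ := fun _ => Fin n → P m n) c ∘ₗ
        LinearMap.snd Kq _ _ ∘ₗ LinearMap.applyₗ z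
    have e1 := sig_map φ (fun a a' => delAux a b * delAux a' b') a a'
    have e2 := sig_map φ (fun b b' => delAux a b * delAux a' b') b b'
    refine e1.trans (Eq.trans ?_ e2.symm)
    clear e1 e2
    let F : Fin m → Fin m → Fin n → Fin n → P m n := fun a a' b b' =>
      if a = c then (if b = d then t a' b' * z.1 else 0) else 0
    let H : Fin m → Fin m → Fin m → Fin n → Fin n → Fin n → P m n :=
      fun x u v x' u' v' => t x x' * (t u u' * z.2 v v')
    let W : Fin m → Fin m → Fin m → Fin n → Fin n → P m n := fun x u v b b' =>
      tau (fun x' y' => tau (fun u' v' => H x u v x' u' v') b' y') b d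
    let G : Fin m → Fin m → Fin n → Fin n → P m n := fun a a' b b' =>
      tau (fun x y => tau (fun u v => W x u v b b') a' y) a c
    have key : ∀ a b a' b', φ (delAux a b * delAux a' b') =
        (F a a' b b' + sig (fun p r => sig (fun p' r' => F p r p' r') b b') a a') +
          G a a' b b' := by
      intro a b a' b'
      have h0 : φ (delAux a b * delAux a' b') = F a a' b b' +
          tau (fun x y => tau (fun x' y' => t x x' *
            ((if a' = y then (if b' = y' then z.1 else 0) else 0) +
              tau (fun u v => tau (fun u' v' => t u u' * z.2 v v') b' y') a' y)) b d) a c := rfl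
      rw [h0]
      simp only [mul_add, tau_add]
      rw [add_assoc]
      congr 1
      congr 1
      · have h1 : ∀ x y, tau (fun x' y' => (t x x' *
            (if a' = y then (if b' = y' then z.1 else 0) else 0) : P m n)) b d =
            if a' = y then sig (fun p' r' => if p' = d then t x r' * z.1 else 0) b b' else 0 := by
          intro x y
          rw [← tau_sig_delta (fun x' => t x x' * z.1) b b' d]
          by_cases h : a' = y
          · simp only [h, if_true, mul_ite, mul_zero]
          · simp only [h, if_false, mul_zero]
            have := tau_smul (0 : Kq) (fun _ _ => (0 : P m n)) b d
            simpa using this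
        simp only [h1]
        rw [tau_sig_delta (fun x => sig (fun p' r' => if p' = d then t x r' * z.1 else 0) b b')]
        congr 1
        funext p r
        by_cases h : p = c
        · simp only [h, if_true, F]
        · simp only [h, if_false, F]
          have := sig_smul (0 : Kq) (fun _ _ => (0 : P m n)) b b'
          simpa using this.symm
      · have h2 : ∀ x y, tau (fun x' y' => (t x x' *
            tau (fun u v => tau (fun u' v' => t u u' * z.2 v v') b' y') a' y : P m n)) b d =
            tau (fun u v => W x u v b b') a' y := by
          intro x y
          rw [← tau_tau_comm]
          congr 1
          funext x' y'
          have h3 := tau_map (LinearMap.mulLeft Kq (t x x'))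
            (fun u v => tau (fun u' v' => t u u' * z.2 v v') b' y') a' y
          refine h3.trans ?_
          congr 1
          funext u v
          exact tau_map (LinearMap.mulLeft Kq (t x x')) (fun u' v' => t u u' * z.2 v v') b' y'
        simp only [h2, G]
    have hW : ∀ x u v b b', sig (fun p r => W p r v b b') x u =
        sig (fun b b' => W x u v b b') b b' := by
      intro x u v b b'
      refine (sig_tau_comm (fun p r x' y' => tau (fun u' v' => H p r v x' u' v') b' y')
        x u b d).trans ?_
      refine Eq.trans ?_ (rll (fun x' u' v' => H x u v x' u' v') b b' d).symm
      congr 1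
      funext x' y'
      refine (sig_tau_comm (fun p r u' v' => H p r v x' u' v') x u b' y').trans ?_
      congr 1
      funext u' v'
      have e3 := congrArg (LinearMap.mulRight Kq (z.2 v v')) (hP x x' u u')
      rw [sig_map, sig_map] at e3
      simpa only [H, LinearMap.mulRight_apply, mul_assoc] using e3
    have hG : sig (fun a a' => G a a' b b') a a' = sig (fun b b' => G a a' b b') b b' := by
      refine (rll (fun x u v => W x u v b b') a a' c).trans ?_
      simp only [hW]
      refine Eq.trans ?_ (sig_tau_comm
        (fun b b' x y => tau (fun u v => W x u v b b') a' y) b b' a c).symm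
      congr 1
      funext x y
      exact (sig_tau_comm (fun b b' u v => W x u v b b') b b' a' y).symm
    simp only [key]
    refine (sig_add (fun a a' => F a a' b b' +
      sig (fun p r => sig (fun p' r' => F p r p' r') b b') a a')
      (fun a a' => G a a' b b') a a').trans (Eq.trans ?_ (sig_add (fun b b' => F a a' b b' +
      sig (fun p r => sig (fun p' r' => F p r p' r') b b') a a')
      (fun b b' => G a a' b b') b b').symm)
    rw [hG, quad_key F a a' b b']

/-- The operator `∂_{c,d}` on `𝒫`, characterised by `del_one` and `del_t_mul`. -/
def del (c : Fin m) (d : Fin n) : P m n →ₗ[Kq] P m n :=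
  LinearMap.proj d ∘ₗ LinearMap.proj (φ := fun _ => Fin n → P m n) c ∘ₗ
    LinearMap.snd Kq _ _ ∘ₗ LinearMap.applyₗ ((1 : P m n), (0 : Fin m → Fin n → P m n)) ∘ₗ
      (lift delAux isQuad_delAux).toLinearMap

theorem del_one (c : Fin m) (d : Fin n) : del c d (1 : P m n) = 0 := by
  simp [del]

theorem lift_delAux_apply (f : P m n) :
    lift delAux isQuad_delAux f ((1 : P m n), (0 : Fin m → Fin n → P m n)) =
      (f, fun c d => del c d f) := by
  refine Prod.ext ?_ rfl
  let A : P m n →ₗ[Kq] P m n := LinearMap.fst Kq _ _ ∘ₗ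
    LinearMap.applyₗ ((1 : P m n), (0 : Fin m → Fin n → P m n)) ∘ₗ
      (lift delAux isQuad_delAux).toLinearMap
  have : A = LinearMap.id := by
    refine linearMap_ext (by simp [A]) fun a b x hx => ?_
    have : A (t a b * x) = t a b * A x := by
      simp [A, delAux]
    rw [this, hx]; rfl
  exact LinearMap.congr_fun this f

theorem del_t_mul (a c : Fin m) (b d : Fin n) (f : P m n) :
    del c d (t a b * f) = (if a = c then (if b = d then f else 0) else 0) +
      tau (fun a' c' => tau (fun b' d' => t a' b' * del c' d' f) b d) a c := by
  have : del c d (t a b * f) = (lift delAux isQuad_delAux (t a b * f)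
    ((1 : P m n), (0 : Fin m → Fin n → P m n))).2 c d := rfl
  rw [this, map_mul, lift_t, Module.End.mul_apply, lift_delAux_apply]
  rfl

theorem del_del_braid (f : P m n) : ∀ (a c : Fin m) (b d : Fin n),
    sig (fun a c => del c d (del a b f)) a c = sig (fun b d => del c d (del a b f)) b d := by
  induction f using induction_on with
  | h1 => intro a c b d; simp only [del_one, map_zero]; simp [sig]
  | hadd f g hf hg => intro a c b d; simp only [map_add, sig_add, hf, hg]
  | hsmul r f hf => intro a c b d; simp only [map_smul, sig_smul, hf]
  | ht x y f hf =>
    intro a c b d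
    let F : Fin m → Fin m → Fin n → Fin n → P m n := fun a c b d =>
      if a = x then (if b = y then del c d f else 0) else 0
    let H : Fin m → Fin m → Fin m → Fin n → Fin n → Fin n → P m n :=
      fun x a c y b d => t x y * del c d (del a b f)
    let W : Fin m → Fin m → Fin m → Fin n → Fin n → P m n := fun x a c b d =>
      tau (fun y' b' => tau (fun y'' d' => H x a c y'' b' d') y' d) y b
    let G : Fin m → Fin m → Fin n → Fin n → P m n := fun a c b d =>
      tau (fun x' a' => tau (fun x'' c' => W x'' a' c' b d) x' c) x a
    have key : ∀ a b c d, del c d (del a b (t x y * f)) =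
        (F a c b d + sig (fun p r => sig (fun p' r' => F p r p' r') b d) a c) + G a c b d := by
      intro a b c d
      have h0 : del c d (del a b (t x y * f)) = F a c b d +
          tau (fun x' a' => tau (fun y' b' =>
            (if x' = c then (if y' = d then del a' b' f else 0) else 0) +
              tau (fun x'' c' => tau (fun y'' d' => H x'' a' c' y'' b' d') y' d) x' c) y b) x a := by
        rw [del_t_mul, map_add, tau_map]
        congr 1
        · simp only [F, eq_comm (a := a), eq_comm (a := b)]
          split_ifs <;> simp
        · congr 1
          funext x' a'
          rw [tau_map]
          congr 1
          funext y' b'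
          exact del_t_mul x' c y' d _
      rw [h0]
      simp only [tau_add]
      rw [add_assoc]
      congr 1
      congr 1
      · have h1 : ∀ x' a', tau (fun y' b' =>
            (if x' = c then (if y' = d then del a' b' f else 0) else 0 : P m n)) y b =
            if x' = c then sig (fun p' r' => if p' = y then del a' r' f else 0) b d else 0 := by
          intro x' a'
          rw [← tau_sig_delta' (fun b' => del a' b' f) y b d]
          by_cases h : x' = c
          · simp only [h, if_true]
          · simp only [h, if_false]
            have := tau_smul (0 : Kq) (fun _ _ => (0 : P m n)) y b
            simpa using this
        simp only [h1]
        rw [tau_sig_delta' (fun a' => sig (fun p' r' => if p' = y then del a' r' f else 0) b d)]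
        congr 1
        funext p r
        by_cases h : p = x
        · simp only [h, if_true, F]
        · simp only [h, if_false, F]
          have := sig_smul (0 : Kq) (fun _ _ => (0 : P m n)) b d
          simpa using this.symm
      · simp only [G, W]
        congr 1
        funext x' a'
        exact (tau_tau_comm (fun x'' c' y' b' => tau (fun y'' d' => H x'' a' c' y'' b' d') y' d)
          x' c y b).symm
    have hW : ∀ x a c b d, sig (fun p r => W x p r b d) a c =
        sig (fun b d => W x a c b d) b d := by
      intro x a c b d
      refine (sig_tau_comm (fun p r y' b' => tau (fun y'' d' => H x p r y'' b' d') y' d)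
        a c y b).trans ?_
      refine Eq.trans ?_ (rll' (fun y'' b' d' => H x a c y'' b' d') y b d).symm
      congr 1
      funext y' b'
      refine (sig_tau_comm (fun p r y'' d' => H x p r y'' b' d') a c y' d).trans ?_
      congr 1
      funext y'' d'
      have e3 := congrArg (LinearMap.mulLeft Kq (t x y'')) (hf a c b' d')
      rw [sig_map, sig_map] at e3
      exact e3
    have hG : sig (fun a c => G a c b d) a c = sig (fun b d => G a c b d) b d := by
      refine (rll' (fun x a c => W x a c b d) x a c).trans ?_
      simp only [hW]
      refine Eq.trans ?_ (sig_tau_comm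
        (fun b d x' a' => tau (fun x'' c' => W x'' a' c' b d) x' c) b d x a).symm
      congr 1
      funext x' a'
      exact (sig_tau_comm (fun b d x'' c' => W x'' a' c' b d) b d x' c).symm
    simp only [key]
    refine (sig_add (fun a c => F a c b d +
      sig (fun p r => sig (fun p' r' => F p r p' r') b d) a c)
      (fun a c => G a c b d) a c).trans (Eq.trans ?_ (sig_add (fun b d => F a c b d +
      sig (fun p r => sig (fun p' r' => F p r p' r') b d) a c)
      (fun b d => G a c b d) b d).symm)
    rw [hG, quad_key F a c b d]

theorem isQuad_del :
    IsQuad (fun (a : Fin m) (b : Fin n) c d => (del c d * del a b : Module.End Kq (P m n))) := by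
  rw [isQuad_iff]
  intro a b c d
  refine LinearMap.ext fun f => ?_
  refine (sig_map (LinearMap.applyₗ f)
    (fun a c => (del c d * del a b : Module.End Kq (P m n))) a c).trans (Eq.trans ?_
      (sig_map (LinearMap.applyₗ f)
        (fun b d => (del c d * del a b : Module.End Kq (P m n))) b d).symm)
  exact del_del_braid f a c b d

end P

/-! ### The quantized Weyl algebra -/

/-- The generators `t_{i,j}` and `∂_{i,j}` of `𝒫𝒟`. -/
inductive PDGen (m n : ℕ) : Type
  | t (i : Fin m) (j : Fin n)
  | d (i : Fin m) (j : Fin n)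

/-- `⟦a, b⟧`. -/
def kd {m : ℕ} (a b : Fin m) : Kq := if a = b then 1 else 0

/-- `⟦a, b⟧_q`. -/
def kdq {m : ℕ} (a b : Fin m) : Kq := if a = b then q else q - q⁻¹

/-- The coefficient `◇ + □` for the indices `a, a', b, b'`, where `a'` and `b'` stand for the
barred indices. -/
def mixCoeff {m : ℕ} (a a' b b' : Fin m) : Kq :=
  kd a a' * kd b b' * kdq a b + (1 - kd a a') * kd a b * kd a' b'

open PDGen in
/-- The defining relations of `𝒫𝒟`. -/
inductive PDRel (m n : ℕ) :
    FreeAlgebra Kq (PDGen m n) → FreeAlgebra Kq (PDGen m n) → Prop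
  | t_row (k : Fin m) (i j : Fin n) (h : i < j) : PDRel m n
      (FreeAlgebra.ι Kq (t k i) * FreeAlgebra.ι Kq (t k j))
      (q • (FreeAlgebra.ι Kq (t k j) * FreeAlgebra.ι Kq (t k i)))
  | t_col (k : Fin n) (i j : Fin m) (h : i < j) : PDRel m n
      (FreeAlgebra.ι Kq (t i k) * FreeAlgebra.ι Kq (t j k))
      (q • (FreeAlgebra.ι Kq (t j k) * FreeAlgebra.ι Kq (t i k)))
  | t_comm (i k : Fin m) (j l : Fin n) (h : i < k) (h' : j < l) : PDRel m n
      (FreeAlgebra.ι Kq (t i l) * FreeAlgebra.ι Kq (t k j))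
      (FreeAlgebra.ι Kq (t k j) * FreeAlgebra.ι Kq (t i l))
  | t_cross (i k : Fin m) (j l : Fin n) (h : i < k) (h' : j < l) : PDRel m n
      (FreeAlgebra.ι Kq (t i j) * FreeAlgebra.ι Kq (t k l) -
        FreeAlgebra.ι Kq (t k l) * FreeAlgebra.ι Kq (t i j))
      ((q - q⁻¹) • (FreeAlgebra.ι Kq (t i l) * FreeAlgebra.ι Kq (t k j)))
  | d_row (k : Fin m) (i j : Fin n) (h : i < j) : PDRel m n
      (FreeAlgebra.ι Kq (d k j) * FreeAlgebra.ι Kq (d k i))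
      (q • (FreeAlgebra.ι Kq (d k i) * FreeAlgebra.ι Kq (d k j)))
  | d_col (k : Fin n) (i j : Fin m) (h : i < j) : PDRel m n
      (FreeAlgebra.ι Kq (d j k) * FreeAlgebra.ι Kq (d i k))
      (q • (FreeAlgebra.ι Kq (d i k) * FreeAlgebra.ι Kq (d j k)))
  | d_comm (i k : Fin m) (j l : Fin n) (h : i < k) (h' : j < l) : PDRel m n
      (FreeAlgebra.ι Kq (d k j) * FreeAlgebra.ι Kq (d i l))
      (FreeAlgebra.ι Kq (d i l) * FreeAlgebra.ι Kq (d k j))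
  | d_cross (i k : Fin m) (j l : Fin n) (h : i < k) (h' : j < l) : PDRel m n
      (FreeAlgebra.ι Kq (d k l) * FreeAlgebra.ι Kq (d i j) -
        FreeAlgebra.ι Kq (d i j) * FreeAlgebra.ι Kq (d k l))
      ((q - q⁻¹) • (FreeAlgebra.ι Kq (d k j) * FreeAlgebra.ι Kq (d i l)))
  | mixed (a₁ a₁' : Fin m) (a₂ a₂' : Fin n) : PDRel m n
      (FreeAlgebra.ι Kq (d a₁' a₂') * FreeAlgebra.ι Kq (t a₁ a₂))
      (algebraMap Kq _ (kd a₁ a₁' * kd a₂ a₂') +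
        ∑ b₁ ∈ Finset.Ici a₁, ∑ b₁' ∈ Finset.Ici a₁', ∑ b₂ ∈ Finset.Ici a₂, ∑ b₂' ∈ Finset.Ici a₂',
          (mixCoeff a₁ a₁' b₁ b₁' * mixCoeff a₂ a₂' b₂ b₂') •
            (FreeAlgebra.ι Kq (t b₁ b₂) * FreeAlgebra.ι Kq (d b₁' b₂')))

/-- The quantized Weyl algebra `𝒫𝒟 = 𝒫𝒟_{m × n}`. -/
def PD (m n : ℕ) : Type := RingQuot (PDRel m n)

instance (m n : ℕ) : Ring (PD m n) := inferInstanceAs (Ring (RingQuot (PDRel m n)))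

instance (m n : ℕ) : Algebra Kq (PD m n) := inferInstanceAs (Algebra Kq (RingQuot (PDRel m n)))

theorem sum_mixCoeff {M : Type} [AddCommGroup M] [Module Kq M] {m : ℕ} (a a' : Fin m)
    (F : Fin m → Fin m → M) :
    ∑ b ∈ Finset.Ici a, ∑ b' ∈ Finset.Ici a', mixCoeff a a' b b' • F b b' = tau F a a' := by
  by_cases h : a = a'
  · subst h
    have h1 : ∀ b ∈ Finset.Ici a, ∑ b' ∈ Finset.Ici a, mixCoeff a a b b' • F b b' =
        kdq a b • F b b := by
      intro b hb
      rw [Finset.sum_eq_single b]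
      · simp [mixCoeff, kd]
      · intro c _ hc; simp [mixCoeff, kd, Ne.symm hc]
      · intro hb'; exact absurd hb hb'
    rw [Finset.sum_congr rfl h1, ← Finset.Ioi_insert, Finset.sum_insert (by simp)]
    have h2 : ∀ b ∈ Finset.Ioi a, kdq a b • F b b = qh • F b b := by
      intro b hb
      simp [kdq, (Finset.mem_Ioi.1 hb).ne, qh]
    rw [Finset.sum_congr rfl h2, ← Finset.smul_sum]
    simp only [tau, if_true, gtSum, kdq]
    rw [← Finset.sum_filter]
    congr 3
    ext b; simp
  · rw [Finset.sum_eq_single a, Finset.sum_eq_single a']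
    · simp [mixCoeff, kd, h, tau]
    · intro c _ hc; simp [mixCoeff, kd, h, Ne.symm hc]
    · simp
    · intro c _ hc; simp [mixCoeff, kd, h, Ne.symm hc]
    · simp

namespace PD
variable {m n : ℕ}

/-- The quotient map from the free algebra. -/
def mk (m n : ℕ) : FreeAlgebra Kq (PDGen m n) →ₐ[Kq] PD m n :=
  RingQuot.mkAlgHom Kq (PDRel m n)

theorem mk_rel {x y : FreeAlgebra Kq (PDGen m n)} (h : PDRel m n x y) : mk m n x = mk m n y :=
  RingQuot.mkAlgHom_rel Kq h

/-- The generator `t_{i,j}` of `𝒫𝒟`. -/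
def t (i : Fin m) (j : Fin n) : PD m n :=
  mk m n (FreeAlgebra.ι Kq (PDGen.t i j))

/-- The generator `∂_{i,j}` of `𝒫𝒟`. -/
def d (i : Fin m) (j : Fin n) : PD m n :=
  mk m n (FreeAlgebra.ι Kq (PDGen.d i j))

/-- The action `φ_PD` of `𝒫𝒟` on `𝒫`: `t_{i,j}` acts by left multiplication and `∂_{i,j}` by
`P.del i j`.  -/
def phi (m n : ℕ) : PD m n →ₐ[Kq] Module.End Kq (P m n) :=
  RingQuot.liftAlgHom Kq ⟨FreeAlgebra.lift Kq (fun g => match g with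
    | PDGen.t i j => LinearMap.mulLeft Kq (P.t i j)
    | PDGen.d i j => P.del i j), by
    intro x y hxy
    have ht := P.isQuad_t (m := m) (n := n)
    have hd := P.isQuad_del (m := m) (n := n)
    induction hxy with
    | t_row k i j h =>
      refine LinearMap.ext fun f => ?_
      have := congrArg (· * f) (ht.1 k i j h)
      simpa [mul_assoc] using this
    | t_col k i j h =>
      refine LinearMap.ext fun f => ?_
      have := congrArg (· * f) (ht.2.1 k i j h)
      simpa [mul_assoc] using this
    | t_comm i k j l h h' =>
      refine LinearMap.ext fun f => ?_
      have := congrArg (· * f) (ht.2.2.1 i k j l h h')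
      simpa [mul_assoc] using this
    | t_cross i k j l h h' =>
      refine LinearMap.ext fun f => ?_
      have := congrArg (· * f) (ht.2.2.2 i k j l h h')
      simpa [mul_assoc, sub_mul, qh] using this
    | d_row k i j h => simpa using hd.1 k i j h
    | d_col k i j h => simpa using hd.2.1 k i j h
    | d_comm i k j l h h' => simpa using hd.2.2.1 i k j l h h'
    | d_cross i k j l h h' => simpa [qh] using hd.2.2.2 i k j l h h'
    | mixed a₁ a₁' a₂ a₂' =>
      refine LinearMap.ext fun f => ?_
      have h1 := P.del_t_mul a₁ a₁' a₂ a₂' f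
      simp only [← sum_mixCoeff, Finset.smul_sum, smul_smul] at h1
      simp only [map_mul, map_add, map_sum, map_smul, FreeAlgebra.lift_ι_apply, AlgHom.commutes,
        Module.End.mul_apply, LinearMap.mulLeft_apply, LinearMap.add_apply, LinearMap.sum_apply,
        LinearMap.smul_apply, Module.algebraMap_end_apply, h1]
      congr 1
      simp only [kd]
      split_ifs <;> simp⟩

@[simp] theorem phi_t (i : Fin m) (j : Fin n) (f : P m n) :
    phi m n (t i j) f = P.t i j * f := by
  have h : phi m n (t i j) = FreeAlgebra.lift Kq _ (FreeAlgebra.ι Kq (PDGen.t i j)) :=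
    RingQuot.liftAlgHom_mkAlgHom_apply Kq _ _ _
  rw [h]; simp

@[simp] theorem phi_d (i : Fin m) (j : Fin n) (f : P m n) :
    phi m n (d i j) f = P.del i j f := by
  have h : phi m n (d i j) = FreeAlgebra.lift Kq _ (FreeAlgebra.ι Kq (PDGen.d i j)) :=
    RingQuot.liftAlgHom_mkAlgHom_apply Kq _ _ _
  rw [h]; simp

end PD

/-- The position `k` in `{1, …, m}` of the generators `E_k`, `F_k`. -/
def lo {m : ℕ} (k : Fin (m - 1)) : Fin m := ⟨k.1, by omega⟩

/-- The position `k + 1` in `{1, …, m}`. -/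
def hi {m : ℕ} (k : Fin (m - 1)) : Fin m := ⟨k.1 + 1, by omega⟩

theorem lo_lt_hi {m : ℕ} (k : Fin (m - 1)) : lo k < hi k := by simp [lo, hi, Fin.lt_def]

theorem lo_inj {m : ℕ} {k l : Fin (m - 1)} : lo k = lo l ↔ k = l := by
  simp [lo, Fin.ext_iff]

theorem hi_inj {m : ℕ} {k l : Fin (m - 1)} : hi k = hi l ↔ k = l := by
  simp [hi, Fin.ext_iff]

theorem hi_lt {m : ℕ} {k : Fin (m - 1)} {a : Fin m} (h : lo k < a) (h' : a ≠ hi k) : hi k < a := by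
  simp only [lo, hi, Fin.lt_def, ne_eq, Fin.ext_iff] at *; omega

theorem lt_lo {m : ℕ} {k : Fin (m - 1)} {a : Fin m} (h : a < hi k) (h' : a ≠ lo k) : a < lo k := by
  simp only [lo, hi, Fin.lt_def, ne_eq, Fin.ext_iff] at *; omega

namespace P
variable {m n : ℕ}

theorem isQuad_scale {ι κ M : Type} [LinearOrder ι] [LinearOrder κ] [AddCommGroup M] [Module Kq M]
    {G : ι → κ → ι → κ → M} (h : IsQuad G) (α : ι → Kq) :
    IsQuad (fun a b c d => (α a * α c) • G a b c d) := by
  refine ⟨fun k i j h' => ?_, fun k i j h' => ?_, fun i k j l h' h'' => ?_,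
    fun i k j l h' h'' => ?_⟩
  · simp only [h.1 k i j h']; module
  · simp only [h.2.1 k i j h']; module
  · simp only [h.2.2.1 i k j l h' h'', mul_comm]
  · have := h.2.2.2 i k j l h' h''
    simp only [mul_comm (α k) (α i)]
    rw [← smul_sub, this, smul_comm]

def skewAux (α β : Fin m → Kq) (e : Fin m → Fin n → P m n) (a : Fin m) (b : Fin n) :
    Module.End Kq (P m n × P m n) where
  toFun z := (β a • (t a b * z.1) + e a b * z.2, α a • (t a b * z.2))
  map_add' x y := by
    refine Prod.ext ?_ ?_
    · simp only [Prod.fst_add, Prod.snd_add, mul_add, smul_add]; abel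
    · simp only [Prod.snd_add, mul_add, smul_add]
  map_smul' r x := by
    refine Prod.ext ?_ ?_
    · simp only [Prod.smul_fst, Prod.smul_snd, mul_smul_comm, RingHom.id_apply, smul_add,
        smul_comm r]
    · simp only [Prod.smul_snd, mul_smul_comm, RingHom.id_apply, smul_comm r]

theorem isQuad_skewAux {α β : Fin m → Kq} {e : Fin m → Fin n → P m n}
    (he : IsQuad (fun a b c d => β a • (t a b * e c d) + α c • (e a b * t c d))) :
    IsQuad (fun (a : Fin m) (b : Fin n) c d => skewAux α β e a b * skewAux α β e c d) := by
  have hα := (isQuad_iff _).1 (isQuad_scale (isQuad_t (m := m) (n := n)) α)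
  have hβ := (isQuad_iff _).1 (isQuad_scale (isQuad_t (m := m) (n := n)) β)
  rw [isQuad_iff] at he ⊢
  intro a b c d
  refine LinearMap.ext fun z => ?_
  have h1 := congrArg (LinearMap.mulRight Kq z.1) (hβ a b c d)
  have h2 := congrArg (LinearMap.mulRight Kq z.2) (he a b c d)
  have h3 := congrArg (LinearMap.mulRight Kq z.2) (hα a b c d)
  simp only [sig_map] at h1 h2 h3
  have key : ∀ a b c d, (skewAux α β e a b * skewAux α β e c d) z =
      (LinearMap.mulRight Kq z.1 ((β a * β c) • (t a b * t c d)) +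
        LinearMap.mulRight Kq z.2 (β a • (t a b * e c d) + α c • (e a b * t c d)),
       LinearMap.mulRight Kq z.2 ((α a * α c) • (t a b * t c d))) := by
    intro a b c d
    refine Prod.ext ?_ ?_
    · simp only [skewAux, Module.End.mul_apply, LinearMap.coe_mk, AddHom.coe_mk,
        LinearMap.mulRight_apply, add_mul, mul_add, smul_mul_assoc, mul_smul_comm, mul_assoc]
      module
    · simp only [skewAux, Module.End.mul_apply, LinearMap.coe_mk, AddHom.coe_mk,
        LinearMap.mulRight_apply, smul_mul_assoc, mul_smul_comm, mul_assoc]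
      module
  have ea := sig_map (LinearMap.applyₗ z : Module.End Kq (P m n × P m n) →ₗ[Kq] _)
    (fun a c => skewAux α β e a b * skewAux α β e c d) a c
  have eb := sig_map (LinearMap.applyₗ z : Module.End Kq (P m n × P m n) →ₗ[Kq] _)
    (fun b d => skewAux α β e a b * skewAux α β e c d) b d
  refine ea.trans (Eq.trans ?_ eb.symm)
  simp only [LinearMap.applyₗ_apply_apply, key]
  refine Prod.ext ?_ ?_
  · refine (sig_map (LinearMap.fst Kq (P m n) (P m n)) _ a c).trans
      (Eq.trans ?_ (sig_map (LinearMap.fst Kq (P m n) (P m n)) _ b d).symm)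
    simp only [LinearMap.fst_apply]
    refine (sig_add _ _ a c).trans (Eq.trans ?_ (sig_add _ _ b d).symm)
    exact congrArg₂ (· + ·) h1 h2
  · refine (sig_map (LinearMap.snd Kq (P m n) (P m n)) _ a c).trans
      (Eq.trans ?_ (sig_map (LinearMap.snd Kq (P m n) (P m n)) _ b d).symm)
    exact h3

theorem isQuad_torus (α : Fin m → Kq) : IsQuad
    (fun (a : Fin m) (b : Fin n) c d => ((α a • t a b) * (α c • t c d) : P m n)) := by
  simpa only [smul_mul_smul_comm] using isQuad_scale (isQuad_t (m := m) (n := n)) α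

/-- The algebra endomorphism of `𝒫` that scales the `a`-th row by `α a`. -/
def torus (n : ℕ) (α : Fin m → Kq) : P m n →ₐ[Kq] P m n :=
  lift (fun a b => α a • t a b) (isQuad_torus α)

theorem torus_one (α : Fin m → Kq) : torus n α 1 = 1 := map_one _

theorem torus_t (α : Fin m → Kq) (a : Fin m) (b : Fin n) (f : P m n) :
    torus n α (t a b * f) = α a • (t a b * torus n α f) := by
  rw [map_mul, torus, lift_t, smul_mul_assoc]

/-- The `(α, β)`-skew derivation of `𝒫` with value `e a b` at `t_{a,b}`. -/
def skew (α β : Fin m → Kq) (e : Fin m → Fin n → P m n)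
    (he : IsQuad (fun a b c d => β a • (t a b * e c d) + α c • (e a b * t c d))) :
    P m n →ₗ[Kq] P m n :=
  LinearMap.fst Kq _ _ ∘ₗ LinearMap.applyₗ ((0 : P m n), (1 : P m n)) ∘ₗ
    (lift (skewAux α β e) (isQuad_skewAux he)).toLinearMap

theorem skew_one (α β : Fin m → Kq) (e : Fin m → Fin n → P m n)
    (he : IsQuad (fun a b c d => β a • (t a b * e c d) + α c • (e a b * t c d))) :
    skew α β e he 1 = 0 := by
  simp [skew]

theorem skew_t (α β : Fin m → Kq) (e : Fin m → Fin n → P m n)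
    (he : IsQuad (fun a b c d => β a • (t a b * e c d) + α c • (e a b * t c d)))
    (a : Fin m) (b : Fin n) (f : P m n) :
    skew α β e he (t a b * f) = e a b * torus n α f + β a • (t a b * skew α β e he f) := by
  let A : P m n →ₗ[Kq] P m n := LinearMap.snd Kq _ _ ∘ₗ
    LinearMap.applyₗ ((0 : P m n), (1 : P m n)) ∘ₗ
      (lift (skewAux α β e) (isQuad_skewAux he)).toLinearMap
  have hA : A = (torus n α).toLinearMap := by
    refine linearMap_ext (by simp [A]) fun a b x hx => ?_
    have h1 : A (t a b * x) = α a • (t a b * A x) := by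
      simp [A, skewAux]
    have h2 := torus_t α a b x
    rw [h1, hx]; exact h2.symm
  have h3 : skew α β e he (t a b * f) = β a • (t a b * skew α β e he f) + e a b * A f := by
    simp [skew, A, skewAux]
  rw [h3, hA, add_comm]; rfl

/-- The weight of `K_k` on the `a`-th row. -/
def kap (k : Fin (m - 1)) (a : Fin m) : Kq := if a = lo k then q⁻¹ else if a = hi k then q else 1

/-- The weight of `K_k⁻¹` on the `a`-th row. -/
def kapInv (k : Fin (m - 1)) (a : Fin m) : Kq :=
  if a = lo k then q else if a = hi k then q⁻¹ else 1

def eVal (k : Fin (m - 1)) (a : Fin m) (b : Fin n) : P m n :=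
  if a = lo k then -(q⁻¹ • t (hi k) b) else 0

def fVal (k : Fin (m - 1)) (a : Fin m) (b : Fin n) : P m n :=
  if a = hi k then -(q • t (lo k) b) else 0

theorem isQuad_eVal (k : Fin (m - 1)) : IsQuad (fun (a : Fin m) (b : Fin n) c d =>
    (1 : Fin m → Kq) a • (t a b * eVal k c d) + kap k c • (eVal k a b * t c d)) := by
  obtain ⟨h1, h2, h3, h4⟩ := isQuad_t (m := m) (n := n)
  have hq := q_ne_zero
  have hk := lo_lt_hi k
  simp only [qh] at h4
  beta_reduce at h1 h2 h3
  refine ⟨fun r i j h => ?_, fun r i j h => ?_, fun i r j l h h' => ?_, fun i r j l h h' => ?_⟩ <;>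
    beta_reduce
  · by_cases hr : r = lo k
    · subst hr
      have e1 := h3 (lo k) (hi k) i j hk h
      have e2 := h4 (lo k) (hi k) i j hk h
      rw [sub_eq_iff_eq_add] at e2
      simp only [eVal, kap, kapInv, qh, if_true, if_false, Pi.one_apply, one_smul, mul_neg, neg_mul,
        smul_mul_assoc, mul_smul_comm, mul_zero, zero_mul, smul_zero, add_zero, zero_add, neg_zero, hk.ne, hk.ne']
      rw [e2, ← e1]
      all_goals (match_scalars <;> field_simp <;> ring)
    · simp [eVal, hr]
  · by_cases hi1 : i = lo k
    · subst hi1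
      by_cases hr : j = hi k
      · subst hr
        simp only [eVal, kap, kapInv, qh, if_true, if_false, Pi.one_apply, one_smul, mul_neg, neg_mul,
          smul_mul_assoc, mul_smul_comm, mul_zero, zero_mul, smul_zero, add_zero, zero_add, neg_zero, hk.ne, hk.ne']
        all_goals (match_scalars <;> field_simp <;> ring)
      · have hlt := hi_lt h hr
        have e := h2 r (hi k) j hlt
        simp only [eVal, kap, kapInv, qh, if_true, if_false, Pi.one_apply, one_smul, mul_neg, neg_mul,
          smul_mul_assoc, mul_smul_comm, mul_zero, zero_mul, smul_zero, add_zero, zero_add, neg_zero, hr, h.ne', h.ne]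
        rw [e]
        all_goals (match_scalars <;> field_simp <;> ring)
    · by_cases hr : j = lo k
      · subst hr
        have hlt := h.trans hk
        have e := h2 r i (hi k) hlt
        simp only [eVal, kap, kapInv, qh, if_true, if_false, Pi.one_apply, one_smul, mul_neg, neg_mul,
          smul_mul_assoc, mul_smul_comm, mul_zero, zero_mul, smul_zero, add_zero, zero_add, neg_zero, hi1, hlt.ne, h.ne, h.ne']
        rw [e]
        all_goals (match_scalars <;> field_simp <;> ring)
      · simp [eVal, hi1, hr]
  · by_cases hi1 : i = lo k
    · subst hi1
      by_cases hr : r = hi k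
      · subst hr
        have e := h1 (hi k) j l h'
        simp only [eVal, kap, kapInv, qh, if_true, if_false, Pi.one_apply, one_smul, mul_neg, neg_mul,
          smul_mul_assoc, mul_smul_comm, mul_zero, zero_mul, smul_zero, add_zero, zero_add, neg_zero, hk.ne, hk.ne']
        rw [e]
        all_goals (match_scalars <;> field_simp <;> ring)
      · have hlt := hi_lt h hr
        have e := h3 (hi k) r j l hlt h'
        simp only [eVal, kap, kapInv, qh, if_true, if_false, Pi.one_apply, one_smul, mul_neg, neg_mul,
          smul_mul_assoc, mul_smul_comm, mul_zero, zero_mul, smul_zero, add_zero, zero_add, neg_zero, hr, h.ne', h.ne]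
        rw [e]
        all_goals (match_scalars <;> field_simp <;> ring)
    · by_cases hr : r = lo k
      · subst hr
        have hlt := h.trans hk
        have e := h3 i (hi k) j l hlt h'
        simp only [eVal, kap, kapInv, qh, if_true, if_false, Pi.one_apply, one_smul, mul_neg, neg_mul,
          smul_mul_assoc, mul_smul_comm, mul_zero, zero_mul, smul_zero, add_zero, zero_add, neg_zero, hi1, hlt.ne, h.ne, h.ne']
        rw [e]
        all_goals (match_scalars <;> field_simp <;> ring)
      · simp [eVal, hi1, hr]
  · by_cases hi1 : i = lo k
    · subst hi1
      by_cases hr : r = hi k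
      · subst hr
        have e := h1 (hi k) j l h'
        simp only [eVal, kap, kapInv, qh, if_true, if_false, Pi.one_apply, one_smul, mul_neg, neg_mul,
          smul_mul_assoc, mul_smul_comm, mul_zero, zero_mul, smul_zero, add_zero, zero_add, neg_zero, hk.ne, hk.ne']
        rw [e]
        all_goals (match_scalars <;> field_simp <;> ring)
      · have hlt := hi_lt h hr
        have e := h4 (hi k) r j l hlt h'
        rw [sub_eq_iff_eq_add] at e
        simp only [eVal, kap, kapInv, qh, if_true, if_false, Pi.one_apply, one_smul, mul_neg, neg_mul,
          smul_mul_assoc, mul_smul_comm, mul_zero, zero_mul, smul_zero, add_zero, zero_add, neg_zero, hr, h.ne', h.ne]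
        rw [e]
        all_goals (match_scalars <;> field_simp <;> ring)
    · by_cases hr : r = lo k
      · subst hr
        have hlt := h.trans hk
        have e := h4 i (hi k) j l hlt h'
        rw [sub_eq_iff_eq_add] at e
        simp only [eVal, kap, kapInv, qh, if_true, if_false, Pi.one_apply, one_smul, mul_neg, neg_mul,
          smul_mul_assoc, mul_smul_comm, mul_zero, zero_mul, smul_zero, add_zero, zero_add, neg_zero, hi1, hlt.ne, h.ne, h.ne']
        rw [e]
        all_goals (match_scalars <;> field_simp <;> ring)
      · simp [eVal, hi1, hr]

theorem isQuad_fVal (k : Fin (m - 1)) : IsQuad (fun (a : Fin m) (b : Fin n) c d =>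
    kapInv k a • (t a b * fVal k c d) + (1 : Fin m → Kq) c • (fVal k a b * t c d)) := by
  obtain ⟨h1, h2, h3, h4⟩ := isQuad_t (m := m) (n := n)
  have hq := q_ne_zero
  have hk := lo_lt_hi k
  simp only [qh] at h4
  beta_reduce at h1 h2 h3
  refine ⟨fun r i j h => ?_, fun r i j h => ?_, fun i r j l h h' => ?_, fun i r j l h h' => ?_⟩ <;>
    beta_reduce
  · by_cases hr : r = hi k
    · subst hr
      have e1 := h3 (lo k) (hi k) i j hk h
      have e2 := h4 (lo k) (hi k) i j hk h
      rw [sub_eq_iff_eq_add] at e2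
      simp only [fVal, kap, kapInv, qh, if_true, if_false, Pi.one_apply, one_smul, mul_neg, neg_mul,
        smul_mul_assoc, mul_smul_comm, mul_zero, zero_mul, smul_zero, add_zero, zero_add, neg_zero, hk.ne, hk.ne']
      rw [e2, ← e1]
      all_goals (match_scalars <;> field_simp <;> ring)
    · simp [fVal, hr]
  · by_cases hr : j = hi k
    · subst hr
      by_cases hi1 : i = lo k
      · subst hi1
        simp only [fVal, kap, kapInv, qh, if_true, if_false, Pi.one_apply, one_smul, mul_neg, neg_mul,
          smul_mul_assoc, mul_smul_comm, mul_zero, zero_mul, smul_zero, add_zero, zero_add, neg_zero, hk.ne, hk.ne']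
        all_goals (match_scalars <;> field_simp <;> ring)
      · have hlt := lt_lo h hi1
        have e := h2 r i (lo k) hlt
        simp only [fVal, kap, kapInv, qh, if_true, if_false, Pi.one_apply, one_smul, mul_neg, neg_mul,
          smul_mul_assoc, mul_smul_comm, mul_zero, zero_mul, smul_zero, add_zero, zero_add, neg_zero, hi1, h.ne', h.ne]
        rw [e]
        all_goals (match_scalars <;> field_simp <;> ring)
    · by_cases hi1 : i = hi k
      · subst hi1
        have hlt := hk.trans h
        have e := h2 r (lo k) j hlt
        simp only [fVal, kap, kapInv, qh, if_true, if_false, Pi.one_apply, one_smul, mul_neg, neg_mul,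
          smul_mul_assoc, mul_smul_comm, mul_zero, zero_mul, smul_zero, add_zero, zero_add, neg_zero, hr, hlt.ne', h.ne, h.ne']
        rw [e]
        all_goals (match_scalars <;> field_simp <;> ring)
      · simp [fVal, hi1, hr]
  · by_cases hr : r = hi k
    · subst hr
      by_cases hi1 : i = lo k
      · subst hi1
        have e := h1 (lo k) j l h'
        simp only [fVal, kap, kapInv, qh, if_true, if_false, Pi.one_apply, one_smul, mul_neg, neg_mul,
          smul_mul_assoc, mul_smul_comm, mul_zero, zero_mul, smul_zero, add_zero, zero_add, neg_zero, hk.ne, hk.ne']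
        rw [e]
        all_goals (match_scalars <;> field_simp <;> ring)
      · have hlt := lt_lo h hi1
        have e := h3 i (lo k) j l hlt h'
        simp only [fVal, kap, kapInv, qh, if_true, if_false, Pi.one_apply, one_smul, mul_neg, neg_mul,
          smul_mul_assoc, mul_smul_comm, mul_zero, zero_mul, smul_zero, add_zero, zero_add, neg_zero, hi1, h.ne', h.ne]
        rw [e]
        all_goals (match_scalars <;> field_simp <;> ring)
    · by_cases hi1 : i = hi k
      · subst hi1
        have hlt := hk.trans h
        have e := h3 (lo k) r j l hlt h'
        simp only [fVal, kap, kapInv, qh, if_true, if_false, Pi.one_apply, one_smul, mul_neg, neg_mul,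
          smul_mul_assoc, mul_smul_comm, mul_zero, zero_mul, smul_zero, add_zero, zero_add, neg_zero, hr, hlt.ne', h.ne, h.ne']
        rw [e]
        all_goals (match_scalars <;> field_simp <;> ring)
      · simp [fVal, hi1, hr]
  · by_cases hr : r = hi k
    · subst hr
      by_cases hi1 : i = lo k
      · subst hi1
        have e := h1 (lo k) j l h'
        simp only [fVal, kap, kapInv, qh, if_true, if_false, Pi.one_apply, one_smul, mul_neg, neg_mul,
          smul_mul_assoc, mul_smul_comm, mul_zero, zero_mul, smul_zero, add_zero, zero_add, neg_zero, hk.ne, hk.ne']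
        rw [e]
        all_goals (match_scalars <;> field_simp <;> ring)
      · have hlt := lt_lo h hi1
        have e := h4 i (lo k) j l hlt h'
        rw [sub_eq_iff_eq_add] at e
        simp only [fVal, kap, kapInv, qh, if_true, if_false, Pi.one_apply, one_smul, mul_neg, neg_mul,
          smul_mul_assoc, mul_smul_comm, mul_zero, zero_mul, smul_zero, add_zero, zero_add, neg_zero, hi1, h.ne', h.ne]
        rw [e]
        all_goals (match_scalars <;> field_simp <;> ring)
    · by_cases hi1 : i = hi k
      · subst hi1
        have hlt := hk.trans h
        have e := h4 (lo k) r j l hlt h'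
        rw [sub_eq_iff_eq_add] at e
        simp only [fVal, kap, kapInv, qh, if_true, if_false, Pi.one_apply, one_smul, mul_neg, neg_mul,
          smul_mul_assoc, mul_smul_comm, mul_zero, zero_mul, smul_zero, add_zero, zero_add, neg_zero, hr, hlt.ne', h.ne, h.ne']
        rw [e]
        all_goals (match_scalars <;> field_simp <;> ring)
      · simp [fVal, hi1, hr]

end P

/-- Two positions are adjacent. -/
def Adj {r : ℕ} (i j : Fin r) : Prop := i.1 + 1 = j.1 ∨ j.1 + 1 = i.1

theorem Adj.symm {r : ℕ} {i j : Fin r} (h : Adj i j) : Adj j i := Or.symm h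

namespace P
variable {m n : ℕ}

/-- The action of `E_k` on `𝒫` in the row index. -/
def opE (n : ℕ) (k : Fin (m - 1)) : P m n →ₗ[Kq] P m n := skew (kap k) 1 (eVal k) (isQuad_eVal k)

/-- The action of `F_k` on `𝒫` in the row index. -/
def opF (n : ℕ) (k : Fin (m - 1)) : P m n →ₗ[Kq] P m n :=
  skew 1 (kapInv k) (fVal k) (isQuad_fVal k)

theorem opE_one (k : Fin (m - 1)) : opE n k 1 = 0 := skew_one _ _ _ _

theorem opF_one (k : Fin (m - 1)) : opF n k 1 = 0 := skew_one _ _ _ _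

theorem torus_torus (α β : Fin m → Kq) (f : P m n) :
    torus n α (torus n β f) = torus n (α * β) f := by
  have : (torus n α).comp (torus n β) = torus n (α * β) := by
    apply algHom_ext
    intro a b
    have h (γ : Fin m → Kq) : torus n γ (t a b) = γ a • t a b := lift_t _ _ a b
    simp only [AlgHom.comp_apply, h, map_smul, smul_smul, Pi.mul_apply]
    rw [mul_comm]
  exact DFunLike.congr_fun this f

theorem torus_const_one (f : P m n) : torus n 1 f = f := by
  have : torus n (1 : Fin m → Kq) = AlgHom.id Kq (P m n) := by
    apply algHom_ext
    intro a b
    have h (γ : Fin m → Kq) : torus n γ (t a b) = γ a • t a b := lift_t _ _ a b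
    simp [h]
  exact DFunLike.congr_fun this f

theorem opE_t (k : Fin (m - 1)) (a : Fin m) (b : Fin n) (f : P m n) :
    opE n k (t a b * f) =
      (if a = lo k then -(q⁻¹ • (t (hi k) b * torus n (kap k) f)) else 0) + t a b * opE n k f := by
  rw [opE, skew_t, Pi.one_apply, one_smul, eVal]
  split_ifs <;> simp

theorem opF_t (k : Fin (m - 1)) (a : Fin m) (b : Fin n) (f : P m n) :
    opF n k (t a b * f) =
      (if a = hi k then -(q • (t (lo k) b * f)) else 0) + kapInv k a • (t a b * opF n k f) := by
  rw [opF, skew_t, torus_const_one, fVal]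
  split_ifs <;> simp

theorem torus_opE (c : Fin m → Kq) (k : Fin (m - 1)) (f : P m n) :
    c (lo k) • torus n c (opE n k f) = c (hi k) • opE n k (torus n c f) := by
  induction f using induction_on with
  | h1 => simp [opE_one]
  | hadd f g hf hg => simp only [map_add, smul_add, hf, hg]
  | hsmul r f hf => rw [map_smul, map_smul, map_smul, map_smul, smul_comm, hf, smul_comm]
  | ht a b f hf =>
    have hf' := congrArg (fun x => c a • (t a b * x)) hf
    simp only [mul_smul_comm] at hf'
    simp only [opE_t, torus_t, map_add, map_smul]
    by_cases h : a = lo k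
    · subst h
      simp only [if_true, map_neg, map_smul, torus_t, torus_torus, mul_comm (kap k) c]
      linear_combination (norm := module) hf'
    · simp only [h, if_false, map_zero, zero_add, torus_t]
      linear_combination (norm := module) hf'

theorem torus_opF (c : Fin m → Kq) (k : Fin (m - 1)) (f : P m n) :
    c (hi k) • torus n c (opF n k f) = c (lo k) • opF n k (torus n c f) := by
  induction f using induction_on with
  | h1 => simp [opF_one]
  | hadd f g hf hg => simp only [map_add, smul_add, hf, hg]
  | hsmul r f hf => rw [map_smul, map_smul, map_smul, map_smul, smul_comm, hf, smul_comm]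
  | ht a b f hf =>
    have hf' := congrArg (fun x => (kapInv k a * c a) • (t a b * x)) hf
    simp only [mul_smul_comm] at hf'
    simp only [opF_t, torus_t, map_add, map_smul]
    by_cases h : a = hi k
    · subst h
      simp only [if_true, map_neg, map_smul, torus_t]
      linear_combination (norm := module) hf'
    · simp only [h, if_false, map_zero, zero_add, torus_t]
      linear_combination (norm := module) hf'


theorem kap_mul_kapInv (k : Fin (m - 1)) : kap k * kapInv k = 1 := by
  funext a
  have hq := q_ne_zero
  simp only [kap, kapInv, Pi.mul_apply, Pi.one_apply]
  split_ifs <;> simp [hq]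

theorem lo_ne_hi_of {k l : Fin (m - 1)} (h : k = l) : lo k ≠ hi l := h ▸ (lo_lt_hi k).ne

theorem kapInv_torus_opF (k l : Fin (m - 1)) (f : P m n) :
    kapInv l (lo k) • torus n (kap k) (opF n l f) =
      kapInv l (hi k) • opF n l (torus n (kap k) f) := by
  have hq := q_ne_zero
  have h := torus_opF (kap k) l f
  by_cases hkl : k = l
  · subst hkl
    simp only [kap, kapInv, (lo_lt_hi k).ne', if_true, if_false] at h ⊢
    exact h
  · have h1 : lo k ≠ lo l := fun h => hkl (lo_inj.1 h)
    have h2 : hi k ≠ hi l := fun h => hkl (hi_inj.1 h)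
    simp only [kap, kapInv, h1, h1.symm, h2, h2.symm, if_false] at h ⊢
    by_cases h3 : lo k = hi l
    · have h4 : hi k ≠ lo l := by
        simp only [lo, hi, ne_eq, Fin.ext_iff] at h3 ⊢; omega
      simpa only [h3, h4, h4.symm, if_true, if_false] using h
    · by_cases h4 : hi k = lo l
      · simp only [h3, h4, Ne.symm h3, if_true, if_false] at h ⊢
        exact h
      · simpa only [h3, h4, Ne.symm h3, Ne.symm h4, if_false] using h

theorem opE_opF (k l : Fin (m - 1)) :
    opE n k * opF n l - opF n l * opE n k =
      if k = l then qh⁻¹ • ((torus n (kap k)).toLinearMap - (torus n (kapInv k)).toLinearMap)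
        else (0 : Module.End Kq (P m n)) := by
  have hq := q_ne_zero
  have hqh := qh_ne_zero
  have hqh' : q ^ 2 - 1 ≠ 0 := by
    intro h; apply hqh; rw [qh]; field_simp; rw [h, mul_zero]
  refine linearMap_ext ?_ fun a b f hf => ?_
  · split_ifs <;> simp [opE_one, opF_one, torus_one]
  · have hx := kapInv_torus_opF k l f
    have hx' := congrArg (fun x => q⁻¹ • (t (hi k) b * x)) hx
    have hf' := congrArg (fun x => kapInv l a • (t a b * x)) hf
    have hlo := lo_inj (k := l) (l := k)
    have hhi := hi_inj (k := k) (l := l)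
    by_cases hkl : k = l
    · subst hkl
      simp only [if_true, LinearMap.sub_apply, LinearMap.smul_apply, Module.End.mul_apply,
        AlgHom.toLinearMap_apply] at hf' ⊢
      simp only [mul_sub, smul_sub, mul_smul_comm] at hf' hx'
      have hlh := (lo_lt_hi k).ne
      have hhl := (lo_lt_hi k).ne'
      by_cases h1 : a = lo k
      · subst h1
        simp only [opE_t, opF_t, torus_t, map_add, map_neg, map_smul, if_true, if_false, hlh, hhl,
          map_zero, zero_add, kap, kapInv] at hf' hx' ⊢
        simp only [qh] at *
        linear_combination (norm := skip) hf' - hx'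
        match_scalars <;> field_simp <;> ring
      · by_cases h2 : a = hi k
        · subst h2
          simp only [opE_t, opF_t, torus_t, map_add, map_neg, map_smul, if_true, if_false, hlh, hhl,
            map_zero, zero_add, kap, kapInv] at hf' hx' ⊢
          simp only [qh] at *
          linear_combination (norm := skip) hf'
          match_scalars <;> field_simp <;> ring
        · simp only [opE_t, opF_t, torus_t, map_add, map_neg, map_smul, if_true, if_false, h1, h2,
            map_zero, zero_add, kap, kapInv] at hf' hx' ⊢
          simp only [qh] at *
          linear_combination (norm := skip) hf'
          match_scalars <;> field_simp <;> ring
    · have hlk : ¬ (l = k) := fun h => hkl h.symm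
      simp only [hkl, hlk, iff_false] at hlo hhi
      simp only [hkl, if_false, LinearMap.sub_apply, Module.End.mul_apply,
        LinearMap.zero_apply, mul_zero, smul_zero] at hf' ⊢
      simp only [mul_sub, smul_sub, mul_smul_comm] at hf' hx'
      by_cases h1 : a = lo k
      · subst h1
        by_cases h2 : lo k = hi l
        · simp only [opE_t, opF_t, torus_t, map_add, map_neg, map_smul, if_true, if_false, h2, hlo,
            (lo_lt_hi l).ne, hhi, map_zero, zero_add, mul_add, smul_add] at hf' hx' ⊢
          linear_combination (norm := skip) hf' - hx'
          match_scalars <;> field_simp <;> ring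
        · simp only [opE_t, opF_t, torus_t, map_add, map_neg, map_smul, if_true, if_false, h2, hlo,
            hhi, map_zero, zero_add] at hf' hx' ⊢
          linear_combination (norm := skip) hf' - hx'
          match_scalars <;> field_simp <;> ring
      · by_cases h2 : a = hi l
        · subst h2
          simp only [opE_t, opF_t, torus_t, map_add, map_neg, map_smul, if_true, if_false, h1, hlo,
            hhi, map_zero, zero_add] at hf' hx' ⊢
          linear_combination (norm := module) hf'
        · simp only [opE_t, opF_t, torus_t, map_add, map_neg, map_smul, if_true, if_false, h1, h2,
            map_zero, zero_add] at hf' hx' ⊢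
          linear_combination (norm := module) hf'

theorem torus_opE_self (k : Fin (m - 1)) (f : P m n) :
    torus n (kap k) (opE n k f) = (q * q) • opE n k (torus n (kap k) f) := by
  have hq := q_ne_zero
  have h := congrArg (q • ·) (torus_opE (kap k) k f)
  simpa [kap, (lo_lt_hi k).ne', smul_smul, hq] using h

theorem torus_opE_adj {k l : Fin (m - 1)} (hkl : Adj k l) (f : P m n) :
    torus n (kap k) (opE n l f) = q⁻¹ • opE n l (torus n (kap k) f) := by
  have hq := q_ne_zero
  have h := torus_opE (kap k) l f
  rcases hkl with h' | h'
  · have h1 : lo l = hi k := by simp only [lo, hi, Fin.ext_iff]; omega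
    have h2 : hi l ≠ lo k := by simp only [lo, hi, ne_eq, Fin.ext_iff]; omega
    have h3 : hi l ≠ hi k := by simp only [hi, ne_eq, Fin.ext_iff]; omega
    have h := congrArg (q⁻¹ • ·) h
    simpa [kap, h1, h2, h3, (lo_lt_hi k).ne', smul_smul, hq] using h
  · have h1 : hi l = lo k := by simp only [lo, hi, Fin.ext_iff]; omega
    have h2 : lo l ≠ lo k := by simp only [lo, ne_eq, Fin.ext_iff]; omega
    have h3 : lo l ≠ hi k := by simp only [lo, hi, ne_eq, Fin.ext_iff]; omega
    simpa [kap, h1, h2, h3, (lo_lt_hi k).ne', smul_smul, hq] using h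

theorem torus_opE_far {k l : Fin (m - 1)} (hkl : k ≠ l) (hkl' : ¬ Adj k l) (f : P m n) :
    torus n (kap k) (opE n l f) = opE n l (torus n (kap k) f) := by
  have h := torus_opE (kap k) l f
  simp only [Adj, ne_eq, Fin.ext_iff] at hkl hkl'
  have h1 : lo l ≠ lo k := by simp only [lo, ne_eq, Fin.ext_iff]; omega
  have h2 : hi l ≠ lo k := by simp only [lo, hi, ne_eq, Fin.ext_iff]; omega
  have h3 : hi l ≠ hi k := by simp only [hi, ne_eq, Fin.ext_iff]; omega
  have h4 : lo l ≠ hi k := by simp only [lo, hi, ne_eq, Fin.ext_iff]; omega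
  simpa [kap, h1, h2, h3, h4] using h

theorem kap_comm (k l : Fin (m - 1)) (f : P m n) :
    torus n (kap k) (torus n (kap l) f) = torus n (kap l) (torus n (kap k) f) := by
  rw [torus_torus, torus_torus, mul_comm]

theorem opE_far {k l : Fin (m - 1)} (hkl : k ≠ l) (hkl' : ¬ Adj k l) :
    opE n k * opE n l = opE n l * opE n k := by
  refine linearMap_ext (by simp [opE_one]) fun a b f hf => ?_
  have hf' := congrArg (fun x => t a b * x) hf
  have e1 := torus_opE_far hkl hkl' f
  have e2 := torus_opE_far hkl.symm (fun h => hkl' h.symm) f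
  simp only [Adj, ne_eq, Fin.ext_iff] at hkl hkl'
  have h1 : lo l ≠ lo k := by simp only [lo, ne_eq, Fin.ext_iff]; omega
  have h2 : hi l ≠ lo k := by simp only [lo, hi, ne_eq, Fin.ext_iff]; omega
  have h4 : hi k ≠ lo l := by simp only [lo, hi, ne_eq, Fin.ext_iff]; omega
  simp only [Module.End.mul_apply] at hf' ⊢
  by_cases ha : a = lo k
  · subst ha
    simp only [opE_t, map_add, map_neg, map_smul, if_true, if_false, h1, h1.symm, h2, h4, map_zero,
      zero_add, e1, e2] at hf' ⊢
    linear_combination (norm := module) hf'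
  · by_cases ha' : a = lo l
    · subst ha'
      simp only [opE_t, map_add, map_neg, map_smul, if_true, if_false, h1, h1.symm, h2, h4,
        map_zero, zero_add, e1, e2] at hf' ⊢
      linear_combination (norm := module) hf'
    · simp only [opE_t, map_add, map_neg, map_smul, if_true, if_false, ha, ha', map_zero,
        zero_add] at hf' ⊢
      exact hf'

theorem opF_far {k l : Fin (m - 1)} (hkl : k ≠ l) (hkl' : ¬ Adj k l) :
    opF n k * opF n l = opF n l * opF n k := by
  refine linearMap_ext (by simp [opF_one]) fun a b f hf => ?_
  have hf' := congrArg (fun x => (kapInv l a * kapInv k a) • (t a b * x)) hf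
  simp only [Adj, ne_eq, Fin.ext_iff] at hkl hkl'
  have h1 : lo l ≠ lo k := by simp only [lo, ne_eq, Fin.ext_iff]; omega
  have h2 : hi l ≠ lo k := by simp only [lo, hi, ne_eq, Fin.ext_iff]; omega
  have h3 : hi l ≠ hi k := by simp only [hi, ne_eq, Fin.ext_iff]; omega
  have h4 : hi k ≠ lo l := by simp only [lo, hi, ne_eq, Fin.ext_iff]; omega
  simp only [Module.End.mul_apply] at hf' ⊢
  by_cases ha : a = hi k
  · subst ha
    simp only [opF_t, map_add, map_neg, map_smul, if_true, if_false, h1, h1.symm, h2, h2.symm, h3,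
      h3.symm, h4, map_zero, zero_add, kapInv, one_smul, one_mul, mul_one,
      (lo_lt_hi k).ne'] at hf' ⊢
    linear_combination (norm := module) hf'
  · by_cases ha' : a = hi l
    · subst ha'
      simp only [opF_t, map_add, map_neg, map_smul, if_true, if_false, h1, h1.symm, h2, h2.symm,
        h3, h3.symm, h4, h4.symm, map_zero, zero_add, kapInv, one_smul, one_mul, mul_one,
        (lo_lt_hi l).ne'] at hf' ⊢
      linear_combination (norm := module) hf'
    · simp only [opF_t, map_add, map_neg, map_smul, if_true, if_false, ha, ha', map_zero,
        zero_add] at hf' ⊢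
      linear_combination (norm := module) hf'

theorem opE_serre {k l : Fin (m - 1)} (hkl : Adj k l) :
    opE n k * opE n k * opE n l - (q + q⁻¹) • (opE n k * opE n l * opE n k) +
      opE n l * opE n k * opE n k = 0 := by
  have hq := q_ne_zero
  refine linearMap_ext (by simp [opE_one]) fun a b f hf => ?_
  have hf' := congrArg (fun x => t a b * x) hf
  have e1 : ∀ f : P m n, _ := fun f => torus_opE_adj hkl f
  have e2 : ∀ f : P m n, _ := fun f => torus_opE_adj (k := l) (l := k) hkl.symm f
  have e3 : ∀ f : P m n, _ := fun f => torus_opE_self k f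
  have e4 : ∀ f : P m n, _ := fun f => torus_opE_self l f
  have e5 : ∀ f : P m n, _ := fun f => kap_comm k l f
  simp only [LinearMap.add_apply, LinearMap.sub_apply, LinearMap.smul_apply, LinearMap.zero_apply,
    Module.End.mul_apply, mul_add, mul_sub, mul_smul_comm, mul_zero] at hf' ⊢
  have h0 : lo l ≠ lo k := by
    rcases hkl with h | h <;> simp only [lo, ne_eq, Fin.ext_iff] <;> omega
  have hk := (lo_lt_hi k).ne'
  have hl := (lo_lt_hi l).ne'
  by_cases ha : a = lo k
  · subst ha
    rcases hkl with h | h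
    · have h1 : hi k = lo l := by simp only [lo, hi, Fin.ext_iff]; omega
      have h2 : hi l ≠ lo k := by simp only [lo, hi, ne_eq, Fin.ext_iff]; omega
      simp only [opE_t, map_add, map_neg, map_smul, if_true, if_false, h1, h2, h0, h0.symm, hk, hl,
        map_zero, zero_add, add_zero, e1, e2, e3, e4, e5, mul_add, mul_smul_comm, smul_add,
        smul_neg, mul_neg, neg_neg] at hf' ⊢
      linear_combination (norm := skip) hf'
      match_scalars <;> field_simp <;> ring
    · have h1 : hi k ≠ lo l := by simp only [lo, hi, ne_eq, Fin.ext_iff]; omega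
      have h2 : hi l = lo k := by simp only [lo, hi, Fin.ext_iff]; omega
      simp only [opE_t, map_add, map_neg, map_smul, if_true, if_false, h1, h2, h0, h0.symm, hk, hl,
        map_zero, zero_add, add_zero, e1, e2, e3, e4, e5, mul_add, mul_smul_comm, smul_add,
        smul_neg, mul_neg, neg_neg] at hf' ⊢
      linear_combination (norm := skip) hf'
      match_scalars <;> field_simp <;> ring
  · by_cases ha' : a = lo l
    · subst ha'
      rcases hkl with h | h
      · have h1 : hi k = lo l := by simp only [lo, hi, Fin.ext_iff]; omega
        have h2 : hi l ≠ lo k := by simp only [lo, hi, ne_eq, Fin.ext_iff]; omega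
        simp only [opE_t, map_add, map_neg, map_smul, if_true, if_false, h1, h2, h0, h0.symm, hk,
          hl, map_zero, zero_add, add_zero, e1, e2, e3, e4, e5, mul_add, mul_smul_comm, smul_add,
          smul_neg, mul_neg, neg_neg] at hf' ⊢
        linear_combination (norm := skip) hf'
        match_scalars <;> field_simp <;> ring
      · have h1 : hi k ≠ lo l := by simp only [lo, hi, ne_eq, Fin.ext_iff]; omega
        have h2 : hi l = lo k := by simp only [lo, hi, Fin.ext_iff]; omega
        simp only [opE_t, map_add, map_neg, map_smul, if_true, if_false, h1, h2, h0, h0.symm, hk,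
          hl, map_zero, zero_add, add_zero, e1, e2, e3, e4, e5, mul_add, mul_smul_comm, smul_add,
          smul_neg, mul_neg, neg_neg] at hf' ⊢
        linear_combination (norm := skip) hf'
        match_scalars <;> field_simp <;> ring
    · simp only [opE_t, map_add, map_neg, map_smul, if_true, if_false, ha, ha', map_zero,
        zero_add] at hf' ⊢
      exact hf'

theorem opF_serre {k l : Fin (m - 1)} (hkl : Adj k l) :
    opF n k * opF n k * opF n l - (q + q⁻¹) • (opF n k * opF n l * opF n k) +
      opF n l * opF n k * opF n k = 0 := by
  have hq := q_ne_zero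
  refine linearMap_ext (by simp [opF_one]) fun a b f hf => ?_
  have hf' := congrArg (fun x => (kapInv k a * kapInv k a * kapInv l a) • (t a b * x)) hf
  simp only [LinearMap.add_apply, LinearMap.sub_apply, LinearMap.smul_apply, LinearMap.zero_apply,
    Module.End.mul_apply, mul_add, mul_sub, mul_smul_comm, mul_zero] at hf' ⊢
  have h0 : hi l ≠ hi k := by
    rcases hkl with h | h <;> simp only [hi, ne_eq, Fin.ext_iff] <;> omega
  have h0' : lo l ≠ lo k := by
    rcases hkl with h | h <;> simp only [lo, ne_eq, Fin.ext_iff] <;> omega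
  have hk := (lo_lt_hi k).ne'
  have hl := (lo_lt_hi l).ne'
  by_cases ha : a = hi k
  · subst ha
    rcases hkl with h | h
    · have h1 : hi k = lo l := by simp only [lo, hi, Fin.ext_iff]; omega
      have h2 : hi l ≠ lo k := by simp only [lo, hi, ne_eq, Fin.ext_iff]; omega
      simp only [opF_t, map_add, map_neg, map_smul, if_true, if_false, h1, h2, h2.symm, h0, h0.symm,
        h0', h0'.symm, hk, hl, hk.symm, hl.symm, kapInv,
        map_zero, zero_add, add_zero] at hf' ⊢
      linear_combination (norm := skip) hf'
      match_scalars <;> field_simp <;> ring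
    · have h1 : hi k ≠ lo l := by simp only [lo, hi, ne_eq, Fin.ext_iff]; omega
      have h2 : hi l = lo k := by simp only [lo, hi, Fin.ext_iff]; omega
      simp only [opF_t, map_add, map_neg, map_smul, if_true, if_false, h1, h1.symm, h2, h0, h0.symm,
        h0', h0'.symm, hk, hl, hk.symm, hl.symm, kapInv,
        map_zero, zero_add, add_zero] at hf' ⊢
      linear_combination (norm := skip) hf'
      match_scalars <;> field_simp <;> ring
  · by_cases ha' : a = hi l
    · subst ha'
      rcases hkl with h | h
      · have h1 : hi k = lo l := by simp only [lo, hi, Fin.ext_iff]; omega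
        have h2 : hi l ≠ lo k := by simp only [lo, hi, ne_eq, Fin.ext_iff]; omega
        simp only [opF_t, map_add, map_neg, map_smul, if_true, if_false, h1, h2, h2.symm, h0,
          h0.symm, h0', h0'.symm, hk, hl, hk.symm, hl.symm, kapInv,
          map_zero, zero_add, add_zero] at hf' ⊢
        linear_combination (norm := skip) hf'
        match_scalars <;> field_simp <;> ring
      · have h1 : hi k ≠ lo l := by simp only [lo, hi, ne_eq, Fin.ext_iff]; omega
        have h2 : hi l = lo k := by simp only [lo, hi, Fin.ext_iff]; omega
        simp only [opF_t, map_add, map_neg, map_smul, if_true, if_false, h1, h1.symm, h2, h0,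
          h0.symm, h0', h0'.symm, hk, hl, hk.symm, hl.symm, kapInv,
          map_zero, zero_add, add_zero] at hf' ⊢
        linear_combination (norm := skip) hf'
        match_scalars <;> field_simp <;> ring
    · simp only [opF_t, map_add, map_neg, map_smul, if_true, if_false, ha, ha', map_zero,
        zero_add] at hf' ⊢
      linear_combination (norm := module) hf'

end P

/-! ### The quantized enveloping algebra of `gl_m` -/

/-- The generators `E_k`, `F_k` (`1 ≤ k ≤ m - 1`), `K_{ε_i}` and `K_{ε_i}⁻¹` (`1 ≤ i ≤ m`). -/
inductive UGen (m : ℕ) : Type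
  | E (k : Fin (m - 1))
  | F (k : Fin (m - 1))
  | K (i : Fin m)
  | Ki (i : Fin m)

namespace UGen

/-- The generator as an element of the free algebra. -/
abbrev gE {m : ℕ} (k : Fin (m - 1)) : FreeAlgebra Kq (UGen m) := FreeAlgebra.ι Kq (UGen.E k)

/-- The generator as an element of the free algebra. -/
abbrev gF {m : ℕ} (k : Fin (m - 1)) : FreeAlgebra Kq (UGen m) := FreeAlgebra.ι Kq (UGen.F k)

/-- The generator as an element of the free algebra. -/
abbrev gK {m : ℕ} (i : Fin m) : FreeAlgebra Kq (UGen m) := FreeAlgebra.ι Kq (UGen.K i)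

/-- The generator as an element of the free algebra. -/
abbrev gKi {m : ℕ} (i : Fin m) : FreeAlgebra Kq (UGen m) := FreeAlgebra.ι Kq (UGen.Ki i)

end UGen

/-- The pairing of `ε_i` with the simple root `ε_k - ε_{k+1}`. -/
def wt {m : ℕ} (i : Fin m) (k : Fin (m - 1)) : ℤ :=
  (if i = lo k then 1 else 0) - (if i = hi k then 1 else 0)

/-- The defining relations of `U_q(gl_m)`. -/
inductive URel (m : ℕ) : FreeAlgebra Kq (UGen m) → FreeAlgebra Kq (UGen m) → Prop
  | K_Ki (i : Fin m) : URel m (UGen.gK i * UGen.gKi i) 1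
  | Ki_K (i : Fin m) : URel m (UGen.gKi i * UGen.gK i) 1
  | K_K (i j : Fin m) : URel m (UGen.gK i * UGen.gK j) (UGen.gK j * UGen.gK i)
  | K_E (i : Fin m) (k : Fin (m - 1)) :
      URel m (UGen.gK i * UGen.gE k * UGen.gKi i) (q ^ wt i k • UGen.gE k)
  | K_F (i : Fin m) (k : Fin (m - 1)) :
      URel m (UGen.gK i * UGen.gF k * UGen.gKi i) (q ^ (- wt i k) • UGen.gF k)
  | E_F (k l : Fin (m - 1)) :
      URel m (UGen.gE k * UGen.gF l - UGen.gF l * UGen.gE k)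
        (if k = l then (q - q⁻¹)⁻¹ • (UGen.gK (lo k) * UGen.gKi (hi k) -
          UGen.gKi (lo k) * UGen.gK (hi k)) else 0)
  | E_serre (k l : Fin (m - 1)) (h : Adj k l) :
      URel m (UGen.gE k * UGen.gE k * UGen.gE l - (q + q⁻¹) • (UGen.gE k * UGen.gE l * UGen.gE k) +
        UGen.gE l * UGen.gE k * UGen.gE k) 0
  | E_E (k l : Fin (m - 1)) (h : k ≠ l) (h' : ¬ Adj k l) :
      URel m (UGen.gE k * UGen.gE l) (UGen.gE l * UGen.gE k)
  | F_serre (k l : Fin (m - 1)) (h : Adj k l) :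
      URel m (UGen.gF k * UGen.gF k * UGen.gF l - (q + q⁻¹) • (UGen.gF k * UGen.gF l * UGen.gF k) +
        UGen.gF l * UGen.gF k * UGen.gF k) 0
  | F_F (k l : Fin (m - 1)) (h : k ≠ l) (h' : ¬ Adj k l) :
      URel m (UGen.gF k * UGen.gF l) (UGen.gF l * UGen.gF k)

/-- The quantized enveloping algebra `U_q(gl_m)` over `ℂ(q)`. -/
def Uq (m : ℕ) : Type := RingQuot (URel m)

instance (m : ℕ) : Ring (Uq m) := inferInstanceAs (Ring (RingQuot (URel m)))

instance (m : ℕ) : Algebra Kq (Uq m) := inferInstanceAs (Algebra Kq (RingQuot (URel m)))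

namespace P
variable {m n : ℕ}

/-- The row weights of `K_{ε_i}`. -/
def kw (i a : Fin m) : Kq := if a = i then q⁻¹ else 1

/-- The row weights of `K_{ε_i}⁻¹`. -/
def kwInv (i a : Fin m) : Kq := if a = i then q else 1

theorem kw_mul (i : Fin m) : kw i * kwInv i = 1 := by
  funext a
  simp only [kw, kwInv, Pi.mul_apply, Pi.one_apply]
  split_ifs <;> simp [q_ne_zero]

theorem kw_kap (k : Fin (m - 1)) : kw (lo k) * kwInv (hi k) = kap k := by
  funext a
  have := (lo_lt_hi k).ne
  simp only [kw, kwInv, kap, Pi.mul_apply]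
  split_ifs <;> simp_all

theorem kwInv_kap (k : Fin (m - 1)) : kwInv (lo k) * kw (hi k) = kapInv k := by
  funext a
  have := (lo_lt_hi k).ne
  simp only [kw, kwInv, kapInv, Pi.mul_apply]
  split_ifs <;> simp_all

theorem torus_conj_opE (i : Fin m) (k : Fin (m - 1)) (f : P m n) :
    torus n (kw i) (opE n k (torus n (kwInv i) f)) = q ^ wt i k • opE n k f := by
  have hq := q_ne_zero
  have hk := (lo_lt_hi k).ne
  have h := torus_opE (kw i) k (torus n (kwInv i) f)
  rw [torus_torus, kw_mul, torus_const_one] at h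
  simp only [kw, wt] at h ⊢
  by_cases h1 : i = lo k
  · subst h1
    have h' := congrArg (q • ·) h
    simpa [hk, hk.symm, smul_smul, hq] using h'
  · by_cases h2 : i = hi k
    · subst h2
      simpa [hk, hk.symm, smul_smul, hq] using h
    · simpa [h1, h2, Ne.symm h1, Ne.symm h2] using h

theorem torus_conj_opF (i : Fin m) (k : Fin (m - 1)) (f : P m n) :
    torus n (kw i) (opF n k (torus n (kwInv i) f)) = q ^ (- wt i k) • opF n k f := by
  have hq := q_ne_zero
  have hk := (lo_lt_hi k).ne
  have h := torus_opF (kw i) k (torus n (kwInv i) f)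
  rw [torus_torus, kw_mul, torus_const_one] at h
  simp only [kw, wt] at h ⊢
  by_cases h1 : i = lo k
  · subst h1
    simpa [hk, hk.symm, smul_smul, hq] using h
  · by_cases h2 : i = hi k
    · subst h2
      have h' := congrArg (q • ·) h
      simpa [hk, hk.symm, smul_smul, hq] using h'
    · simpa [h1, h2, Ne.symm h1, Ne.symm h2] using h

/-- The operator on `𝒫` given by a generator acting in the row index. -/
def opGen (m n : ℕ) : UGen m → Module.End Kq (P m n)
  | UGen.E k => opE n k
  | UGen.F k => opF n k
  | UGen.K i => (torus n (kw i)).toLinearMap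
  | UGen.Ki i => (torus n (kwInv i)).toLinearMap

theorem opGen_rel {x y : FreeAlgebra Kq (UGen m)} (h : URel m x y) :
    FreeAlgebra.lift Kq (opGen m n) x = FreeAlgebra.lift Kq (opGen m n) y := by
  induction h with
  | K_Ki i =>
    refine LinearMap.ext fun f => ?_
    simp [opGen, torus_torus, kw_mul, torus_const_one]
  | Ki_K i =>
    refine LinearMap.ext fun f => ?_
    simp [opGen, torus_torus, mul_comm (kwInv i), kw_mul, torus_const_one]
  | K_K i j =>
    refine LinearMap.ext fun f => ?_
    simp [opGen, torus_torus, mul_comm (kw i)]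
  | K_E i k =>
    refine LinearMap.ext fun f => ?_
    simpa [opGen] using torus_conj_opE i k f
  | K_F i k =>
    refine LinearMap.ext fun f => ?_
    have := torus_conj_opF i k f
    simp only [opGen, map_mul, map_smul, FreeAlgebra.lift_ι_apply]
    exact this
  | E_F k l =>
    have := opE_opF (n := n) k l
    simp only [map_sub, map_mul, FreeAlgebra.lift_ι_apply, opGen, this, apply_ite (FreeAlgebra.lift Kq (opGen m n)),
      map_smul, map_zero, qh]
    split_ifs
    · refine LinearMap.ext fun f => ?_
      simp [torus_torus, kw_kap, kwInv_kap]
    · rfl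
  | E_serre k l h => simpa [opGen] using opE_serre (n := n) h
  | E_E k l h h' => simpa [opGen] using opE_far (n := n) h h'
  | F_serre k l h => simpa [opGen] using opF_serre (n := n) h
  | F_F k l h h' => simpa [opGen] using opF_far (n := n) h h'

theorem isQuad_transpose :
    IsQuad (fun (a : Fin m) (b : Fin n) c d => (t b a * t d c : P n m)) := by
  rw [isQuad_iff]
  intro a b c d
  exact ((isQuad_iff _).1 (isQuad_t (m := n) (n := m)) b a d c).symm

/-- The transposition `t_{i,j} ↦ t_{j,i}` from `𝒫_{m × n}` to `𝒫_{n × m}`. -/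
def transpose (m n : ℕ) : P m n →ₐ[Kq] P n m := lift (fun a b => t b a) isQuad_transpose

theorem transpose_t (a : Fin m) (b : Fin n) : transpose m n (t a b) = t b a := lift_t _ _ a b

theorem transpose_transpose (f : P m n) : transpose n m (transpose m n f) = f := by
  have : (transpose n m).comp (transpose m n) = AlgHom.id Kq (P m n) := by
    apply algHom_ext
    intro a b
    simp [transpose_t]
  exact DFunLike.congr_fun this f

/-- The transposition as an isomorphism. -/
def transposeEquiv (m n : ℕ) : P m n ≃ₗ[Kq] P n m :=
  LinearEquiv.ofLinearMap (transpose m n).toLinearMap (transpose n m).toLinearMap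
    (LinearMap.ext fun f => transpose_transpose f) (LinearMap.ext fun f => transpose_transpose f)

/-- `X` acts on `𝒫` in the row index, as a skew derivation or as an automorphism. -/
def IsRow (X T : Module.End Kq (P m n)) : Prop :=
  ∃ (x : Kq) (ε β : Fin m → Kq) (s : Fin m → Fin m), X 1 = x • 1 ∧
    ∀ a b f, X (t a b * f) = ε a • (t (s a) b * T f) + β a • (t a b * X f)

/-- `Y` acts on `𝒫` in the column index, as a skew derivation or as an automorphism. -/
def IsCol (Y S : Module.End Kq (P m n)) : Prop :=
  ∃ (y : Kq) (ε β : Fin n → Kq) (s : Fin n → Fin n), Y 1 = y • 1 ∧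
    ∀ a b f, Y (t a b * f) = ε b • (t a (s b) * S f) + β b • (t a b * Y f)

theorem commute_of {X T Y S : Module.End Kq (P m n)} (hX : IsRow X T) (hY : IsCol Y S)
    (h1 : Commute T S) (h2 : Commute X S) (h3 : Commute T Y) : Commute X Y := by
  obtain ⟨x, ε, β, s, hx1, hx⟩ := hX
  obtain ⟨y, δ, γ, r, hy1, hy⟩ := hY
  refine linearMap_ext ?_ fun a b f hf => ?_
  · simp [hx1, hy1, smul_smul, mul_comm]
  · have e1 := DFunLike.congr_fun h1.eq f
    have e2 := DFunLike.congr_fun h2.eq f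
    have e3 := DFunLike.congr_fun h3.eq f
    simp only [Module.End.mul_apply] at e1 e2 e3 hf ⊢
    simp only [hx, hy, map_add, map_smul, e1, e2, e3, hf]
    module

theorem isRow_torus (α : Fin m → Kq) : IsRow (torus n α).toLinearMap 0 :=
  ⟨1, 0, α, id, by simp, fun a b f => by simpa using torus_t α a b f⟩

theorem isRow_opE (k : Fin (m - 1)) : IsRow (opE n k) (torus n (kap k)).toLinearMap :=
  ⟨0, fun a => if a = lo k then - q⁻¹ else 0, 1, fun _ => hi k, by simp [opE_one], fun a b f => by
    simp only [opE_t]; split_ifs <;> simp⟩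

theorem isRow_opF (k : Fin (m - 1)) :
    IsRow (opF n k) (torus n 1).toLinearMap :=
  ⟨0, fun a => if a = hi k then - q else 0, kapInv k, fun _ => lo k, by simp [opF_one],
    fun a b f => by simp only [opF_t]; split_ifs <;> simp [torus_const_one]⟩

theorem isRow_opGen (g : UGen m) :
    IsRow (opGen m n g) 0 ∨ ∃ α : Fin m → Kq, IsRow (opGen m n g) (torus n α).toLinearMap := by
  cases g with
  | E k => exact Or.inr ⟨_, isRow_opE k⟩
  | F k => exact Or.inr ⟨_, isRow_opF k⟩
  | K i => exact Or.inl (isRow_torus _)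
  | Ki i => exact Or.inl (isRow_torus _)

/-- Transport of operators along the transposition. -/
def conj (m n : ℕ) : Module.End Kq (P n m) ≃ₐ[Kq] Module.End Kq (P m n) :=
  (transposeEquiv n m).conjAlgEquiv Kq

theorem conj_apply (X : Module.End Kq (P n m)) (f : P m n) :
    conj m n X f = transpose n m (X (transpose m n f)) := rfl

theorem isCol_conj {X T : Module.End Kq (P n m)} (h : IsRow X T) :
    IsCol (conj m n X) (conj m n T) := by
  obtain ⟨x, ε, β, s, hx1, hx⟩ := h
  refine ⟨x, ε, β, s, by simp [conj_apply, hx1], fun a b f => ?_⟩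
  simp [conj_apply, transpose_t, hx]

theorem commute_gen (g : UGen m) (g' : UGen n) :
    Commute (opGen m n g) (conj m n (opGen n m g')) := by
  have h0 (α : Fin m → Kq) (β : Fin n → Kq) :
      Commute (torus n α).toLinearMap (conj m n (torus m β).toLinearMap) :=
    commute_of (isRow_torus α) (isCol_conj (isRow_torus β)) (Commute.zero_left _)
      (by rw [map_zero]; exact Commute.zero_right _) (Commute.zero_left _)
  have h1 (g : UGen m) (β : Fin n → Kq) :
      Commute (opGen m n g) (conj m n (torus m β).toLinearMap) := by
    rcases isRow_opGen (n := n) g with h | ⟨α, h⟩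
    · exact commute_of h (isCol_conj (isRow_torus β)) (Commute.zero_left _)
        (by rw [map_zero]; exact Commute.zero_right _) (Commute.zero_left _)
    · exact commute_of h (isCol_conj (isRow_torus β)) (by rw [map_zero]; exact Commute.zero_right _)
        (by rw [map_zero]; exact Commute.zero_right _) (h0 _ _)
  have h2 (α : Fin m → Kq) (g' : UGen n) :
      Commute (torus n α).toLinearMap (conj m n (opGen n m g')) := by
    rcases isRow_opGen (n := m) g' with h | ⟨β, h⟩
    · exact commute_of (isRow_torus α) (isCol_conj h) (Commute.zero_left _)
        (by rw [map_zero]; exact Commute.zero_right _) (Commute.zero_left _)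
    · exact commute_of (isRow_torus α) (isCol_conj h) (Commute.zero_left _)
        (h0 _ _) (Commute.zero_left _)
  rcases isRow_opGen (n := n) g with h | ⟨α, h⟩ <;>
    rcases isRow_opGen (n := m) g' with h' | ⟨β, h'⟩
  · exact commute_of h (isCol_conj h') (Commute.zero_left _)
      (by rw [map_zero]; exact Commute.zero_right _) (Commute.zero_left _)
  · exact commute_of h (isCol_conj h') (Commute.zero_left _) (h1 _ _) (Commute.zero_left _)
  · exact commute_of h (isCol_conj h') (by rw [map_zero]; exact Commute.zero_right _)
      (by rw [map_zero]; exact Commute.zero_right _) (h2 _ _)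
  · exact commute_of h (isCol_conj h') (h0 _ _) (h1 _ _) (h2 _ _)

end P

namespace Uq
variable {m n : ℕ}

/-- The quotient map from the free algebra. -/
def mk (m : ℕ) : FreeAlgebra Kq (UGen m) →ₐ[Kq] Uq m := RingQuot.mkAlgHom Kq (URel m)

theorem mk_rel {x y : FreeAlgebra Kq (UGen m)} (h : URel m x y) : mk m x = mk m y :=
  RingQuot.mkAlgHom_rel Kq h

theorem mk_surjective : Function.Surjective (mk m) := RingQuot.mkAlgHom_surjective Kq (URel m)

/-- The generator `E_k`. -/
def E (k : Fin (m - 1)) : Uq m := mk m (UGen.gE k)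

/-- The generator `F_k`. -/
def F (k : Fin (m - 1)) : Uq m := mk m (UGen.gF k)

/-- The invertible generator `K_{ε_i}`. -/
def K (i : Fin m) : (Uq m)ˣ where
  val := mk m (UGen.gK i)
  inv := mk m (UGen.gKi i)
  val_inv := by rw [← map_mul, mk_rel (URel.K_Ki i), map_one]
  inv_val := by rw [← map_mul, mk_rel (URel.Ki_K i), map_one]

/-- The element `K_λ = ∏ i, K_{ε_i} ^ λ_i` for an integral weight `λ = ∑ i, λ_i ε_i`. -/
def KLam (lam : Fin m → ℤ) : Uq m := ((List.ofFn fun i => K i ^ lam i).prod : (Uq m)ˣ)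

/-- The action of `U_L = U_q(gl_m)` on `𝒫`. -/
def phiL (m n : ℕ) : Uq m →ₐ[Kq] Module.End Kq (P m n) :=
  RingQuot.liftAlgHom Kq ⟨FreeAlgebra.lift Kq (P.opGen m n), fun _ _ h => P.opGen_rel h⟩

/-- The action of `U_R = U_q(gl_n)` on `𝒫`: the transpose of the row action on `𝒫_{n × m}`. -/
def phiR (m n : ℕ) : Uq n →ₐ[Kq] Module.End Kq (P m n) :=
  (P.conj m n).toAlgHom.comp (phiL n m)

theorem phiL_mk (x : FreeAlgebra Kq (UGen m)) :
    phiL m n (mk m x) = FreeAlgebra.lift Kq (P.opGen m n) x :=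
  RingQuot.liftAlgHom_mkAlgHom_apply Kq _ _ _

theorem phiL_phiR_commute (x : Uq m) (y : Uq n) : Commute (phiL m n x) (phiR m n y) := by
  obtain ⟨x, rfl⟩ := mk_surjective x
  obtain ⟨y, rfl⟩ := mk_surjective y
  have hy : phiR m n (mk n y) = P.conj m n (FreeAlgebra.lift Kq (P.opGen n m) y) :=
    congrArg (P.conj m n) (phiL_mk y)
  rw [phiL_mk, hy]
  induction x using FreeAlgebra.induction with
  | grade0 r => rw [AlgHom.commutes]; exact Algebra.commutes _ _
  | mul a b ha hb => rw [map_mul]; exact ha.mul_left hb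
  | add a b ha hb => rw [map_add]; exact ha.add_left hb
  | grade1 g =>
    rw [FreeAlgebra.lift_ι_apply]
    clear hy
    induction y using FreeAlgebra.induction with
    | grade0 r => rw [AlgHom.commutes, AlgEquiv.commutes]; exact (Algebra.commutes _ _).symm
    | mul a b ha hb => rw [map_mul, map_mul]; exact ha.mul_right hb
    | add a b ha hb => rw [map_add, map_add]; exact ha.add_right hb
    | grade1 g' => rw [FreeAlgebra.lift_ι_apply]; exact P.commute_gen g g'

end Uq

open scoped TensorProduct

/-- The algebra `U_LR = U_L ⊗ U_R`. -/
abbrev ULR (m n : ℕ) : Type := Uq m ⊗[Kq] Uq n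

/-- The action `φ_U` of `U_LR` on `𝒫`. -/
def phiU (m n : ℕ) : ULR m n →ₐ[Kq] Module.End Kq (P m n) :=
  Algebra.TensorProduct.lift (Uq.phiL m n) (Uq.phiR m n) Uq.phiL_phiR_commute

/-- The elements of `U_LR` that act on `𝒫` by elements of `𝒫𝒟`. -/
def UringLR (m n : ℕ) : Subalgebra Kq (ULR m n) := (PD.phi m n).range.comap (phiU m n)

/-- The elements `x` of `U_L` such that `x ⊗ 1` acts on `𝒫` by an element of `𝒫𝒟`. -/
def UringL (m n : ℕ) : Subalgebra Kq (Uq m) :=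
  (UringLR m n).comap Algebra.TensorProduct.includeLeft

/-- The elements `x` of `U_R` such that `1 ⊗ x` acts on `𝒫` by an element of `𝒫𝒟`. -/
def UringR (m n : ℕ) : Subalgebra Kq (Uq n) :=
  (UringLR m n).comap Algebra.TensorProduct.includeRight

/-- The weight `λ_a = - ∑ i ≥ a, 2 ε_i`. -/
def lamTail {m : ℕ} (a i : Fin m) : ℤ := if a ≤ i then -2 else 0

/-! ### Checks: the actions are the intended ones -/

namespace Uq
variable {m n : ℕ}

theorem phiL_E (k : Fin (m - 1)) : phiL m n (E k) = P.opE n k := by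
  rw [E, phiL_mk, FreeAlgebra.lift_ι_apply]; rfl

theorem phiL_F (k : Fin (m - 1)) : phiL m n (F k) = P.opF n k := by
  rw [F, phiL_mk, FreeAlgebra.lift_ι_apply]; rfl

theorem phiL_K (i : Fin m) : phiL m n (K i) = (P.torus n (P.kw i)).toLinearMap := by
  rw [K, phiL_mk, FreeAlgebra.lift_ι_apply]; rfl

theorem phiR_apply (x : Uq n) (f : P m n) :
    phiR m n x f = P.transpose n m (phiL n m x (P.transpose m n f)) := rfl

theorem torus_single (α : Fin m → Kq) (a : Fin m) (b : Fin n) :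
    P.torus n α (P.t a b) = α a • P.t a b := P.lift_t _ _ a b

theorem phiL_E_t (k : Fin (m - 1)) (a : Fin m) (b : Fin n) :
    phiL m n (E k) (P.t a b) = if a = lo k then -(q⁻¹ • P.t (hi k) b) else 0 := by
  have := P.opE_t k a b (1 : P m n)
  simpa [phiL_E, P.opE_one] using this

theorem phiL_F_t (k : Fin (m - 1)) (a : Fin m) (b : Fin n) :
    phiL m n (F k) (P.t a b) = if a = hi k then -(q • P.t (lo k) b) else 0 := by
  have := P.opF_t k a b (1 : P m n)
  simpa [phiL_F, P.opF_one] using this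

theorem phiL_K_t (i a : Fin m) (b : Fin n) :
    phiL m n (K i) (P.t a b) = if a = i then q⁻¹ • P.t a b else P.t a b := by
  rw [phiL_K, AlgHom.toLinearMap_apply, torus_single, P.kw]
  split_ifs <;> simp

theorem phiR_E_t (k : Fin (n - 1)) (a : Fin m) (b : Fin n) :
    phiR m n (E k) (P.t a b) = if b = lo k then -(q⁻¹ • P.t a (hi k)) else 0 := by
  rw [phiR_apply, P.transpose_t, phiL_E_t]
  split_ifs <;> simp [P.transpose_t]

theorem phiR_F_t (k : Fin (n - 1)) (a : Fin m) (b : Fin n) :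
    phiR m n (F k) (P.t a b) = if b = hi k then -(q • P.t a (lo k)) else 0 := by
  rw [phiR_apply, P.transpose_t, phiL_F_t]
  split_ifs <;> simp [P.transpose_t]

theorem phiR_K_t (i : Fin n) (a : Fin m) (b : Fin n) :
    phiR m n (K i) (P.t a b) = if b = i then q⁻¹ • P.t a b else P.t a b := by
  rw [phiR_apply, P.transpose_t, phiL_K_t]
  split_ifs <;> simp [P.transpose_t]

theorem skew_mul {α β : Fin m → Kq} {X : Module.End Kq (P m n)} {e : Fin m → Fin n → P m n}
    (hX1 : X 1 = 0)
    (hX : ∀ a b f, X (P.t a b * f) = e a b * P.torus n α f + β a • (P.t a b * X f)) (f g : P m n) :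
    X (f * g) = X f * P.torus n α g + P.torus n β f * X g := by
  induction f using P.induction_on with
  | h1 => simp [hX1]
  | hadd f f' hf hf' => simp only [add_mul, map_add, hf, hf']; abel
  | hsmul r f hf => simp only [smul_mul_assoc, map_smul, hf, smul_add]
  | ht a b f hf =>
    rw [mul_assoc, hX, hX, hf, map_mul, P.torus_t]
    simp only [mul_add, add_mul, smul_mul_assoc, smul_add, mul_assoc, add_assoc]

/-- The coproduct rule for `E_k`; `K_k` acts as the automorphism of row weights `P.kap k`. -/
theorem phiL_E_mul (k : Fin (m - 1)) (f g : P m n) :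
    phiL m n (E k) (f * g) = phiL m n (E k) f * P.torus n (P.kap k) g + f * phiL m n (E k) g := by
  have := skew_mul (X := P.opE n k) (P.opE_one k) (P.skew_t _ _ _ (P.isQuad_eVal k)) f g
  rwa [P.torus_const_one, ← phiL_E] at this

/-- The coproduct rule for `F_k`. -/
theorem phiL_F_mul (k : Fin (m - 1)) (f g : P m n) :
    phiL m n (F k) (f * g) =
      phiL m n (F k) f * g + P.torus n (P.kapInv k) f * phiL m n (F k) g := by
  have := skew_mul (X := P.opF n k) (P.opF_one k) (P.skew_t _ _ _ (P.isQuad_fVal k)) f g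
  rwa [P.torus_const_one, ← phiL_F] at this

/-- The coproduct rule for `K_{ε_i}`. -/
theorem phiL_K_mul (i : Fin m) (f g : P m n) :
    phiL m n (K i) (f * g) = phiL m n (K i) f * phiL m n (K i) g := by
  simp [phiL_K]

theorem phiL_K_K (k : Fin (m - 1)) :
    phiL m n (K (lo k) * (K (hi k))⁻¹ : (Uq m)ˣ) = (P.torus n (P.kap k)).toLinearMap := by
  have h : phiL m n ((K (hi k))⁻¹ : (Uq m)ˣ) = (P.torus n (P.kwInv (hi k))).toLinearMap := by
    show phiL m n (mk m (UGen.gKi (hi k))) = _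
    rw [phiL_mk, FreeAlgebra.lift_ι_apply]; rfl
  rw [Units.val_mul, map_mul, h, phiL_K]
  refine LinearMap.ext fun f => ?_
  simp [P.torus_torus, P.kw_kap]

end Uq

namespace PD
variable {m n : ℕ}

theorem isQuad_tt : IsQuad (fun (a : Fin m) (b : Fin n) c d => (t a b * t c d : PD m n)) := by
  refine ⟨fun k i j h => ?_, fun k i j h => ?_, fun i k j l h h' => ?_, fun i k j l h h' => ?_⟩
  · simpa [t] using mk_rel (PDRel.t_row k i j h)
  · simpa [t] using mk_rel (PDRel.t_col k i j h)
  · simpa [t] using mk_rel (PDRel.t_comm i k j l h h')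
  · simpa [t, qh] using mk_rel (PDRel.t_cross i k j l h h')

/-- The canonical map from `𝒫` to `𝒫𝒟`. -/
def ofP (m n : ℕ) : P m n →ₐ[Kq] PD m n := P.lift t isQuad_tt

theorem ofP_t (i : Fin m) (j : Fin n) : ofP m n (P.t i j) = t i j := P.lift_t _ _ i j

theorem mixed (a a' : Fin m) (b b' : Fin n) : (d a' b' * t a b : PD m n) =
    algebraMap Kq (PD m n) (kd a a' * kd b b') +
      tau (fun x x' => tau (fun y y' => t x y * d x' y') b b') a a' := by
  have h := mk_rel (PDRel.mixed a a' b b')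
  simp only [map_mul (mk m n), map_add, map_sum, map_smul, AlgHom.commutes] at h
  simp only [← sum_mixCoeff, Finset.smul_sum, smul_smul]
  exact h

/-- The left ideal `ℐ` of `𝒫𝒟` generated by the `∂_{i,j}`. -/
def delIdeal (m n : ℕ) : Ideal (PD m n) :=
  Ideal.span (Set.range fun p : Fin m × Fin n => d p.1 p.2)

theorem mul_ofP_sub_mem (D : PD m n) (f : P m n) :
    D * ofP m n f - ofP m n (phi m n D f) ∈ delIdeal m n := by
  obtain ⟨D, rfl⟩ := RingQuot.mkAlgHom_surjective Kq (PDRel m n) D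
  change mk m n D * ofP m n f - ofP m n (phi m n (mk m n D) f) ∈ delIdeal m n
  induction D using FreeAlgebra.induction generalizing f with
  | grade0 r =>
    rw [AlgHom.commutes, AlgHom.commutes, Module.algebraMap_end_apply, map_smul,
      Algebra.smul_def, sub_self]
    exact zero_mem _
  | mul x y hx hy =>
    have h1 := (delIdeal m n).mul_mem_left (mk m n x) (hy f)
    have h2 := hx (phi m n (mk m n y) f)
    have h3 := add_mem h1 h2
    rw [mul_sub, ← mul_assoc, sub_add_sub_cancel] at h3
    rw [map_mul, map_mul]
    exact h3
  | add x y hx hy =>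
    have h3 := add_mem (hx f) (hy f)
    rw [sub_add_sub_comm, ← add_mul, ← map_add (ofP m n)] at h3
    rw [map_add, map_add]
    exact h3
  | grade1 g =>
    cases g with
    | t i j =>
      have h : phi m n (mk m n (FreeAlgebra.ι Kq (PDGen.t i j))) f = P.t i j * f := phi_t i j f
      rw [h, map_mul, ofP_t]
      change t i j * _ - t i j * _ ∈ _
      rw [sub_self]
      exact zero_mem _
    | d i j =>
      have h (f : P m n) : phi m n (mk m n (FreeAlgebra.ι Kq (PDGen.d i j))) f = P.del i j f :=
        phi_d i j f
      rw [h]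
      change d i j * _ - _ ∈ _
      let Q := PD m n ⧸ delIdeal m n
      let π : PD m n →ₗ[Kq] Q := (delIdeal m n).mkQ.restrictScalars Kq
      have hπ (x : PD m n) : π x = 0 ↔ x ∈ delIdeal m n := Submodule.Quotient.mk_eq_zero _
      have hπm (x y : PD m n) : π (x * y) = x • π y := rfl
      have key : ∀ i j, π (d i j * ofP m n f) = π (ofP m n (P.del i j f)) := by
        induction f using P.induction_on with
        | h1 =>
          intro i j
          rw [P.del_one, map_zero, map_zero, map_one, mul_one]
          exact (hπ _).2 (Ideal.subset_span ⟨(i, j), rfl⟩)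
        | hadd f g hf hg =>
          intro i j
          rw [map_add, map_add, mul_add, map_add, hf, hg, map_add, map_add]
        | hsmul r f hf =>
          intro i j
          rw [map_smul, map_smul, mul_smul_comm, map_smul, hf, map_smul, map_smul]
        | ht a b f hf =>
          intro i j
          have e : d i j * ofP m n (P.t a b * f) = algebraMap Kq (PD m n) (kd a i * kd b j) *
              ofP m n f + tau (fun x x' => tau (fun y y' => t x y * d x' y' * ofP m n f) b j) a i := by
            rw [map_mul, ofP_t, ← mul_assoc, mixed, add_mul]
            congr 1
            refine (tau_map (LinearMap.mulRight Kq (ofP m n f)) _ a i).trans ?_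
            congr 1; funext x x'
            exact tau_map (LinearMap.mulRight Kq (ofP m n f)) _ b j
          rw [e, P.del_t_mul, map_add, map_add, map_add]
          congr 1
          · rw [← Algebra.smul_def, ← map_smul (ofP m n)]
            congr 2
            simp only [kd]
            split_ifs <;> simp
          · refine (tau_map π _ a i).trans (Eq.trans ?_
              (tau_map (π ∘ₗ (ofP m n).toLinearMap) _ a i).symm)
            congr 1; funext x x'
            refine (tau_map π _ b j).trans (Eq.trans ?_
              (tau_map (π ∘ₗ (ofP m n).toLinearMap) _ b j).symm)
            congr 1; funext y y'
            rw [mul_assoc, hπm, hf, ← hπm]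
            simp [ofP_t]
      rw [← hπ, map_sub, key, sub_self]

/-- The map `𝒫 → 𝒫𝒟 / ℐ` is injective. -/
theorem eq_zero_of_ofP_mem (f : P m n) (h : ofP m n f ∈ delIdeal m n) : f = 0 := by
  have h2 : ∀ D ∈ delIdeal m n, phi m n D 1 = 0 := by
    intro D hD
    induction hD using Submodule.span_induction with
    | mem x hx =>
      obtain ⟨p, rfl⟩ := hx
      simp [P.del_one]
    | zero => simp
    | add x y _ _ hx hy => simp [hx, hy]
    | smul r x _ hx => simp [hx]
  rw [← h2 _ h]
  clear h
  induction f using P.induction_on with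
  | h1 => simp
  | hadd f g hf hg => rw [map_add, map_add, LinearMap.add_apply, ← hf, ← hg]
  | hsmul r f hf => rw [map_smul, map_smul, LinearMap.smul_apply, ← hf]
  | ht a b f hf => rw [map_mul, map_mul, Module.End.mul_apply, ← hf, ofP_t, phi_t]

end PD
end
end QWeyl

open QWeyl
open scoped TensorProduct

namespace QWeyl
noncomputable section

/-! ### Elementary values of the mixed braid operator. -/

section Braid
variable {ι M : Type} [LinearOrder ι] [Fintype ι] [AddCommGroup M] [Module Kq M]

/-! Every $K_\lambda$ in $U_L$ acts on $\mathscr P$ by rescaling rows, and $K_{\lambda_{L,a}}$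
multiplies the rows $i \ge a$ by $q^2$ (`Uq.phiL_KLam_lamTail`). Thus the point is to realise the
row scalings `tailWt a` by elements of $\mathscr{PD}$. This goes by descending induction on $a$;
past the last row the scaling is the identity.

The inductive step rests on an operator identity $$K_{\varepsilon_a}^{-1} = K_{\varepsilon_a} +
(1-q^{-2})\sum_j t_{a,j}\sum_c w_c\,\partial_{c,j}L_c, \qquad w_c = q^{2(m+1-c)}.$$ Here the $L_c$
(`opL`) form the $a$-th column of a triangular $L$-operator: $L_c = 0$ for $c<a$, $L_a =
K_{\varepsilon_a}$, and $L_{c+1} = qL_cX_c - X_cL_c$ for $c\ge a$ with $X_c = E_cK_c^{-1}$.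

The identity holds because of three commutation rules with the generators $t_{b,d}$. The $L_c$ pass
through $t_{b,d}$ by a triangular $R$-matrix in the row index (`opL_t`). The weights $w_c$ are those
for which this $R$-matrix cancels the row braiding of the $\partial_{c,j}$ in the contraction over
$c$ (`opV_t`). A further contraction with $t_{i,j}$ over $j$ leaves a column braiding, which the
relations of $\mathscr P$ exchange for a row braiding (`opZ_t`). The resulting operators $Z_i$
satisfy $Z_it_{i,d} = q\,t_{i,d}Z_i$, and for $b \ne i$, $Z_it_{b,d} = t_{b,d}Z_i$, with the extra
term $(q-q^{-1})t_{i,d}Z_b$ when $b>i$. Since $Z_i\cdot 1 = q[\![i,a]\!]$, this triangular recursion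
forces $Z_i = 0$ for $i>a$ and $Z_a = qK_{\varepsilon_a}^{-1}$ (`opZ_eq`).

Composing with the scaling `midWt a` turns $K_{\varepsilon_a}$ and $K_{\varepsilon_a}^{-1}$ into the
scalings for $a+1$ and $a$. It remains to see that each $L_c$ composed with `midWt a` comes from
$\mathscr{PD}$. For $c=a$ this is the induction hypothesis. Passing from $c$ to $c+1$ is, up to
sign, the adjoint action $D \mapsto X_cD - K_c^{-1}DK_cX_c$, and the image of $\mathscr{PD}$ is
stable under it (`PD.adjoint_mem_range`), as a check on generators shows (`opEK_t`, `opEK_del`).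

For $a=m$ only $c=m$ contributes, which gives the closed formula. The statement for $U_R$ follows by
the transposition $t_{i,j}\mapsto t_{j,i}$, which carries $\partial_{i,j}$ to $\partial_{j,i}$. -/

theorem tau_self (F : ι → ι → M) (a : ι) :
    tau F a a = q • F a a + qh • gtSum a (fun x => F x x) := if_pos rfl

theorem tau_ne (F : ι → ι → M) {a c : ι} (h : a ≠ c) : tau F a c = F a c := if_neg h

/-- Weights that cancel on the diagonal can be pulled out of `tau`. -/
theorem tau_weight (F : ι → ι → M) {γ δ : ι → Kq} (h : ∀ x, γ x * δ x = 1) (a c : ι) :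
    tau (fun x y => (γ x * δ y) • F x y) a c = (γ a * δ c) • tau F a c := by
  by_cases hac : a = c
  · subst hac
    rw [tau_self, tau_self]
    simp only [h, one_smul]
  · rw [tau_ne _ hac, tau_ne _ hac]

end Braid

/-! ### Commutation of row scalings and of $E_kK_k^{-1}$ with the derivatives. -/

namespace P
variable {m n : ℕ}

/-- Row scalings as a homomorphism of monoids. -/
def torusHom (m n : ℕ) : (Fin m → Kq) →* Module.End Kq (P m n) where
  toFun γ := (torus n γ).toLinearMap
  map_one' := LinearMap.ext fun f => torus_const_one f
  map_mul' γ δ := LinearMap.ext fun f => (torus_torus γ δ f).symm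

theorem torusHom_apply (γ : Fin m → Kq) (f : P m n) : torusHom m n γ f = torus n γ f := rfl

/-- `∂_{c,d}` lowers the weight of the `c`-th row. -/
theorem torus_del {γ : Fin m → Kq} (hγ : ∀ x, γ x ≠ 0) (f : P m n) : ∀ (c : Fin m) (d : Fin n),
    γ c • torus n γ (del c d f) = del c d (torus n γ f) := by
  induction f using induction_on with
  | h1 => intro c d; simp [del_one]
  | hadd f g hf hg => intro c d; simp only [map_add, smul_add, hf, hg]
  | hsmul r f hf => intro c d; rw [map_smul, map_smul, smul_comm, hf, map_smul, map_smul]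
  | ht a b f hf =>
    intro c d
    rw [torus_t, map_smul, del_t_mul, del_t_mul, map_add, smul_add, smul_add]
    congr 1
    · by_cases h : a = c
      · subst h; split_ifs <;> simp
      · simp [h]
    · have key : ∀ x y, γ y • torus n γ (tau (fun b' d' => t x b' * del y d' f) b d) =
          γ x • tau (fun b' d' => t x b' * del y d' (torus n γ f)) b d := by
        intro x y
        have h1 := tau_map (γ y • (torus n γ).toLinearMap)
          (fun b' d' => t x b' * del y d' f) b d
        refine h1.trans ?_
        rw [← tau_smul]
        congr 1; funext b' d'
        simp only [LinearMap.smul_apply, AlgHom.toLinearMap_apply, torus_t, ← hf y d',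
          mul_smul_comm]
        rw [smul_comm]
      have h2 := tau_map (torus n γ).toLinearMap
        (fun a' c' => tau (fun b' d' => t a' b' * del c' d' f) b d) a c
      simp only [AlgHom.toLinearMap_apply] at h2
      rw [h2]
      by_cases h : a = c
      · subst h
        -- On the diagonal, each summand $t_x\partial_x$ of the mixed braiding carries its own
        -- weight $\gamma_x$ on both sides. Dividing by it term by term is what needs all $\gamma_x$
        -- to be nonzero.
        have e (x) := smul_right_injective (P m n) (hγ x) (key x x)
        rw [tau_self, tau_self, e]
        simp only [e]
      · rw [tau_ne _ h, tau_ne _ h]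
        exact key a c

/-- The operator `E_k K_k⁻¹` on `𝒫`. -/
def opEK (n : ℕ) (k : Fin (m - 1)) : P m n →ₗ[Kq] P m n :=
  opE n k ∘ₗ (torus n (kapInv k)).toLinearMap

theorem opEK_apply (k : Fin (m - 1)) (f : P m n) :
    opEK n k f = opE n k (torus n (kapInv k) f) := rfl

theorem opEK_one (k : Fin (m - 1)) : opEK n k 1 = 0 := by
  rw [opEK_apply, torus_one, opE_one]

/-- The coproduct of $X = E_kK_k^{-1}$ is $X\otimes 1 + K_k^{-1}\otimes X$. The twist by $K_k$ on
$f$, present for $E_k$, has disappeared, so commuting $X$ past $t_{a,b}$ leaves only an element of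
$\mathscr P$ as error term. -/
theorem opEK_t (k : Fin (m - 1)) (a : Fin m) (b : Fin n) (f : P m n) :
    opEK n k (t a b * f) =
      (if a = lo k then -(t (hi k) b * f) else 0) + kapInv k a • (t a b * opEK n k f) := by
  have hq := q_ne_zero
  rw [opEK_apply, torus_t, map_smul, opE_t, torus_torus, kap_mul_kapInv, torus_const_one, smul_add]
  congr 1
  split_ifs with h
  · subst h; simp [kapInv, smul_smul, hq]
  · simp

theorem kapInv_ne_zero (k : Fin (m - 1)) (a : Fin m) : kapInv k a ≠ 0 := by
  have hq := q_ne_zero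
  unfold kapInv; split_ifs <;> simp [hq]

/-- $E_kK_k^{-1}$ moves one unit of row degree from `lo k` to `hi k`. -/
theorem torus_opEK (c : Fin m → Kq) (k : Fin (m - 1)) (f : P m n) :
    c (lo k) • torus n c (opEK n k f) = c (hi k) • opEK n k (torus n c f) := by
  rw [opEK_apply, torus_opE, opEK_apply, torus_torus, torus_torus, mul_comm]

theorem opEK_far {k l : Fin (m - 1)} (hkl : k ≠ l) (hkl' : ¬ Adj k l) (f : P m n) :
    opEK n k (opEK n l f) = opEK n l (opEK n k f) := by
  -- For roots that are neither equal nor adjacent, $K_k^{-1}$ commutes with $E_l$. Both torus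
  -- factors move to the right, and what remains is the commutation of $E_k$ with $E_l$.
  have key (k l : Fin (m - 1)) (h : k ≠ l) (h' : ¬ Adj k l) (g : P m n) :
      opEK n k (opEK n l g) = opE n k (opE n l (torus n (kapInv k * kapInv l) g)) := by
    simp only [Adj, ne_eq, Fin.ext_iff] at h h'
    have h1 : lo l ≠ lo k := by simp only [lo, ne_eq, Fin.ext_iff]; omega
    have h2 : hi l ≠ lo k := by simp only [lo, hi, ne_eq, Fin.ext_iff]; omega
    have h3 : hi l ≠ hi k := by simp only [hi, ne_eq, Fin.ext_iff]; omega
    have h4 : lo l ≠ hi k := by simp only [lo, hi, ne_eq, Fin.ext_iff]; omega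
    have e := torus_opE (kapInv k) l (torus n (kapInv l) g)
    simp only [kapInv, h1, h2, h3, h4, if_false, one_smul] at e
    rw [opEK_apply, opEK_apply, ← torus_torus]
    exact congrArg _ e
  rw [key k l hkl hkl', key l k hkl.symm (fun h => hkl' h.symm), mul_comm]
  exact DFunLike.congr_fun (opE_far hkl hkl') _

/-- Equivariance of the mixed braiding under $X = E_kK_k^{-1}$, with `Φ x y` in the role of
$t_x\partial_y f$. The first two terms come from $X$ acting on the outputs of the braiding, where it
replaces $t_{lo}$ by $-t_{hi}$ and $\partial_{hi}$ by $q\,\partial_{lo}$. The third term and the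
right side come from the same replacements on the inputs. -/
theorem tau_shift {M : Type} [AddCommGroup M] [Module Kq M] (k : Fin (m - 1))
    (Φ : Fin m → Fin m → M) (a c : Fin m) :
    tau (fun x y => (if x = lo k then -Φ (hi k) y else 0)) a c +
        tau (fun x y => if y = hi k then (kapInv k x * q) • Φ x (lo k) else 0) a c +
        kap k c • (if a = lo k then tau Φ (hi k) c else 0) =
      if c = hi k then q • tau Φ a (lo k) else 0 := by
  have hq := q_ne_zero
  have hk := (lo_lt_hi k)
  by_cases hac : a = c
  · subst hac
    rw [tau_self, tau_self]
    simp only [gtSum_ite', gtSum_zero, add_zero, sub_zero]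
    rcases eq_or_ne a (lo k) with h | h
    · subst h
      simp only [if_true, if_false, hk.ne, hk.ne', hk, lt_irrefl, tau_ne _ hk.ne', kap, kapInv,
        smul_zero, add_zero, zero_add, qh]
      match_scalars; field_simp; ring
    · rcases eq_or_ne a (hi k) with h' | h'
      · subst h'
        simp only [if_true, if_false, hk.ne', hk.not_gt, lt_irrefl, tau_ne _ hk.ne', kap,
          kapInv, smul_zero, add_zero, zero_add]
        match_scalars; field_simp
      · have h1 : a < hi k ↔ a < lo k := ⟨fun h1 => lt_lo h1 h, fun h1 => h1.trans hk⟩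
        simp only [h, h', if_false, h1, smul_zero, zero_add, add_zero, kapInv, hk.ne', if_true]
        split_ifs
        · match_scalars; field_simp; ring
        · simp
  · rw [tau_ne _ hac, tau_ne _ hac]
    rcases eq_or_ne c (hi k) with h | h
    · subst h
      rcases eq_or_ne a (lo k) with h' | h'
      · subst h'
        simp only [if_true, tau_self, gtSum_split hk, kap, kapInv, hk.ne', if_false, qh]
        -- No position lies strictly between `lo k` and `hi k`.
        have : midSum (lo k) (hi k) (fun x => Φ x x) = 0 := by
          refine Finset.sum_eq_zero fun x _ => if_neg ?_
          simp only [lo, hi, Fin.lt_def]; omega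
        rw [this]
        match_scalars <;> field_simp <;> ring
      · simp only [h', hac, if_true, if_false, tau_ne _ h', kapInv]
        match_scalars; field_simp
    · rcases eq_or_ne a (lo k) with h' | h'
      · subst h'
        simp only [h, if_true, if_false, tau_ne _ (Ne.symm h), kap, Ne.symm hac]
        match_scalars <;> field_simp <;> ring
      · simp [h, h']

/-- The counterpart of `opEK_t` for the derivatives: moving $X$ past $\partial_{c,d}$ costs a scalar
and one further derivative, so the error term again lies in the image of $\mathscr{PD}$. It follows
by induction along the recursion `del_t_mul`, in which `tau_weight` handles the scalars and
`tau_shift` the replacements of rows. -/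
theorem opEK_del (k : Fin (m - 1)) (f : P m n) : ∀ (c : Fin m) (d : Fin n),
    opEK n k (del c d f) =
      kap k c • del c d (opEK n k f) + if c = hi k then q • del (lo k) d f else 0 := by
  have hκ (x : Fin m) : kapInv k x * kap k x = 1 := by
    rw [mul_comm]; exact congrFun (kap_mul_kapInv k) x
  induction f using induction_on with
  | h1 => intro c d; simp [opEK_one, del_one]
  | hadd f g hf hg =>
    intro c d
    simp only [map_add, smul_add, hf, hg]
    split_ifs <;> module
  | hsmul r f hf =>
    intro c d
    simp only [map_smul, hf, smul_add, smul_comm r]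
    split_ifs <;> simp [smul_comm r]
  | ht a b f hf =>
    intro c d
    let Φ : Fin m → Fin m → P m n := fun x y => tau (fun b' d' => t x b' * del y d' f) b d
    let Ψ : Fin m → Fin m → P m n :=
      fun x y => tau (fun b' d' => t x b' * del y d' (opEK n k f)) b d
    -- The middle term carries weights that multiply to $1$ on the diagonal, so they come out of the
    -- row braiding. The outer two terms are those treated by `tau_shift`.
    have hΦ : ∀ x y, opEK n k (Φ x y) = (if x = lo k then -Φ (hi k) y else 0) +
        (kapInv k x * kap k y) • Ψ x y +
        if y = hi k then (kapInv k x * q) • Φ x (lo k) else 0 := by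
      intro x y
      have e1 : ∀ b' d', opEK n k (t x b' * del y d' f) =
          ((if x = lo k then (-1 : Kq) else 0) • (t (hi k) b' * del y d' f) +
            (kapInv k x * kap k y) • (t x b' * del y d' (opEK n k f))) +
          (if y = hi k then kapInv k x * q else 0) • (t x b' * del (lo k) d' f) := by
        intro b' d'
        rw [opEK_t, hf]
        split_ifs <;> simp [mul_add, smul_smul, add_assoc]
      simp only [Φ, Ψ, tau_map]
      simp only [e1]
      rw [tau_add (fun b' d' => _ + _), tau_add, tau_smul, tau_smul, tau_smul]
      split_ifs <;> simp
    have hδ : ∀ (x y : Fin m), del y d (t x b * f) =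
        (if x = y then (if b = d then f else 0) else 0) + tau Φ x y :=
      fun x y => del_t_mul x y b d f
    have hδ' : del c d (t a b * opEK n k f) =
        (if a = c then (if b = d then opEK n k f else 0) else 0) + tau Ψ a c :=
      del_t_mul a c b d _
    have e2 : opEK n k (tau Φ a c) =
        tau (fun x y => (if x = lo k then -Φ (hi k) y else 0)) a c +
        (kapInv k a * kap k c) • tau Ψ a c +
        tau (fun x y => if y = hi k then (kapInv k x * q) • Φ x (lo k) else 0) a c := by
      rw [tau_map, ← tau_weight Ψ hκ, ← tau_add, ← tau_add]
      simp only [hΦ]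
    have e3 := tau_shift k Φ a c
    rw [hδ, map_add, e2, opEK_t, map_add, map_smul, hδ', hδ]
    have e4 : del c d (if a = lo k then -(t (hi k) b * f) else 0) =
        -((if a = lo k then (if hi k = c then (if b = d then f else 0) else 0) else 0) +
          if a = lo k then tau Φ (hi k) c else 0) := by
      split_ifs with h1 <;> simp_all
    rw [e4]
    have e5 : opEK n k (if a = c then (if b = d then f else 0) else 0) =
        (kap k c * kapInv k a) • (if a = c then (if b = d then opEK n k f else 0) else 0) := by
      by_cases h : a = c
      · subst h
        rw [mul_comm, hκ, one_smul]; split_ifs <;> simp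
      · simp [h]
    have e6 : (if c = hi k then q • ((if a = lo k then (if b = d then f else 0) else 0) +
          tau Φ a (lo k)) else 0) =
        kap k c • (if a = lo k then (if hi k = c then (if b = d then f else 0) else 0) else 0) +
          if c = hi k then q • tau Φ a (lo k) else 0 := by
      have hk := (lo_lt_hi k).ne'
      by_cases h : c = hi k
      · subst h
        simp only [if_true, smul_add, kap, hk, if_false]
      · simp [h, Ne.symm h]
    rw [e5, e6, ← e3]
    module

end P

/-! ### Stability of the image of $\mathscr{PD}$ under the adjoint action of $E_kK_k^{-1}$. -/

namespace PD
variable {m n : ℕ}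

theorem induction_on {C : PD m n → Prop} (D : PD m n) (halg : ∀ r, C (algebraMap Kq _ r))
    (ht : ∀ i j, C (t i j)) (hd : ∀ i j, C (d i j)) (hmul : ∀ D D', C D → C D' → C (D * D'))
    (hadd : ∀ D D', C D → C D' → C (D + D')) : C D := by
  obtain ⟨x, rfl⟩ := RingQuot.mkAlgHom_surjective Kq (PDRel m n) D
  change C (mk m n x)
  induction x using FreeAlgebra.induction with
  | grade0 r => rw [AlgHom.commutes]; exact halg r
  | grade1 g =>
    cases g with
    | t i j => exact ht i j
    | d i j => exact hd i j
  | mul x y hx hy => rw [map_mul]; exact hmul _ _ hx hy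
  | add x y hx hy => rw [map_add]; exact hadd _ _ hx hy

/-- The operators on `𝒫` that come from `𝒫𝒟` are stable under the adjoint action of
`E_k K_k⁻¹`. -/
theorem adjoint_mem_range (k : Fin (m - 1)) (D : PD m n) :
    ∃ D' D'' : PD m n, (∀ f, P.torus n (P.kapInv k) (phi m n D (P.torus n (P.kap k) f)) =
        phi m n D' f) ∧
      ∀ f, P.opEK n k (phi m n D f) - phi m n D' (P.opEK n k f) = phi m n D'' f := by
  have hκ : P.kapInv k * P.kap k = 1 := by rw [mul_comm, P.kap_mul_kapInv]
  have hκ' (f : P m n) : P.torus n (P.kapInv k) (P.torus n (P.kap k) f) = f := by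
    rw [P.torus_torus, hκ, P.torus_const_one]
  induction D using induction_on with
  | halg r =>
    exact ⟨algebraMap Kq _ r, 0, fun f => by simp [Module.algebraMap_end_apply, hκ'],
      fun f => by simp [Module.algebraMap_end_apply]⟩
  | ht i j =>
    refine ⟨P.kapInv k i • t i j, if i = lo k then -t (hi k) j else 0, fun f => ?_, fun f => ?_⟩
    · simp [Uq.torus_single, hκ']
    · rw [phi_t, P.opEK_t]
      split_ifs <;> simp
  | hd i j =>
    refine ⟨P.kap k i • d i j, if i = hi k then q • d (lo k) j else 0, fun f => ?_, fun f => ?_⟩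
    · have h1 := P.torus_del (P.kapInv_ne_zero k) (P.torus n (P.kap k) f) i j
      rw [hκ', phi_d] at *
      rw [map_smul, LinearMap.smul_apply, phi_d, ← h1, smul_smul, ← Pi.mul_apply,
        P.kap_mul_kapInv, Pi.one_apply, one_smul]
    · rw [phi_d, P.opEK_del]
      split_ifs <;> simp
  | hmul D₁ D₂ h₁ h₂ =>
    obtain ⟨A₁, B₁, a₁, b₁⟩ := h₁
    obtain ⟨A₂, B₂, a₂, b₂⟩ := h₂
    -- The twisted Leibniz rule $\mathrm{ad}_X(D_1D_2) = \mathrm{ad}_X(D_1)D_2 +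
    -- (K_k^{-1}D_1K_k)\,\mathrm{ad}_X(D_2)$. It is the reason for carrying the conjugate
    -- $K_k^{-1}DK_k$ along in the induction.
    refine ⟨A₁ * A₂, B₁ * D₂ + A₁ * B₂, fun f => ?_, fun f => ?_⟩
    · simp only [map_mul, Module.End.mul_apply, ← a₁, ← a₂]
      rw [P.torus_torus (P.kap k), P.kap_mul_kapInv, P.torus_const_one]
    · simp only [map_mul, map_add, Module.End.mul_apply, LinearMap.add_apply, ← b₁, ← b₂, map_sub]
      abel
  | hadd D₁ D₂ h₁ h₂ =>
    obtain ⟨A₁, B₁, a₁, b₁⟩ := h₁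
    obtain ⟨A₂, B₂, a₂, b₂⟩ := h₂
    refine ⟨A₁ + A₂, B₁ + B₂, fun f => ?_, fun f => ?_⟩
    · simp only [map_add, LinearMap.add_apply, ← a₁, ← a₂]
    · simp only [map_add, LinearMap.add_apply, ← b₁, ← b₂]
      abel

end PD

/-! ### A column of the triangular $L$-operator. -/

namespace P
variable {m n : ℕ}

/-- The operators by which the entries `c` of the `a`-th column of the triangular
`L`-operator act. -/
def opL (n : ℕ) (a : Fin m) : ℕ → Module.End Kq (P m n)
  | 0 => if 0 = a.1 then (torus n (kw a)).toLinearMap else 0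
  | c + 1 => if c + 1 = a.1 then (torus n (kw a)).toLinearMap else
      if h : c + 1 < m then
        q • (opL n a c * opEK n ⟨c, Nat.lt_sub_of_add_lt h⟩) -
          opEK n ⟨c, Nat.lt_sub_of_add_lt h⟩ * opL n a c
      else 0

theorem opL_self (a : Fin m) : opL n a a = (torus n (kw a)).toLinearMap := by
  obtain ⟨a, ha⟩ := a
  cases a <;> simp [opL]

/-- The case `hi k = a` is excluded because there the recursion starts afresh: the $q$-commutator of
the vanishing entry at `lo k` would be $0$, while the diagonal entry is $K_{\varepsilon_a}$. -/
theorem opL_succ {a : Fin m} {k : Fin (m - 1)} (h : hi k ≠ a) (f : P m n) :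
    opL n a (hi k) f = q • opL n a (lo k) (opEK n k f) - opEK n k (opL n a (lo k) f) := by
  have h1 : k.1 + 1 ≠ a.1 := fun h' => h (Fin.ext h')
  have h2 : k.1 + 1 < m := (hi k).2
  show opL n a (k.1 + 1) f = q • opL n a k.1 (opEK n k f) - opEK n k (opL n a k.1 f)
  rw [opL, if_neg h1, dif_pos h2]
  rfl

/-- Induction along the positions `1, …, m`. -/
theorem pos_induction {C : Fin m → Prop} (h0 : ∀ a : Fin m, a.1 = 0 → C a)
    (hs : ∀ k : Fin (m - 1), C (lo k) → C (hi k)) (a : Fin m) : C a := by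
  obtain ⟨a, ha⟩ := a
  induction a with
  | zero => exact h0 _ rfl
  | succ a ih => exact hs ⟨a, by omega⟩ (ih (by omega))

theorem opL_eq_zero {a : Fin m} (c : Fin m) : c < a → opL n a c = 0 := by
  induction c using pos_induction with
  | h0 c hc =>
    intro h
    rw [hc, opL, if_neg]
    rw [Fin.lt_def] at h; omega
  | hs k ih =>
    intro h
    have := ih ((lo_lt_hi k).trans h)
    ext f
    rw [opL_succ h.ne, this]
    simp

/-- An entry below the diagonal is a $q$-commutator with $E_kK_k^{-1}$, which kills $1$. -/
theorem opL_one (a : Fin m) (c : Fin m) : opL n a c 1 = if c = a then 1 else 0 := by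
  by_cases h : c = a
  · subst h; simp [opL_self]
  rw [if_neg h]
  revert h
  induction c using pos_induction with
  | h0 c hc =>
    intro h
    rw [hc, opL, if_neg (fun h' => h (Fin.ext (hc.trans h')))]; rfl
  | hs k ih =>
    intro h
    rw [opL_succ h, opEK_one, map_zero, smul_zero, zero_sub, neg_eq_zero]
    by_cases h' : lo k = a
    · rw [h', opL_self, AlgHom.toLinearMap_apply, torus_one, opEK_one]
    · rw [ih h', map_zero]

/-- The entry at $c$ is built from $K_{\varepsilon_a}$ and from the $E_lK_l^{-1}$ with `hi l` at
most $c$. If $c$ lies before `lo k`, none of these roots is equal or adjacent to $k$. -/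
theorem opL_opEK_far {a : Fin m} (k : Fin (m - 1)) (c : Fin m) : c < lo k → ∀ f : P m n,
    opL n a c (opEK n k f) = opEK n k (opL n a c f) := by
  intro h f
  rcases lt_or_ge c a with h1 | h1
  · simp [opL_eq_zero c h1]
  have h0 : ∀ f : P m n, a < lo k → opL n a a (opEK n k f) = opEK n k (opL n a a f) := by
    intro f h
    have := torus_opEK (kw a) k f
    rw [opL_self]
    simpa [kw, h.ne', (h.trans (lo_lt_hi k)).ne'] using this
  revert h h1 f
  induction c using pos_induction with
  | h0 c hc =>
    intro h f h1
    have : c = a := Fin.ext (by rw [Fin.le_def] at h1; omega)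
    subst this
    exact h0 f h
  | hs l ih =>
    intro h f h1
    by_cases h2 : hi l = a
    · rw [h2] at h ⊢; exact h0 f h
    · have h3 : lo l < lo k := (lo_lt_hi l).trans h
      have h4 : a ≤ lo l := by
        simp only [lo, hi, Fin.lt_def, Fin.le_def, Fin.ext_iff] at *; omega
      have h5 : l ≠ k := fun h => h3.ne (by rw [h])
      have h6 : ¬ Adj l k := by
        simp only [Adj, lo, hi, Fin.lt_def] at *; omega
      rw [opL_succ h2, opL_succ h2, opEK_far h5 h6, ih h3 _ h4, ih h3 _ h4, map_sub, map_smul,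
        opEK_far h5 h6]

/-- This is the comultiplication of a column of an $L$-operator, in the form of an exchange rule:
the entries pass through $t_{b,d}$ by a triangular $R$-matrix in the row index. Only this rule and
the values at $1$ enter the later contractions, so those need no further property of the entries. -/
theorem opL_t (a : Fin m) (c : Fin m) : ∀ (b : Fin m) (d : Fin n) (f : P m n),
    opL n a c (t b d * f) = (if b = c then q⁻¹ else 1) • (t b d * opL n a c f) -
      if b < c then qh • (t c d * opL n a b f) else 0 := by
  have hq := q_ne_zero
  have hself : ∀ (b : Fin m) (d : Fin n) (f : P m n),
      opL n a a (t b d * f) = (if b = a then q⁻¹ else 1) • (t b d * opL n a a f) -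
      if b < a then qh • (t a d * opL n a b f) else 0 := by
    intro b d f
    have : (if b < a then qh • (t a d * opL n a b f) else 0) = 0 := by
      split_ifs with h
      · simp [opL_eq_zero b h]
      · rfl
    rw [this, sub_zero, opL_self]
    simp [Uq.torus_single, kw]
  induction c using pos_induction with
  | h0 c hc =>
    intro b d f
    by_cases h : c = a
    · subst h; exact hself b d f
    · have h1 : c < a := by
        rw [Fin.lt_def]; have : c.1 ≠ a.1 := fun h' => h (Fin.ext h'); omega
      have h2 : ¬ b < c := by rw [Fin.lt_def]; omega
      simp [opL_eq_zero c h1, h2]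
  | hs k ih =>
    intro b d f
    by_cases h : hi k = a
    · rw [h]; exact hself b d f
    have hk := lo_lt_hi k
    have hfar := opL_opEK_far (n := n) (a := a) k b
    simp only [opL_succ h, opEK_t, map_add, map_sub, map_smul, ih]
    -- For $b$ before `lo k`, the correction term at `lo k` is carried to `hi k`, and its remainders
    -- cancel because the entry at $b$ commutes with $E_kK_k^{-1}$. For $b$ equal to `lo k`, the
    -- correction is new and has coefficient $-q+q^{-1}$. For later $b$ there is none.
    rcases lt_trichotomy b (lo k) with h1 | h1 | h1
    · have h2 := h1.trans hk
      simp only [h1, h2, h1.ne, h2.ne, if_true, if_false, opEK_t, map_smul, map_zero, hfar h1,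
        kapInv, mul_sub, mul_smul_comm]
      match_scalars <;> field_simp <;> ring
    · subst h1
      simp only [if_true, if_false, hk.ne, hk.ne', hk, hk.not_gt, lt_irrefl, kapInv, map_neg,
        map_zero, ih, mul_sub, mul_smul_comm, qh]
      match_scalars <;> field_simp <;> ring
    · have h2 : ¬ b < hi k := by
        simp only [lo, hi, Fin.lt_def] at *; omega
      simp only [h1.ne', h1.not_gt, h2, if_false, map_zero, kapInv, mul_sub, mul_smul_comm]
      split_ifs <;> match_scalars <;> field_simp

/-- The entry at $c$ moves one unit of row degree from row $a$ to row $c$. -/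
theorem torus_opL (a : Fin m) (γ : Fin m → Kq) (f : P m n) : ∀ c : Fin m,
    γ a • torus n γ (opL n a c f) = γ c • opL n a c (torus n γ f) := by
  induction f using induction_on with
  | h1 =>
    intro c
    rw [torus_one, opL_one]
    split_ifs with h
    · rw [h, torus_one]
    · simp
  | hadd f g hf hg => intro c; simp only [map_add, smul_add, hf, hg]
  | hsmul r f hf => intro c; simp only [map_smul, smul_comm _ r, hf]
  | ht b d f hf =>
    intro c
    have e1 := congrArg (fun x => γ b • (t b d * x)) (hf c)
    have e2 := congrArg (fun x => γ c • (t c d * x)) (hf b)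
    simp only [mul_smul_comm] at e1 e2
    rw [opL_t, torus_t, map_smul, opL_t, map_sub, map_smul, torus_t]
    by_cases h : b < c
    · simp only [h, if_true, map_smul, torus_t]
      linear_combination (norm := module) (if b = c then q⁻¹ else 1 : Kq) • e1 - qh • e2
    · simp only [h, if_false, map_zero]
      linear_combination (norm := module) (if b = c then q⁻¹ else 1 : Kq) • e1

end P

/-! ### Contractions of braidings and the weights of the expansion. -/

section Braid
variable {ι M : Type} [LinearOrder ι] [Fintype ι] [AddCommGroup M] [Module Kq M]

theorem tau_sum {κ : Type} [Fintype κ] (F : κ → ι → ι → M) (a c : ι) :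
    tau (fun x y => ∑ k, F k x y) a c = ∑ k, tau (F k) a c := by
  let φ : (ι → ι → M) →ₗ[Kq] M :=
    ⟨⟨fun G => tau G a c, fun G H => tau_add G H a c⟩, fun r G => tau_smul r G a c⟩
  have h := map_sum φ F Finset.univ
  refine Eq.trans ?_ h
  show tau _ a c = tau _ a c
  congr 1; funext x y
  simp

/-- A contraction turns the mixed braid operator into the braid operator. -/
theorem sum_tau_eq_sum_sig (H : ι → ι → ι → M) (d : ι) :
    ∑ j, tau (fun x y => H j x y) d j = ∑ y, sig (fun u v => H u v y) d y := by
  -- Both sides equal $\sum_j H_{j,d,j}$ plus a correction. On the left the whole correction sits at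
  -- $j=d$; on the right its off-diagonal part is spread over the $y>d$.
  have h1 : ∀ j, tau (fun x y => H j x y) d j = H j d j +
      if j = d then q • H d d d - H d d d + qh • gtSum d (fun x => H d x x) else 0 := by
    intro j
    by_cases h : j = d
    · subst h; rw [tau_self, if_pos rfl]; abel
    · rw [tau_ne _ (Ne.symm h), if_neg h, add_zero]
  have h2 : ∀ y, sig (fun u v => H u v y) d y = H y d y +
      ((if y = d then q • H d d d - H d d d else 0) +
        qh • if d < y then H d y y else 0) := by
    intro y
    unfold sig
    rcases lt_trichotomy d y with h | h | h
    · simp [h, h.ne, h.ne']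
    · subst h; simp
    · simp [h.ne, h.ne', h.not_gt]
  simp only [h1, h2, Finset.sum_add_distrib, ← Finset.smul_sum, Finset.sum_ite_eq',
    Finset.mem_univ, if_true, gtSum]

end Braid

/-- The weights `q^{2(m+1-c)}` of the expansion. -/
def expWt {m : ℕ} (c : Fin m) : Kq := q ^ (2 * (m - c.1))

/-- A telescoping sum, as $(q-q^{-1})q^{2s} = q^{2s+1}-q^{2s-1}$. In `opV_t` this relation leaves
the coefficient $q$ in front of the inhomogeneous term. -/
theorem qh_mul_gtSum_expWt {m : ℕ} (b : Fin m) :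
    qh * gtSum b (fun c => expWt c) = q⁻¹ * expWt b - q := by
  have hq := q_ne_zero
  -- The condition $m \le x + r$ selects the last $r$ rows, so the induction adds rows from the
  -- bottom upwards.
  have key : ∀ r ≤ m, qh * ∑ x : Fin m, (if m ≤ x.1 + r then expWt x else 0) =
      q ^ (2 * r + 1) - q := by
    intro r
    induction r with
    | zero =>
      intro _
      rw [Finset.sum_eq_zero fun x _ => if_neg (by omega)]
      simp
    | succ r ih =>
      intro hr
      have h1 : ∀ x : Fin m, (if m ≤ x.1 + (r + 1) then expWt x else 0) =
          (if m ≤ x.1 + r then expWt x else 0) +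
            if x = ⟨m - (r + 1), by omega⟩ then expWt x else 0 := by
        intro x
        simp only [Fin.ext_iff]
        by_cases h : x.1 = m - (r + 1)
        · rw [if_pos (by omega), if_neg (by omega), if_pos h, zero_add]
        · rw [if_neg h, add_zero]
          congr 1
          simp only [eq_iff_iff]; omega
      have h2 : expWt (⟨m - (r + 1), by omega⟩ : Fin m) = q ^ (2 * (r + 1)) := by
        simp only [expWt]; congr 2; omega
      simp only [h1, Finset.sum_add_distrib, mul_add qh, Finset.sum_ite_eq', Finset.mem_univ,
        if_true, h2]
      rw [ih (by omega), qh]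
      field_simp; ring
  have h := key (m - (b.1 + 1)) (by omega)
  have h1 : gtSum b (fun c => expWt c) =
      ∑ x : Fin m, (if m ≤ x.1 + (m - (b.1 + 1)) then expWt x else 0) := by
    refine Finset.sum_congr rfl fun x _ => ?_
    congr 1
    rw [Fin.lt_def, eq_iff_iff]; omega
  have h2 : expWt b = q ^ (2 * (m - (b.1 + 1))) * q ^ 2 := by
    rw [expWt, ← pow_add]; congr 1; omega
  rw [h1, h, h2]
  field_simp
  ring

/-- The coefficient of $\Phi_x$ on the left is $q\,w_x + (q-q^{-1})\sum_{b<c<x}w_c$, and the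
telescoping relation makes it independent of $x$. This is the cancellation of the row braiding of
the derivatives against the $R$-matrix of the `opL`. -/
theorem expWt_cancel {m : ℕ} {M : Type} [AddCommGroup M] [Module Kq M] (b : Fin m)
    (Φ : Fin m → M) :
    gtSum b (fun c => expWt c • (q • Φ c + qh • gtSum c Φ)) = (q⁻¹ * expWt b) • gtSum b Φ := by
  have hx : ∀ x, b < x → qh * midSum b x (fun c => expWt c) = q⁻¹ * expWt b - q * expWt x := by
    intro x hx
    have h1 := qh_mul_gtSum_expWt b
    have h2 := qh_mul_gtSum_expWt x
    rw [gtSum_split hx] at h1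
    have h3 : qh = q - q⁻¹ := rfl
    linear_combination h1 - h2 - expWt x * h3
  -- The double sum over $b<c<x$ is reordered so that $\Phi_x$ is collected first.
  have hs : gtSum b (fun c => expWt c • (qh • gtSum c Φ)) =
      gtSum b (fun x => (qh * midSum b x (fun c => expWt c)) • Φ x) := by
    simp only [gtSum, midSum, Finset.smul_sum, Finset.mul_sum, Finset.sum_smul]
    have e1 : ∀ c : Fin m, (if b < c then ∑ x, expWt c • qh • (if c < x then Φ x else 0) else 0) =
        ∑ x, if b < c ∧ c < x then (qh * expWt c) • Φ x else 0 := by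
      intro c
      by_cases h : b < c
      · rw [if_pos h]
        refine Finset.sum_congr rfl fun x _ => ?_
        by_cases h' : c < x <;> simp [h, h', smul_smul, mul_comm]
      · simp [h]
    rw [Finset.sum_congr rfl fun c _ => e1 c, Finset.sum_comm]
    refine Finset.sum_congr rfl fun x _ => ?_
    by_cases h : b < x
    · rw [if_pos h]
      refine Finset.sum_congr rfl fun c _ => ?_
      split_ifs <;> simp
    · rw [if_neg h]
      exact Finset.sum_eq_zero fun c _ => if_neg fun h' => h (h'.1.trans h'.2)
  simp only [smul_add]
  rw [gtSum_add, hs, ← gtSum_add, ← gtSum_smul]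
  unfold gtSum
  refine Finset.sum_congr rfl fun x _ => ?_
  split_ifs with h
  · beta_reduce
    rw [hx x h]; module
  · rfl

/-! ### Contraction of $t$, $\partial$ and $L$, and its evaluation. -/

namespace P
variable {m n : ℕ}

/-- The derivatives contracted with the `a`-th column of the `L`-operator. -/
def opV (a : Fin m) (j : Fin n) : P m n →ₗ[Kq] P m n :=
  ∑ c : Fin m, expWt c • (del c j ∘ₗ opL n a c)

theorem opV_apply (a : Fin m) (j : Fin n) (f : P m n) :
    opV a j f = ∑ c : Fin m, expWt c • del c j (opL n a c f) := by
  simp [opV]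

/-- After the weighted contraction over $c$, the row index of $\partial_{c,j}$ no longer braids with
that of $t_{b,d}$; only the column braiding is left. The inhomogeneous term gets the coefficient
$q^{-1}w_b - (q-q^{-1})\sum_{c>b}w_c = q$. -/
theorem opV_t (a b : Fin m) (j d : Fin n) (f : P m n) :
    opV a j (t b d * f) = (if d = j then q • opL n a b f else 0) +
      tau (fun d' j' => t b d' * opV a j' f) d j := by
  have hq := q_ne_zero
  -- `Ψ y x c` is the column-braided form of $t_{x,d}\,\partial_{c,j}L_y f$, with the row braiding
  -- still to be applied. The terms `Ψ c b c` give the result, and all terms `Ψ b x x` have to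
  -- cancel.
  let Ψ : Fin m → Fin m → Fin m → P m n := fun (y x c : Fin m) =>
    tau (fun d' j' => t x d' * del c j' (opL n a y f)) d j
  have h1 : tau (fun d' j' => t b d' * opV a j' f) d j = ∑ c, expWt c • Ψ c b c := by
    simp only [opV_apply, Finset.mul_sum, mul_smul_comm, Ψ]
    rw [tau_sum]
    exact Finset.sum_congr rfl fun c _ => tau_smul _ _ _ _
  have h2 : ∀ x y c : Fin m, del c j (t x d * opL n a y f) =
      (if x = c then (if d = j then opL n a y f else 0) else 0) + tau (Ψ y) x c :=
    fun x y c => del_t_mul x c d j _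
  let δ : P m n := if d = j then opL n a b f else 0
  -- For $c=b$ the diagonal row braiding of $t_b\partial_b$ adds a tail over $x>b$. For $c>b$ the
  -- correction term of `opL_t` contributes $t_{c,d}L_b$, again with a diagonal braiding.
  have h3 : ∀ c : Fin m, del c j (opL n a c (t b d * f)) = Ψ c b c +
      ((if c = b then q⁻¹ • δ + (q⁻¹ * qh) • gtSum b (fun x => Ψ b x x) else 0) -
        if b < c then qh • (δ + (q • Ψ b c c + qh • gtSum c (fun x => Ψ b x x))) else 0) := by
    intro c
    rw [opL_t, map_sub, map_smul, h2]
    rcases lt_trichotomy b c with h | h | h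
    · simp only [h, h.ne, h.ne', if_true, if_false, map_smul, h2, tau_self, tau_ne _ h.ne, one_smul,
        δ]
      module
    · subst h
      simp only [lt_irrefl, if_true, if_false, tau_self, map_zero, δ]
      match_scalars <;> field_simp
    · simp only [h.ne, h.ne', h.not_gt, if_false, map_zero, tau_ne _ h.ne', one_smul]
      module
  have h4 := expWt_cancel b (fun x => Ψ b x x)
  have h5 := qh_mul_gtSum_expWt b
  have h6 : ∑ c, expWt c • (if b < c then
      qh • (δ + (q • Ψ b c c + qh • gtSum c (fun x => Ψ b x x))) else 0) =
      (qh * gtSum b (fun c => expWt c)) • δ +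
        qh • gtSum b (fun c => expWt c • (q • Ψ b c c + qh • gtSum c (fun x => Ψ b x x))) := by
    have : ∀ c, expWt c • (if b < c then
      qh • (δ + (q • Ψ b c c + qh • gtSum c (fun x => Ψ b x x))) else 0) =
      (qh * (if b < c then expWt c else 0)) • δ +
        qh • (if b < c then
          expWt c • (q • Ψ b c c + qh • gtSum c (fun x => Ψ b x x)) else 0) := by
      intro c; split_ifs
      · module
      · simp
    rw [Finset.sum_congr rfl fun c _ => this c, Finset.sum_add_distrib, ← Finset.sum_smul,
      ← Finset.mul_sum, ← Finset.smul_sum]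
    rfl
  rw [opV_apply, h1]
  simp only [h3, smul_add, smul_sub, Finset.sum_add_distrib, Finset.sum_sub_distrib]
  have h7 : ∑ c, expWt c • (if c = b then
      q⁻¹ • δ + (q⁻¹ * qh) • gtSum b (fun x => Ψ b x x) else 0) =
      expWt b • (q⁻¹ • δ + (q⁻¹ * qh) • gtSum b (fun x => Ψ b x x)) := by
    simp [smul_ite]
  simp only [smul_add] at h6 h7 h4
  have h8 : (if d = j then q • opL n a b f else 0) = q • δ := by
    simp only [δ]; split_ifs <;> simp
  rw [h8, h6, h7, h4, h5]
  module

/-- The product of the quantum matrix of the `t_{i,j} ∂_{c,j}` with the `a`-th column of the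
`L`-operator. -/
def opZ (n : ℕ) (a i : Fin m) : P m n →ₗ[Kq] P m n :=
  q • opL n a i + qh • ∑ j : Fin n, LinearMap.mulLeft Kq (t i j) ∘ₗ opV a j

theorem opZ_apply (a i : Fin m) (f : P m n) :
    opZ n a i f = q • opL n a i f + qh • ∑ j : Fin n, t i j * opV a j f := by
  simp [opZ]

theorem opV_one (a : Fin m) (j : Fin n) : opV a j (1 : P m n) = 0 := by
  rw [opV_apply]
  refine Finset.sum_eq_zero fun c _ => ?_
  rw [opL_one]
  split_ifs <;> simp [del_one]

/-- The correction in `opL_t` is present for $b<i$, whereas the inhomogeneous term of `opV_t` is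
present for all $b$. Their sum cancels for $b<i$ and survives for $b\ge i$, which is the pattern of
the row braiding `sig`. -/
theorem opZ_t (a i b : Fin m) (d : Fin n) (f : P m n) :
    opZ n a i (t b d * f) = sig (fun u v => t u d * opZ n a v f) i b := by
  have hq := q_ne_zero
  have hP := (isQuad_iff _).1 (isQuad_t (m := m) (n := n))
  have h1 : ∑ j : Fin n, t i j * opV a j (t b d * f) = q • (t i d * opL n a b f) +
      sig (fun u v => t u d * ∑ y, t v y * opV a y f) i b := by
    simp only [opV_t, mul_add, Finset.sum_add_distrib]
    congr 1
    · simp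
    · have e1 : ∀ j, t i j * tau (fun d' j' => t b d' * opV a j' f) d j =
          tau (fun d' j' => t i j * (t b d' * opV a j' f)) d j :=
        fun j => tau_map (LinearMap.mulLeft Kq (t i j)) _ d j
      simp only [e1]
      -- Summing over the common column index $j$ of $t_{i,j}$ and `opV a j` replaces the mixed
      -- braiding by the braiding of two $t$'s.
      rw [sum_tau_eq_sum_sig (fun u v y => t i u * (t b v * opV a y f)) d]
      have e2 : ∀ y, sig (fun u v => t i u * (t b v * opV a y f)) d y =
          sig (fun u v => t u d * (t v y * opV a y f)) i b := by
        intro y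
        -- The relations of $\mathscr P$ say that braiding the columns of $t\,t$ equals braiding its
        -- rows.
        have e3 := congrArg (LinearMap.mulRight Kq (opV a y f)) (hP i d b y)
        rw [sig_map, sig_map] at e3
        simpa only [LinearMap.mulRight_apply, mul_assoc] using e3.symm
      simp only [e2, Finset.mul_sum]
      unfold sig
      split_ifs <;> simp [Finset.smul_sum, Finset.sum_add_distrib]
  rw [opZ_apply, h1, opL_t]
  simp only [opZ_apply, sig, qh]
  rcases lt_trichotomy i b with h | h | h
  · simp only [h, h.ne, h.ne', h.not_gt, if_true, if_false, mul_add, mul_smul_comm]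
    module
  · subst h
    simp only [lt_irrefl, if_true, if_false, mul_add, mul_smul_comm]
    match_scalars <;> field_simp <;> ring
  · simp only [h, h.ne, h.ne', h.not_gt, if_true, if_false, mul_add, mul_smul_comm]
    module

/-- The recursion `opZ_t` expresses the value at $i$ through the indices $i$ and $b>i$ only, so the
range $i\ge a$ is closed under it. There the initial values at $1$ vanish except at $a$, and the
operator at $a$ just multiplies by $q$ whenever it passes a generator of row $a$. -/
theorem opZ_eq (a : Fin m) (f : P m n) : ∀ i, a ≤ i →
    opZ n a i f = if i = a then q • torus n (kwInv a) f else 0 := by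
  induction f using induction_on with
  | h1 =>
    intro i _
    rw [opZ_apply, opL_one]
    split_ifs <;> simp [opV_one]
  | hadd f g hf hg =>
    intro i hi
    rw [map_add, hf i hi, hg i hi]
    split_ifs <;> simp
  | hsmul r f hf =>
    intro i hi
    rw [map_smul, hf i hi]
    split_ifs
    · rw [map_smul, smul_comm]
    · exact smul_zero r
  | ht b d f hf =>
    intro i hi
    rw [opZ_t, sig, torus_t]
    rcases eq_or_ne i b with h | h
    · subst h
      rw [if_pos rfl, hf i hi]
      split_ifs with h'
      · subst h'; rw [kwInv, if_pos rfl, mul_smul_comm]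
      · simp
    · rw [if_neg h, hf i hi]
      -- Here $b>i\ge a$, so the term at $b$ vanishes by the induction hypothesis.
      have : (if i < b then qh • (t i d * opZ n a b f) else 0) = 0 := by
        split_ifs with h'
        · rw [hf b (hi.trans h'.le), if_neg (hi.trans_lt h').ne', mul_zero, smul_zero]
        · rfl
      rw [this, add_zero]
      split_ifs with h'
      · subst h'; simp [kwInv, h.symm]
      · simp

/-! ### Descending induction on the scalings. -/

/-- The row weights of `K_λ` for `λ = -∑ i ≥ a, 2 ε_i`. -/
def tailWt (a : ℕ) (b : Fin m) : Kq := if a ≤ b.1 then q ^ 2 else 1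

/-- The row weights halfway between those of `tailWt a` and `tailWt (a + 1)`. -/
def midWt (a : Fin m) (b : Fin m) : Kq := if b < a then 1 else if b = a then q else q ^ 2

/-- With the value $q$ on row $a$, the factors $K_{\varepsilon_a}$ and $K_{\varepsilon_a}^{-1}$
bring that row to $1$ and to $q^2$ respectively. -/
theorem kw_mul_midWt (a : Fin m) : kw a * midWt a = tailWt (a.1 + 1) := by
  have hq := q_ne_zero
  funext b
  simp only [Pi.mul_apply, kw, midWt, tailWt, Fin.lt_def, Fin.ext_iff]
  split_ifs <;> first | omega | simp [hq]

theorem kwInv_mul_midWt (a : Fin m) : kwInv a * midWt a = tailWt a.1 := by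
  funext b
  simp only [Pi.mul_apply, kwInv, midWt, tailWt, Fin.lt_def, Fin.ext_iff]
  split_ifs <;> first | omega | simp [sq]

/-- The evaluation of `opZ` at $i=a$, composed on the right with `midWt a`. It links two consecutive
tail scalings. -/
theorem torus_tailWt (a : Fin m) (f : P m n) :
    q • torus n (tailWt a.1) f = q • torus n (tailWt (a.1 + 1)) f +
      qh • ∑ j : Fin n, t a j * ∑ c : Fin m,
        expWt c • del c j (opL n a c (torus n (midWt a) f)) := by
  have h := opZ_eq a (torus n (midWt a) f) a le_rfl
  rw [if_pos rfl, torus_torus, kwInv_mul_midWt, opZ_apply, opL_self, AlgHom.toLinearMap_apply,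
    torus_torus, kw_mul_midWt] at h
  rw [← h]
  simp only [opV_apply]

/-- The recursion of the `opL`, composed with `midWt a`, is the negative of the adjoint action of
$E_kK_k^{-1}$. Starting from $c=a$, where the operator is the previous tail scaling, one never
leaves the image of $\mathscr{PD}$. -/
theorem opL_midWt_mem_range (a : Fin m)
    (h : ∃ D : PD m n, ∀ f, torus n (tailWt (a.1 + 1)) f = PD.phi m n D f) (c : Fin m) :
    ∃ D : PD m n, ∀ f, opL n a c (torus n (midWt a) f) = PD.phi m n D f := by
  have hq := q_ne_zero
  have hself : ∃ D : PD m n, ∀ f, opL n a a (torus n (midWt a) f) = PD.phi m n D f := by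
    obtain ⟨D, hD⟩ := h
    refine ⟨D, fun f => ?_⟩
    rw [opL_self, AlgHom.toLinearMap_apply, torus_torus, kw_mul_midWt, hD]
  have hzero : ∀ c < a, ∃ D : PD m n, ∀ f, opL n a c (torus n (midWt a) f) = PD.phi m n D f :=
    fun c hc => ⟨0, fun f => by simp [opL_eq_zero c hc]⟩
  induction c using pos_induction with
  | h0 c hc =>
    by_cases h : c = a
    · subst h; exact hself
    · refine hzero c ?_
      rw [Fin.lt_def]; have : c.1 ≠ a.1 := fun h' => h (Fin.ext h'); omega
  | hs k ih =>
    have hk := lo_lt_hi k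
    by_cases h1 : hi k = a
    · rw [h1]; exact hself
    by_cases h2 : hi k < a
    · exact hzero _ h2
    have h3 : a ≤ lo k := by
      simp only [lo, hi, Fin.lt_def, Fin.le_def, Fin.ext_iff] at *; omega
    obtain ⟨D, hD⟩ := ih
    obtain ⟨D', D'', h', h''⟩ := PD.adjoint_mem_range k D
    -- $D'$ is $K_k^{-1}DK_k$ and $D''$ is the adjoint action on $D$. The claim becomes
    -- $q\,L\,X\,\mu = K_k^{-1}L\,\mu\,K_k\,X$, with $L$ the entry at `lo k`, $X = E_kK_k^{-1}$ and
    -- $\mu$ the scaling `midWt a`.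
    refine ⟨-D'', fun f => ?_⟩
    rw [map_neg, LinearMap.neg_apply, ← h'', ← h', ← hD, ← hD, neg_sub, opL_succ h1]
    congr 1
    have e1 := torus_opL a (kapInv k) (torus n (midWt a) (torus n (kap k) (opEK n k f))) (lo k)
    have e2 : torus n (kapInv k) (torus n (midWt a) (torus n (kap k) (opEK n k f))) =
        torus n (midWt a) (opEK n k f) := by
      rw [torus_torus, torus_torus, mul_comm, ← mul_assoc, kap_mul_kapInv, one_mul]
    have e3 := torus_opEK (midWt a) k f
    have e4 : kapInv k (lo k) = q := if_pos rfl
    rw [e2, e4] at e1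
    -- The factor $q$ has two sources. If `lo k` is $a$, then $K_k^{-1}$ commutes with $L$, and $\mu
    -- X = qX\mu$ because the weight of $\mu$ jumps from $q$ to $q^2$. If `lo k` is after $a$, then
    -- $\mu$ commutes with $X$, and moving $K_k^{-1}$ past $L$ gives $q$.
    rcases h3.eq_or_lt with h4 | h4
    · have e5 : midWt a (lo k) = q := by simp [midWt, ← h4]
      have e6 : midWt a (hi k) = q * q := by
        rw [h4]; simp [midWt, hk.ne', hk.not_gt, sq]
      rw [e5, e6, mul_smul] at e3
      rw [h4, e4] at e1
      rw [← map_smul, ← smul_right_injective _ hq e3, ← h4]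
      rw [← h4] at e1
      exact (smul_right_injective _ hq e1).symm
    · have h5 := h4.trans hk
      have e5 : midWt a (lo k) = q ^ 2 := by simp [midWt, h4.ne', h4.not_gt]
      have e6 : midWt a (hi k) = q ^ 2 := by simp [midWt, h5.ne', h5.not_gt]
      have e7 : kapInv k a = 1 := by simp [kapInv, h4.ne, h5.ne]
      rw [e5, e6] at e3
      rw [e7, one_smul] at e1
      rw [e1, smul_right_injective _ (pow_ne_zero 2 hq) e3]

theorem exists_phi_eq_torus_tailWt (a : ℕ) :
    ∃ D : PD m n, ∀ f, torus n (tailWt a) f = PD.phi m n D f := by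
  have hq := q_ne_zero
  by_cases ha : m ≤ a
  · refine ⟨1, fun f => ?_⟩
    have : (tailWt a : Fin m → Kq) = 1 := by
      funext b
      simp [tailWt, show ¬ a ≤ b.1 by omega]
    rw [this, torus_const_one]; simp
  · have ih := exists_phi_eq_torus_tailWt (a + 1)
    choose M hM using opL_midWt_mem_range (n := n) ⟨a, by omega⟩ ih
    obtain ⟨D, hD⟩ := ih
    -- `torus_tailWt` divided by $q$, with `M c` an element of $\mathscr{PD}$ that acts as the entry
    -- at $c$ composed with `midWt a`.
    refine ⟨D + (q⁻¹ * qh) • ∑ j : Fin n, PD.t ⟨a, by omega⟩ j *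
      ∑ c : Fin m, expWt c • (PD.d c j * M c), fun f => ?_⟩
    have h := congrArg (q⁻¹ • ·) (torus_tailWt ⟨a, by omega⟩ f)
    simp only [smul_add, smul_smul, inv_mul_cancel₀ hq, one_smul, hM, hD] at h
    rw [h]
    simp [LinearMap.sum_apply, Finset.mul_sum]
termination_by m - a

end P

/-! ### The action of $K_\lambda$ as a row scaling. -/

namespace Uq
variable {m n : ℕ}

theorem phiL_K_inv (i : Fin m) :
    phiL m n ((K i)⁻¹ : (Uq m)ˣ) = P.torusHom m n (P.kwInv i) := by
  show phiL m n (mk m (UGen.gKi i)) = _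
  rw [phiL_mk, FreeAlgebra.lift_ι_apply]; rfl

/-- `K_λ` for `λ = -∑ i ≥ a, 2 ε_i` scales the rows `i ≥ a` by `q ^ 2`. -/
theorem phiL_KLam_lamTail (a : Fin m) (f : P m n) :
    phiL m n (KLam (lamTail a)) f = P.torus n (P.tailWt a.1) f := by
  -- The scaling by which the $i$-th factor of $K_\lambda$ acts: $K_{\varepsilon_i}^{-2}$ for $i\ge
  -- a$, and the identity otherwise.
  let γ (i b : Fin m) : Kq := if b = i ∧ a ≤ i then q ^ 2 else 1
  have h1 : ∀ i, phiL m n ((K i ^ lamTail a i : (Uq m)ˣ) : Uq m) = P.torusHom m n (γ i) := by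
    intro i
    by_cases h : a ≤ i
    · have h2 : (K i ^ lamTail a i : (Uq m)ˣ) = (K i)⁻¹ * (K i)⁻¹ := by
        rw [lamTail, if_pos h]; group
      have h3 : γ i = P.kwInv i * P.kwInv i := by
        funext b
        simp only [γ, P.kwInv, Pi.mul_apply, h, and_true]
        split_ifs <;> simp [sq]
      rw [h2, h3, Units.val_mul, map_mul, map_mul, phiL_K_inv]
    · have h3 : γ i = 1 := by
        funext b; simp [γ, h]
      rw [lamTail, if_neg h, h3, zpow_zero, Units.val_one, map_one, map_one]
  have h2 : phiL m n (KLam (lamTail a)) = P.torusHom m n (∏ i, γ i) := by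
    let φ : (Uq m)ˣ →* Module.End Kq (P m n) :=
      MonoidHom.comp (phiL m n).toRingHom.toMonoidHom (Units.coeHom (Uq m))
    have e : φ (List.ofFn fun i => K i ^ lamTail a i).prod = _ := map_list_prod φ _
    refine e.trans ?_
    -- $K_\lambda$ is an ordered product in a group of units not given as commutative. Its image is
    -- a product of scalings, and the pointwise weights commute, so the order may be dropped on that
    -- side.
    rw [← List.prod_ofFn, map_list_prod (P.torusHom m n), List.map_ofFn, List.map_ofFn]
    congr 2; funext i; exact h1 i
  have h3 : ∏ i, γ i = P.tailWt a.1 := by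
    funext b
    rw [Finset.prod_apply, Finset.prod_eq_single b]
    · simp only [γ, P.tailWt, Fin.le_def, true_and]
    · intro i _ hi; exact if_neg fun h => hi h.1.symm
    · simp
  rw [h2, h3, P.torusHom_apply]

end Uq

/-! ### Transposition, which exchanges $U_L$ and $U_R$. -/

namespace P
variable {m n : ℕ}

/-- The recursion `del_t_mul` treats rows and columns alike once the two mixed braidings are
interchanged, which `tau_tau_comm` allows. -/
theorem transpose_del (f : P m n) : ∀ (c : Fin m) (d : Fin n),
    transpose m n (del c d f) = del d c (transpose m n f) := by
  induction f using induction_on with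
  | h1 => intro c d; simp [del_one]
  | hadd f g hf hg => intro c d; simp only [map_add, hf, hg]
  | hsmul r f hf => intro c d; simp only [map_smul, hf]
  | ht a b f hf =>
    intro c d
    rw [map_mul (transpose m n), transpose_t, del_t_mul, del_t_mul, map_add]
    congr 1
    · split_ifs <;> simp
    · rw [tau_tau_comm]
      refine (tau_map (transpose m n).toLinearMap _ b d).trans ?_
      congr 1; funext y y'
      refine (tau_map (transpose m n).toLinearMap _ a c).trans ?_
      congr 1; funext x x'
      simp [transpose_t, hf]

end P

namespace PD
variable {m n : ℕ}

/-- Conjugation by the transposition sends the operators of $t_{i,j}$ and $\partial_{i,j}$ to those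
of $t_{j,i}$ and $\partial_{j,i}$, hence operators from $\mathscr{PD}$ to operators from
$\mathscr{PD}$. -/
theorem exists_phi_eq_transpose (D : PD n m) : ∃ D' : PD m n, ∀ f,
    P.transpose n m (phi n m D (P.transpose m n f)) = phi m n D' f := by
  induction D using induction_on with
  | halg r =>
    exact ⟨algebraMap Kq _ r, fun f => by
      simp [Module.algebraMap_end_apply, P.transpose_transpose]⟩
  | ht i j => exact ⟨t j i, fun f => by simp [P.transpose_t, P.transpose_transpose]⟩
  | hd i j => exact ⟨d j i, fun f => by simp [P.transpose_del, P.transpose_transpose]⟩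
  | hmul D₁ D₂ h₁ h₂ =>
    obtain ⟨A₁, a₁⟩ := h₁
    obtain ⟨A₂, a₂⟩ := h₂
    refine ⟨A₁ * A₂, fun f => ?_⟩
    simp only [map_mul, Module.End.mul_apply, ← a₁, ← a₂, P.transpose_transpose]
  | hadd D₁ D₂ h₁ h₂ =>
    obtain ⟨A₁, a₁⟩ := h₁
    obtain ⟨A₂, a₂⟩ := h₂
    refine ⟨A₁ + A₂, fun f => ?_⟩
    simp only [map_add, LinearMap.add_apply, ← a₁, ← a₂]

end PD

theorem phiU_tmul_one {m n : ℕ} (x : Uq m) : phiU m n (x ⊗ₜ[Kq] 1) = Uq.phiL m n x := by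
  simp [phiU]

theorem phiU_one_tmul {m n : ℕ} (x : Uq n) : phiU m n (1 ⊗ₜ[Kq] x) = Uq.phiR m n x := by
  simp [phiU]

/-! ### The closed formula for the last row. -/

namespace P
variable {m n : ℕ}

theorem torus_tailWt_last (a : Fin m) (ha : a.1 + 1 = m) (f : P m n) :
    torus n (tailWt a.1) f = f + (q ^ 2 - 1) • ∑ j : Fin n, t a j * del a j f := by
  have hq := q_ne_zero
  have h := congrArg (q⁻¹ • ·) (torus_tailWt a f)
  have h1 : (tailWt (a.1 + 1) : Fin m → Kq) = 1 := by
    funext b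
    simp [tailWt, show ¬ a.1 + 1 ≤ b.1 by omega]
  -- For the last row the column of the $L$-operator consists of its diagonal entry alone. That
  -- entry composed with `midWt a` is the identity, and the weight of the last row is $q^2$.
  have h2 : ∀ j : Fin n, ∑ c : Fin m, expWt c • del c j (opL n a c (torus n (midWt a) f)) =
      q ^ 2 • del a j f := by
    intro j
    rw [Finset.sum_eq_single a]
    · rw [opL_self, AlgHom.toLinearMap_apply, torus_torus, kw_mul_midWt, h1, torus_const_one,
        expWt, show 2 * (m - a.1) = 2 by omega]
    · intro c _ hc
      have : c < a := by
        rw [Fin.lt_def]; have : c.1 ≠ a.1 := fun h' => hc (Fin.ext h'); omega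
      simp [opL_eq_zero c this]
    · simp
  simp only [h1, h2, smul_add, smul_smul, inv_mul_cancel₀ hq, one_smul, torus_const_one,
    mul_smul_comm, ← Finset.smul_sum] at h
  rw [h]
  congr 2
  -- The constant is $q^{-1}(q-q^{-1})q^2 = q^2-1$.
  rw [qh]; field_simp

end P

end
end QWeyl

theorem mainTheorem6 (m n : ℕ) :
    (∀ a : Fin m, Uq.KLam (lamTail a) ∈ UringL m n) ∧
    (∀ b : Fin n, Uq.KLam (lamTail b) ∈ UringR m n) ∧
    (∀ a : Fin m, a.val + 1 = m →
      phiU m n (Uq.KLam (lamTail a) ⊗ₜ[Kq] (1 : Uq n)) =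
        PD.phi m n (1 + (q ^ 2 - 1) • ∑ i : Fin n, PD.t a i * PD.d a i)) := by
  refine ⟨fun a => ?_, fun b => ?_, fun a ha => ?_⟩
  · obtain ⟨D, hD⟩ := P.exists_phi_eq_torus_tailWt (m := m) (n := n) a.1
    refine ⟨D, LinearMap.ext fun f => ?_⟩
    exact (hD f).symm.trans ((Uq.phiL_KLam_lamTail a f).symm.trans
      (DFunLike.congr_fun (phiU_tmul_one _).symm f))
  · obtain ⟨D, hD⟩ := P.exists_phi_eq_torus_tailWt (m := n) (n := m) b.1
    -- $U_R$ acts by the transposed row action on $\mathscr P_{n\times m}$, so the result for rows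
    -- is applied with $m$ and $n$ exchanged and then carried back.
    obtain ⟨D', hD'⟩ := PD.exists_phi_eq_transpose D
    refine ⟨D', LinearMap.ext fun f => ?_⟩
    refine (hD' f).symm.trans (Eq.trans ?_ (DFunLike.congr_fun (phiU_one_tmul _).symm f))
    rw [Uq.phiR_apply, Uq.phiL_KLam_lamTail, hD]
  · refine LinearMap.ext fun f => ?_
    rw [phiU_tmul_one, Uq.phiL_KLam_lamTail, P.torus_tailWt_last a ha]
    simp [LinearMap.sum_apply]
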